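/- Let $n\ge 2$ and let $x$ be an indeterminate. \textbf{Groups and monoids.} Let $G(\infty,\infty,n)$ be the group of $n\times n$ monomial matrices whose nonzero entries are integral powers of $x$ with product $1$. Let $X=\{t_i\ (i\in\mathbb Z),\,s_3,\dots,s_n\}\subset G(\infty,\infty,n)$, where $t_i$ is the block $\begin{pmatrix}0&x^{-i}\\x^i&0\end{pmatrix}$ followed by the identity $I_{n-2}$ and $s_j$ is the permutation matrix exchanging the coordinates $j-1$ and $j$. Put $\lambda=\mathrm{diag}(x^{-(n-1)},x,\dots,x)$. Let $B(\infty,\infty,n)$ be the group with generators $\tilde t_0,\tilde t_1,\tilde s_3,\dots,\tilde s_n$ and relations: $\tilde s_i\tilde s_j\tilde s_i=\tilde s_j\tilde s_i\tilde s_j$ if $|i-j|=1$; $\tilde s_i\tilde s_j=\tilde s_j\tilde s_i$ if $|i-j|>1$; $\tilde s_3\tilde t_i\tilde s_3=\tilde t_i\tilde s_3\tilde t_i$; $\tilde s_j\tilde t_i=\tilde t_i\tilde s_j$ for $j\ge4$; and $\tilde s_3\tilde t_1\tilde t_0\tilde s_3\tilde t_1\tilde t_0=\tilde t_1\tilde t_0\tilde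 s_3\tilde t_1\tilde t_0\tilde s_3$ (relations involving $\tilde s_3$ are present only if $n\ge 3$). For $k\in\mathbb Z\setminus\{0\}$ let $B^{\oplus k}(\infty,\infty,n)$ be the monoid with generators $\tilde t_i$ ($i\in\mathbb Z$), $\tilde s_3,\dots,\tilde s_n$ and the same relations except the last one (with $i\in\mathbb Z$ now), which is replaced by $\tilde t_i\tilde t_{i-k}=\tilde t_j\tilde t_{j-k}$ for $i,j\in\mathbb Z$; let $B^{(k)}(\infty,\infty,n)$ be its group of fractions. \textbf{Intervals.} For a group $W$ generated as a monoid by a set $S$, with word length $\ell$, write $v\preceq w$ if $\ell(w)=\ell(v)+\ell(v^{-1}w)$ and $v\preceq_r w$ if $\ell(w)=\ell(wv^{-1})+\ell(v)$; let $[1,w]^S$ and $[1,w]^S_r$ be the corresponding intervals, $w$ being balanced if they are equal. Let $M([1,w]^S)$ be the monoid generated by symbols $\underline v$, $v\in[1,w]^S$, with relations $\underline v\,\underline u=\underline t$ whenever $vu=t$ and $\ell(v)+\ell(u)=\ell(t)$, and $\underline 1=1$. A Garside monoid $(M,\Delta)$ is a cancellative monoid $M$ with a map $L:M\to\mathbb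 N$ such that $L(fg)\ge L(f)+L(g)$ and $L(g)\ne0$ for $g\neq1$, in which any two elements have left and right gcds and lcms, and such that the left and the right divisors of $\Delta$ coincide and generate $M$ (there may be infinitely many divisors, called simples). \textbf{Statement.} \begin{enumerate} \item For $k=\pm1$, the monoid $B^{\oplus k}(\infty,\infty,n)$ embeds in its group of fractions $B^{(k)}(\infty,\infty,n)$, and $B^{(k)}(\infty,\infty,n)\cong B(\infty,\infty,n)$. \item (Shi) $B(\infty,\infty,n)$ is isomorphic to the affine Artin group $B(\widetilde A_{n-1})$. \item Hence there are two interval Garside structures for $B(\widetilde A_{n-1})$: for $k=\pm1$, $X$ generates $G(\infty,\infty,n)$ as a monoid, $\lambda^k$ is balanced, $([1,\lambda^k]^X,\preceq)$ and $([1,\lambda^k]^X_r,\preceq_r)$ are lattices, $(M([1,\lambda^k]^X),\underline{\lambda^k})$ is a Garside monoid with simples the copy $\underline{[1,\lambda^k]^X}$ of $[1,\lambda^k]^X$, $B^{\oplus k}(\infty,\infty,n)\cong M([1,\lambda^k]^X)$, and $M([1,\lambda^k]^X)$ embeds in its group of fractions, which is isomorphic to $B(\widetilde A_{n-1})$. The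 intervals $[1,\lambda]^X$ and $[1,\lambda^{-1}]^X$ are different. \item If $n\ge3$, these structures do not come from dual presentations: for $k=\pm1$ and every Coxeter element $c$ (product of the simple reflections, each taken once, in some order) of the Coxeter group of type $\widetilde A_{n-1}$ with set of all reflections $T$, the monoids $M([1,\lambda^k]^X)$ and $M([1,c]^T)$ are not isomorphic. \end{enumerate} -/

import Mathlib

open scoped LaurentPolynomial

/-! ### Garside monoids and groups of fractions -/

/-- `f` right-divides `g`. (Left-divisibility, `∃ c, g = f * c`, is Mathlib's `f ∣ g`.) -/
def RightDivides {M : Type*} [Monoid M] (f g : M) : Prop := ∃ c, c * f = g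

/-- Any two elements have a gcd and an lcm for the divisibility relation `r`. -/
def HasGcdsAndLcms {M : Type*} (r : M → M → Prop) : Prop :=
  ∀ f g : M,
    (∃ d, r d f ∧ r d g ∧ ∀ c, r c f → r c g → r c d) ∧
    (∃ m, r f m ∧ r g m ∧ ∀ c, r f c → r g c → r m c)

/-- `(M, Δ)` is a Garside monoid; the set of simples is allowed to be infinite. -/
structure IsGarsideMonoid (M : Type*) [Monoid M] (Δ : M) : Prop where
  exists_length : ∃ L : M → ℕ, (∀ f g, L f + L g ≤ L (f * g)) ∧ ∀ g, g ≠ 1 → L g ≠ 0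
  cancel : ∀ f g h k : M, h * f * k = h * g * k → f = g
  left_gcd_lcm : HasGcdsAndLcms (fun f g : M => f ∣ g)
  right_gcd_lcm : HasGcdsAndLcms (fun f g : M => RightDivides f g)
  divisors_eq : {f : M | f ∣ Δ} = {f : M | RightDivides f Δ}
  divisors_generate : Submonoid.closure {f : M | f ∣ Δ} = ⊤

/-- `ι : M → G` exhibits the group `G` as the group of fractions of the monoid `M`. -/
structure IsFractionEmbedding {M G : Type*} [Monoid M] [Group G] (ι : M →* G) : Prop where
  injective : Function.Injective ι
  right_fraction : ∀ g : G, ∃ a b : M, g = ι a * (ι b)⁻¹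
  left_fraction : ∀ g : G, ∃ a b : M, g = (ι a)⁻¹ * ι b

/-- The universal group of a monoid `M`: generated by the elements of `M`, subject to the
multiplication table of `M`. When `M` is cancellative and has common multiples, this is its group
of fractions (Ore). -/
def FractionGroup (M : Type*) [Monoid M] : Type _ :=
  PresentedGroup {r : FreeGroup M | ∃ a b : M,
    r = FreeGroup.of a * FreeGroup.of b * (FreeGroup.of (a * b))⁻¹}

instance (M : Type*) [Monoid M] : Group (FractionGroup M) :=
  inferInstanceAs (Group (PresentedGroup _))

/-- The canonical homomorphism from a monoid to its universal group. -/
def FractionGroup.of (M : Type*) [Monoid M] : M →* FractionGroup M :=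
  MonoidHom.mk' (fun a => (PresentedGroup.of a : PresentedGroup {r : FreeGroup M | ∃ a b : M,
    r = FreeGroup.of a * FreeGroup.of b * (FreeGroup.of (a * b))⁻¹}))
  fun a b => by
    have h := PresentedGroup.one_of_mem (rels := {r : FreeGroup M | ∃ a b : M,
      r = FreeGroup.of a * FreeGroup.of b * (FreeGroup.of (a * b))⁻¹}) ⟨a, b, rfl⟩
    simp only [map_mul, map_inv] at h
    exact (mul_inv_eq_one.mp h).symm

/-! ### Intervals in a group and interval Garside monoids -/

section Interval

variable {W : Type*} [Group W]

/-- The length `ℓ(w)` of `w` over `S`: the minimal length of a word over `S` representing `w`. -/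
noncomputable def wordLength (S : Set W) (w : W) : ℕ :=
  sInf {m | ∃ l : List W, (∀ x ∈ l, x ∈ S) ∧ l.prod = w ∧ l.length = m}

theorem wordLength_one (S : Set W) : wordLength S 1 = 0 :=
  Nat.sInf_eq_zero.mpr (Or.inl ⟨[], by simp, rfl, rfl⟩)

/-- The relation `v ≼ w`. -/
def Precedes (S : Set W) (v w : W) : Prop :=
  ∃ u, w = v * u ∧ wordLength S w = wordLength S v + wordLength S u

/-- The relation `v ≼_r w`. -/
def PrecedesR (S : Set W) (v w : W) : Prop :=
  wordLength S (w * v⁻¹) + wordLength S v = wordLength S w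

/-- The interval `[1, w]` for `≼`. -/
def interval (S : Set W) (w : W) : Set W := {v | Precedes S 1 v ∧ Precedes S v w}

/-- The interval `[1, w]_r` for `≼_r`. -/
def intervalR (S : Set W) (w : W) : Set W := {v | PrecedesR S 1 v ∧ PrecedesR S v w}

theorem one_precedes (S : Set W) (w : W) : Precedes S 1 w :=
  ⟨w, by simp, by simp [wordLength_one]⟩

theorem precedes_refl (S : Set W) (w : W) : Precedes S w w :=
  ⟨1, by simp, by simp [wordLength_one]⟩

theorem one_mem_interval (S : Set W) (w : W) : (1 : W) ∈ interval S w :=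
  ⟨one_precedes S 1, one_precedes S w⟩

theorem self_mem_interval (S : Set W) (w : W) : w ∈ interval S w :=
  ⟨one_precedes S w, precedes_refl S w⟩

/-- `w` is balanced. -/
def IsBalanced (S : Set W) (w : W) : Prop := interval S w = intervalR S w

/-- Defining relations of the interval monoid: `v u = t` whenever this holds in the group with
`ℓ(v) + ℓ(u) = ℓ(t)`; and the generator attached to the unit of the group is the unit. -/
inductive IntervalRel (S : Set W) (w : W) :
    FreeMonoid (interval S w) → FreeMonoid (interval S w) → Prop
  | mul (v u t : interval S w) (h : (v : W) * u = t)
      (hl : wordLength S (v : W) + wordLength S (u : W) = wordLength S (t : W)) :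
      IntervalRel S w (FreeMonoid.of v * FreeMonoid.of u) (FreeMonoid.of t)
  | one : IntervalRel S w (FreeMonoid.of ⟨1, one_mem_interval S w⟩) 1

/-- The interval monoid `M([1, w])`. -/
abbrev IntervalMonoid (S : Set W) (w : W) : Type _ := PresentedMonoid (IntervalRel S w)

/-- The map `v ↦ v̲` from `[1, w]` to `M([1, w])`. -/
def toIntervalMonoid (S : Set W) (w : W) (v : interval S w) : IntervalMonoid S w :=
  PresentedMonoid.of _ v

/-- The relation `r` is the order relation of a lattice. -/
def IsLatticeOrder {α : Type*} (r : α → α → Prop) : Prop :=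
  ∃ _ : Lattice α, ∀ a b : α, r a b ↔ a ≤ b

/-- The interval `[1, w]` over the positive generating set `S` gives an interval Garside monoid
`(M([1, w]), w̲)` with simples the copy of `[1, w]`. -/
structure IsIntervalGarside (S : Set W) (w : W) : Prop where
  generates : Submonoid.closure S = ⊤
  balanced : IsBalanced S w
  lattice_left : IsLatticeOrder (fun a b : interval S w => Precedes S (a : W) b)
  lattice_right : IsLatticeOrder (fun a b : intervalR S w => PrecedesR S (a : W) b)
  garside : IsGarsideMonoid (IntervalMonoid S w) (toIntervalMonoid S w ⟨w, self_mem_interval S w⟩)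
  simples_injective : Function.Injective (toIntervalMonoid S w)
  simples_range : Set.range (toIntervalMonoid S w) =
    {f | f ∣ toIntervalMonoid S w ⟨w, self_mem_interval S w⟩}

end Interval

/-! ### The group `G(∞,∞,n)` of monomial matrices -/

/-- The monomial matrix whose only nonzero entry in row `i` is `x ^ a i`, in column `σ i`
(here `x = T 1`). -/
noncomputable def monomialMatrix {n : ℕ} (σ : Equiv.Perm (Fin n)) (a : Fin n → ℤ) :
    Matrix (Fin n) (Fin n) ℤ[T;T⁻¹] :=
  Matrix.of fun i j => if σ i = j then LaurentPolynomial.T (a i) else 0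

theorem monomialMatrix_mul {n : ℕ} (σ τ : Equiv.Perm (Fin n)) (a b : Fin n → ℤ) :
    monomialMatrix σ a * monomialMatrix τ b =
      monomialMatrix (σ.trans τ) (fun i => a i + b (σ i)) := by
  ext1 i j
  simp only [monomialMatrix, Matrix.mul_apply, Matrix.of_apply]
  rw [Finset.sum_eq_single (σ i)]
  · simp only [if_true, Equiv.trans_apply, mul_ite, mul_zero, ← LaurentPolynomial.T_add]
    congr
  · intro b _ hb
    rw [if_neg hb.symm, zero_mul]
  · intro h
    exact absurd (Finset.mem_univ _) h

theorem monomialMatrix_one {n : ℕ} :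
    monomialMatrix (1 : Equiv.Perm (Fin n)) (fun _ => 0) = 1 := by
  ext1 i j
  simp only [monomialMatrix, Matrix.of_apply, Matrix.one_apply, Equiv.Perm.one_apply,
    LaurentPolynomial.T_zero]
  congr

theorem prod_T {n : ℕ} (a : Fin n → ℤ) :
    ∏ i, (LaurentPolynomial.T (a i) : ℤ[T;T⁻¹]) = LaurentPolynomial.T (∑ i, a i) := by
  have h : ∀ s : Finset (Fin n), ∏ i ∈ s, (LaurentPolynomial.T (a i) : ℤ[T;T⁻¹]) =
      LaurentPolynomial.T (∑ i ∈ s, a i) := fun s => by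
    induction s using Finset.induction_on with
    | empty => simp
    | insert i s hi ih => rw [Finset.prod_insert hi, Finset.sum_insert hi, ih,
        LaurentPolynomial.T_add]
  exact h _

/-- `G(∞,∞,n)`: the group of `n × n` monomial matrices whose nonzero entries are powers of the
indeterminate `x`, with product `1`. -/
noncomputable def GInf (n : ℕ) : Subgroup (Matrix (Fin n) (Fin n) ℤ[T;T⁻¹])ˣ where
  carrier := {A | ∃ (σ : Equiv.Perm (Fin n)) (a : Fin n → ℤ),
    (A : Matrix (Fin n) (Fin n) ℤ[T;T⁻¹]) = monomialMatrix σ a ∧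
      ∏ i, (LaurentPolynomial.T (a i) : ℤ[T;T⁻¹]) = 1}
  mul_mem' := by
    rintro A B ⟨σ, a, hA, ha⟩ ⟨τ, b, hB, hb⟩
    refine ⟨σ.trans τ, fun i => a i + b (σ i), ?_, ?_⟩
    · rw [Units.val_mul, hA, hB, monomialMatrix_mul]
    · simp only [LaurentPolynomial.T_add, Finset.prod_mul_distrib]
      rw [ha, Equiv.prod_comp σ (fun i => (LaurentPolynomial.T (b i) : ℤ[T;T⁻¹])), hb, one_mul]
  one_mem' := ⟨1, fun _ => 0, by rw [monomialMatrix_one, Units.val_one], by simp⟩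
  inv_mem' := by
    rintro A ⟨σ, a, hA, ha⟩
    refine ⟨σ.symm, fun i => -a (σ.symm i), ?_, ?_⟩
    · apply Units.inv_eq_of_mul_eq_one_right
      rw [hA, monomialMatrix_mul, ← monomialMatrix_one]
      congr 1
      · ext i
        simp
      · ext i
        simp
    · rw [Equiv.prod_comp σ.symm (fun i => (LaurentPolynomial.T (-a i) : ℤ[T;T⁻¹]))]
      rw [prod_T] at ha ⊢
      have h : (LaurentPolynomial.T (∑ i, -a i) : ℤ[T;T⁻¹]) *
          LaurentPolynomial.T (∑ i, a i) = 1 := by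
        rw [← LaurentPolynomial.T_add, Finset.sum_neg_distrib, neg_add_cancel,
          LaurentPolynomial.T_zero]
      rwa [ha, mul_one] at h

/-- The matrix `t_i`: the block `((0, x⁻ⁱ), (xⁱ, 0))` followed by the identity. -/
noncomputable def tMatrix (n : ℕ) (i : ℤ) : Matrix (Fin n) (Fin n) ℤ[T;T⁻¹] :=
  Matrix.of fun r c =>
    if r.val = 0 ∧ c.val = 1 then LaurentPolynomial.T (-i)
    else if r.val = 1 ∧ c.val = 0 then LaurentPolynomial.T i
    else if 2 ≤ r.val ∧ r = c then 1 else 0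

/-- The permutation matrix `s_j` exchanging the coordinates `j - 1` and `j` (numbered from `1`). -/
noncomputable def sMatrix (n j : ℕ) : Matrix (Fin n) (Fin n) ℤ[T;T⁻¹] :=
  Matrix.of fun r c =>
    if r.val + 2 = j ∧ c.val + 1 = j then 1
    else if r.val + 1 = j ∧ c.val + 2 = j then 1
    else if r.val + 2 ≠ j ∧ r.val + 1 ≠ j ∧ r = c then 1 else 0

/-- The generating set `X = {t_i (i ∈ ℤ), s_3, …, s_n}` of `G(∞,∞,n)`, for `n ≥ 2`. -/
def genX (n : ℕ) : Set (GInf n) :=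
  {g | (∃ i : ℤ, ((g : (Matrix (Fin n) (Fin n) ℤ[T;T⁻¹])ˣ) : Matrix _ _ _) = tMatrix n i) ∨
    ∃ j : ℕ, 3 ≤ j ∧ j ≤ n ∧
      ((g : (Matrix (Fin n) (Fin n) ℤ[T;T⁻¹])ˣ) : Matrix _ _ _) = sMatrix n j}

/-- The exponents on the diagonal of `λ`. -/
def lamExp (n : ℕ) (i : Fin n) : ℤ := if i.val = 0 then -((n : ℤ) - 1) else 1

theorem sum_lamExp (n : ℕ) : ∑ i, lamExp n i = 0 := by
  cases n with
  | zero => simp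
  | succ m => simp [Fin.sum_univ_succ, lamExp]

/-- The element `λ = diag(x^(-(n-1)), x, …, x)` of `G(∞,∞,n)`. -/
noncomputable def lam (n : ℕ) : GInf n :=
  ⟨{ val := monomialMatrix 1 (lamExp n)
     inv := monomialMatrix 1 (fun i => -lamExp n i)
     val_inv := by
      rw [monomialMatrix_mul, ← monomialMatrix_one]
      congr 1
      ext i
      simp
     inv_val := by
      rw [monomialMatrix_mul, ← monomialMatrix_one]
      congr 1
      ext i
      simp },
   1, lamExp n, rfl, by rw [prod_T, sum_lamExp, LaurentPolynomial.T_zero]⟩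

/-! ### The monoids `B^{⊕k}(∞,∞,n)`, the group `B(∞,∞,n)` and the affine Artin group -/

/-- The indices `3, …, n` of the generators `s̃_j`. -/
abbrev SIndex (n : ℕ) : Type := {j : ℕ // 3 ≤ j ∧ j ≤ n}

/-- Generators `t̃_i` (`i ∈ ι`) and `s̃_j` (`3 ≤ j ≤ n`). -/
inductive Gen (ι : Type) (n : ℕ) : Type
  | t (i : ι)
  | s (j : SIndex n)

section Presentations

open Gen FreeMonoid in
/-- Defining relations of the monoid `B^{⊕k}(∞,∞,n)`. -/
inductive BPlusRel (n : ℕ) (k : ℤ) : FreeMonoid (Gen ℤ n) → FreeMonoid (Gen ℤ n) → Prop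
  | braid_s (i j : SIndex n) (h : i.val + 1 = j.val ∨ j.val + 1 = i.val) :
      BPlusRel n k (of (s i) * of (s j) * of (s i)) (of (s j) * of (s i) * of (s j))
  | comm_s (i j : SIndex n) (h : i.val + 1 < j.val ∨ j.val + 1 < i.val) :
      BPlusRel n k (of (s i) * of (s j)) (of (s j) * of (s i))
  | braid_t (j : SIndex n) (hj : j.val = 3) (i : ℤ) :
      BPlusRel n k (of (s j) * of (t i) * of (s j)) (of (t i) * of (s j) * of (t i))
  | comm_t (j : SIndex n) (hj : 4 ≤ j.val) (i : ℤ) :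
      BPlusRel n k (of (s j) * of (t i)) (of (t i) * of (s j))
  | dual (i j : ℤ) :
      BPlusRel n k (of (t i) * of (t (i - k))) (of (t j) * of (t (j - k)))

/-- The monoid `B^{⊕k}(∞,∞,n)`. -/
abbrev BPlus (n : ℕ) (k : ℤ) : Type := PresentedMonoid (BPlusRel n k)

/-- `B^{(k)}(∞,∞,n)`, the group of fractions of `B^{⊕k}(∞,∞,n)`. -/
abbrev BFrac (n : ℕ) (k : ℤ) : Type := FractionGroup (BPlus n k)

open Gen FreeGroup in
/-- Defining relations of Shi's presentation of `B(∞,∞,n)`, on `t̃_0, t̃_1, s̃_3, …, s̃_n`. -/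
inductive ShiRel (n : ℕ) : FreeGroup (Gen (Fin 2) n) → FreeGroup (Gen (Fin 2) n) → Prop
  | braid_s (i j : SIndex n) (h : i.val + 1 = j.val ∨ j.val + 1 = i.val) :
      ShiRel n (of (s i) * of (s j) * of (s i)) (of (s j) * of (s i) * of (s j))
  | comm_s (i j : SIndex n) (h : i.val + 1 < j.val ∨ j.val + 1 < i.val) :
      ShiRel n (of (s i) * of (s j)) (of (s j) * of (s i))
  | braid_t (j : SIndex n) (hj : j.val = 3) (i : Fin 2) :
      ShiRel n (of (s j) * of (t i) * of (s j)) (of (t i) * of (s j) * of (t i))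
  | comm_t (j : SIndex n) (hj : 4 ≤ j.val) (i : Fin 2) :
      ShiRel n (of (s j) * of (t i)) (of (t i) * of (s j))
  | six (j : SIndex n) (hj : j.val = 3) :
      ShiRel n (of (s j) * of (t 1) * of (t 0) * of (s j) * of (t 1) * of (t 0))
        (of (t 1) * of (t 0) * of (s j) * of (t 1) * of (t 0) * of (s j))

/-- The group `B(∞,∞,n)`. -/
abbrev BInf (n : ℕ) : Type :=
  PresentedGroup {r : FreeGroup (Gen (Fin 2) n) | ∃ a b, ShiRel n a b ∧ r = a * b⁻¹}

end Presentations

/-- The Artin group of a Coxeter matrix: the braid relations of length `M i j` only. (The entry `0`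
encodes `∞`; the words are then empty and the relation is void.) -/
abbrev ArtinGroup {B : Type*} (M : CoxeterMatrix B) : Type _ :=
  PresentedGroup {r : FreeGroup B | ∃ i j : B,
    r = ((CoxeterSystem.alternatingWord i j (M i j)).map FreeGroup.of).prod *
      (((CoxeterSystem.alternatingWord j i (M i j)).map FreeGroup.of).prod)⁻¹}

/-- The Coxeter matrix of affine type `Ã_{n-1}` (`n ≥ 2`): an `n`-cycle with all labels `3` if
`n ≥ 3`, a single edge labelled `∞` (encoded by `0`) if `n = 2`. -/
def affineA (n : ℕ) : CoxeterMatrix (Fin n) where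
  M := Matrix.of fun i j =>
    if i = j then 1
    else if (i.val + 1) % n = j.val ∨ (j.val + 1) % n = i.val then (if n = 2 then 0 else 3)
    else 2
  isSymm := by
    ext i j
    simp only [Matrix.transpose_apply, Matrix.of_apply, eq_comm (a := j), or_comm]
  diagonal := by simp
  off_diagonal := by
    intro i j h
    simp only [Matrix.of_apply, if_neg h]
    split_ifs <;> simp

/-- The set of all reflections of the Coxeter group of type `Ã_{n-1}`. -/
def affineReflections (n : ℕ) : Set (affineA n).Group :=
  {r | (affineA n).toCoxeterSystem.IsReflection r}

/-- `c` is a Coxeter element of the Coxeter group of type `Ã_{n-1}`: the product of the simple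
reflections, each taken once, in some order. -/
def IsCoxeterElement (n : ℕ) (c : (affineA n).Group) : Prop :=
  ∃ σ : Equiv.Perm (Fin n), c = (List.ofFn fun i => (affineA n).simple (σ i)).prod

/-! Everything about `[1, λ^k]` rests on a closed formula for the length over `X`. Describe `g` by
its permutation and its exponents, row by row. A pair of rows `i < j` costs 1 if `g` inverts it;
otherwise it costs 0 or 2, according as the exponent in row `j` vanishes or not. The length is the
total cost: the cost is subadditive pair by pair, and every `g ≠ 1` can be lowered by a generator
(`closure_genX_and_length`). Equality in subadditivity is tested pair by pair as well, so `≼`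
becomes an explicit condition (`precedes_iff_pairLE`), and `g` lies in `[1, λ^k]` exactly when each
pair it does not invert has exponent 0 or `k` in its larger row (`mem_interval_lam`). Inverting `g`
turns this into the same condition for `-k`, whence balancedness.

If two distinct generators precede `v` in the interval, so does the common multiple given by the
defining relation of `B^{⊕k}` between them (`exists_local_lcm`). This local fact is used twice. With
balancedness it yields all joins (`exists_join`), hence a lattice. It also gives a Matsumoto
property, that reduced words of an interval element agree in `B^{⊕k}`, so `B^{⊕k}` is the interval
monoid (`nonempty_BPlus_mulEquiv`).

For any balanced lattice interval, the monoid `M([1, w])` acts on pairs (simple, element) by a rule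
extracting the largest simple divisor of a product of two simples. The rule respects the defining
relations; evaluating the action at `(1, 1)` splits each element into its greatest simple divisor
and a complement. Left cancellation, lcms and gcds follow. The right-hand properties come from the
isomorphism of `M([1, w])` with the opposite of `M([1, w⁻¹])`; this is harmless since both signs of
`k` are treated. Ore's theorem then embeds the monoid in its group of fractions.

In a group, the dual relation says that `t_{i+1} t_i` is constant (for `k = 1`), so the sequence is
determined by `t_0, t_1`, and the six-letter relation is exactly what propagates the braid relation
with `s_3` along it: the fractions form `B(∞,∞,n)`. Replacing `t_1` by its conjugate under `s_n ⋯
s_3` turns Shi's relations into those of a cycle, i.e. of `Ã_{n-1}`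
(`isShiFamily_iff_isAffineFamily`).

Finally, isomorphisms of interval monoids preserve atoms and hence length. In a dual monoid every
atom divides `c`, of length at most `n`. In `M([1, λ^k])` an element divisible by every atom has
length at least that of `λ^k`, which is `n(n-1) > n` for `n ≥ 3`. -/

section WordLength

/-! ### Word length and the prefix order in a group -/

variable {W : Type*} [Group W] {S : Set W}

theorem exists_reduced_word (hS : Submonoid.closure S = ⊤) (w : W) :
    ∃ l : List W, (∀ x ∈ l, x ∈ S) ∧ l.prod = w ∧ l.length = wordLength S w := by
  have hw : w ∈ Submonoid.closure S := by rw [hS]; trivial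
  obtain ⟨l, hl, hp⟩ := Submonoid.exists_list_of_mem_closure hw
  exact Nat.sInf_mem (s := {m | ∃ l : List W, (∀ x ∈ l, x ∈ S) ∧ l.prod = w ∧ l.length = m})
    ⟨l.length, l, hl, hp, rfl⟩

theorem wordLength_prod_le {l : List W} (hl : ∀ x ∈ l, x ∈ S) :
    wordLength S l.prod ≤ l.length :=
  Nat.sInf_le ⟨l, hl, rfl, rfl⟩

theorem wordLength_mul_le (hS : Submonoid.closure S = ⊤) (u v : W) :
    wordLength S (u * v) ≤ wordLength S u + wordLength S v := by
  obtain ⟨l, hl, rfl, hu⟩ := exists_reduced_word hS u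
  obtain ⟨m, hm, rfl, hv⟩ := exists_reduced_word hS v
  rw [← hu, ← hv, ← List.prod_append, ← List.length_append]
  exact wordLength_prod_le fun x hx => (List.mem_append.mp hx).elim (hl x) (hm x)

theorem wordLength_eq_zero_iff (hS : Submonoid.closure S = ⊤) {w : W} :
    wordLength S w = 0 ↔ w = 1 := by
  constructor
  · intro h
    obtain ⟨l, -, rfl, hw⟩ := exists_reduced_word hS w
    rw [h, List.length_eq_zero_iff] at hw
    simp [hw]
  · rintro rfl
    exact wordLength_one S

theorem wordLength_inv (hS : Submonoid.closure S = ⊤) (hinv : ∀ x ∈ S, x⁻¹ ∈ S) (w : W) :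
    wordLength S w⁻¹ = wordLength S w := by
  have key : ∀ w : W, wordLength S w⁻¹ ≤ wordLength S w := fun w => by
    obtain ⟨l, hl, rfl, hw⟩ := exists_reduced_word hS w
    rw [← hw, List.prod_inv_reverse]
    refine (wordLength_prod_le fun x hx => ?_).trans (by simp)
    simp only [List.mem_reverse, List.mem_map] at hx
    obtain ⟨y, hy, rfl⟩ := hx
    exact hinv y (hl y hy)
  exact le_antisymm (key w) (by simpa using key w⁻¹)

theorem precedes_iff {v w : W} :
    Precedes S v w ↔ wordLength S w = wordLength S v + wordLength S (v⁻¹ * w) := by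
  constructor
  · rintro ⟨u, rfl, h⟩
    simpa using h
  · intro h
    exact ⟨v⁻¹ * w, by simp, h⟩

theorem precedes_mul_right_iff {v u : W} :
    Precedes S v (v * u) ↔ wordLength S (v * u) = wordLength S v + wordLength S u := by
  simp [precedes_iff]

theorem Precedes.trans (hS : Submonoid.closure S = ⊤) {u v w : W} (h : Precedes S u v)
    (h' : Precedes S v w) : Precedes S u w := by
  obtain ⟨a, rfl, ha⟩ := h
  obtain ⟨b, rfl, hb⟩ := h'
  refine ⟨a * b, mul_assoc _ _ _, ?_⟩
  have h1 := wordLength_mul_le hS u (a * b)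
  have h2 := wordLength_mul_le hS a b
  rw [← mul_assoc] at h1
  omega

theorem Precedes.antisymm (hS : Submonoid.closure S = ⊤) {u v : W} (h : Precedes S u v)
    (h' : Precedes S v u) : u = v := by
  obtain ⟨a, rfl, ha⟩ := h
  obtain ⟨b, hb, hb'⟩ := h'
  have : a = 1 := (wordLength_eq_zero_iff hS).mp (by omega)
  simp [this]

theorem Precedes.wordLength_le {u v : W} (h : Precedes S u v) :
    wordLength S u ≤ wordLength S v := by
  rw [precedes_iff] at h
  omega

theorem Precedes.eq_of_wordLength_le (hS : Submonoid.closure S = ⊤) {u v : W}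
    (h : Precedes S u v) (hl : wordLength S v ≤ wordLength S u) : u = v := by
  obtain ⟨a, rfl, ha⟩ := h
  have : a = 1 := (wordLength_eq_zero_iff hS).mp (by omega)
  simp [this]

/-- Left translation by `x` preserves and reflects `≼` below an element for which lengths add; the
three triangle inequalities are squeezed into equalities. -/
theorem precedes_mul_left_iff (hS : Submonoid.closure S = ⊤) {x u v : W}
    (hv : wordLength S (x * v) = wordLength S x + wordLength S v) :
    Precedes S (x * u) (x * v) ∧ wordLength S (x * u) = wordLength S x + wordLength S u ↔
      Precedes S u v := by
  rw [precedes_iff, precedes_iff]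
  have h1 := wordLength_mul_le hS u (u⁻¹ * v)
  have h2 := wordLength_mul_le hS (x * u) (u⁻¹ * v)
  have h3 := wordLength_mul_le hS x u
  simp only [mul_inv_rev, mul_assoc, inv_mul_cancel_left, mul_inv_cancel_left] at *
  omega

theorem Precedes.mul_left (hS : Submonoid.closure S = ⊤) {x u v : W} (h : Precedes S u v)
    (hv : wordLength S (x * v) = wordLength S x + wordLength S v) :
    Precedes S (x * u) (x * v) :=
  ((precedes_mul_left_iff hS hv).mpr h).1

theorem Precedes.wordLength_mul (hS : Submonoid.closure S = ⊤) {x u v : W} (h : Precedes S u v)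
    (hv : wordLength S (x * v) = wordLength S x + wordLength S v) :
    wordLength S (x * u) = wordLength S x + wordLength S u :=
  ((precedes_mul_left_iff hS hv).mpr h).2

theorem mem_interval_iff {v w : W} : v ∈ interval S w ↔ Precedes S v w :=
  ⟨fun h => h.2, fun h => ⟨one_precedes S v, h⟩⟩

theorem mem_intervalR_iff {v w : W} : v ∈ intervalR S w ↔ PrecedesR S v w :=
  ⟨fun h => h.2, fun h => ⟨by simp [PrecedesR, wordLength_one], h⟩⟩

theorem mem_interval_of_precedes (hS : Submonoid.closure S = ⊤) {u v w : W}
    (h : Precedes S u v) (hv : v ∈ interval S w) : u ∈ interval S w :=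
  mem_interval_iff.mpr (h.trans hS (mem_interval_iff.mp hv))

/-- The interval for `≼` is closed under prefixes in any case, that for `≼_r` under suffixes;
balancedness gives both. This is the only way balancedness enters later arguments about quotients.
-/
theorem IsBalanced.right_mem (hS : Submonoid.closure S = ⊤) {w : W} (hb : IsBalanced S w)
    {a b : W} (h : a * b ∈ interval S w)
    (hl : wordLength S (a * b) = wordLength S a + wordLength S b) : b ∈ interval S w := by
  unfold IsBalanced at hb
  rw [hb, mem_intervalR_iff, PrecedesR] at h ⊢
  have h1 := wordLength_mul_le hS (w * (a * b)⁻¹) a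
  have h2 := wordLength_mul_le hS (w * b⁻¹) b
  simp only [mul_inv_rev, mul_assoc, inv_mul_cancel, mul_one] at *
  omega

end WordLength

/-- The interval `[1, w]` is balanced and a lattice for `≼`, over a positive generating set. -/
structure IsLeftGarsideInterval {W : Type*} [Group W] (S : Set W) (w : W) : Prop where
  generates : Submonoid.closure S = ⊤
  balanced : IsBalanced S w
  lattice : IsLatticeOrder (fun a b : interval S w => Precedes S (a : W) b)

namespace IsLeftGarsideInterval

variable {W : Type*} [Group W] {S : Set W} {w : W} (H : IsLeftGarsideInterval S w)

end IsLeftGarsideInterval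

/-! ### The interval monoid, its length and its projection to the group -/

section IntervalMonoid

variable {W : Type*} [Group W] {S : Set W} {w : W}

theorem toIntervalMonoid_mul (v u t : interval S w) (h : (v : W) * u = t)
    (hl : wordLength S (t : W) = wordLength S (v : W) + wordLength S (u : W)) :
    toIntervalMonoid S w v * toIntervalMonoid S w u = toIntervalMonoid S w t :=
  PresentedMonoid.mk_eq_mk_of_rel (IntervalRel.mul v u t h hl.symm)

theorem toIntervalMonoid_one :
    toIntervalMonoid S w ⟨1, one_mem_interval S w⟩ = 1 :=
  PresentedMonoid.mk_eq_mk_of_rel IntervalRel.one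

@[elab_as_elim]
theorem IntervalMonoid.induction {P : IntervalMonoid S w → Prop} (one : P 1)
    (mul : ∀ a x, P x → P (toIntervalMonoid S w a * x)) (x : IntervalMonoid S w) : P x := by
  obtain ⟨l, rfl⟩ := PresentedMonoid.surjective_mk x
  induction l using FreeMonoid.inductionOn' with
  | one => exact one
  | of_mul a l ih => exact mul a _ ih

/-- The length of an element of the interval monoid. -/
noncomputable def IntervalMonoid.length (S : Set W) (w : W) :
    IntervalMonoid S w →* Multiplicative ℕ :=
  PresentedMonoid.lift (rels := IntervalRel S w) (fun v : interval S w => Multiplicative.ofAdd (wordLength S (v : W))) (by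
    rintro _ _ (⟨v, u, t, -, hl⟩ | _)
    · simpa [← ofAdd_add] using congrArg Multiplicative.ofAdd hl
    · simp [wordLength_one])

/-- The projection of the interval monoid to the group. -/
noncomputable def IntervalMonoid.toGroup (S : Set W) (w : W) : IntervalMonoid S w →* W :=
  PresentedMonoid.lift (rels := IntervalRel S w) (fun v : interval S w => (v : W)) (by
    rintro _ _ (⟨v, u, t, h, -⟩ | _)
    · simpa using h
    · simp)

@[simp]
theorem IntervalMonoid.length_of (v : interval S w) :
    IntervalMonoid.length S w (toIntervalMonoid S w v) =
      Multiplicative.ofAdd (wordLength S (v : W)) := rfl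

theorem toIntervalMonoid_injective : Function.Injective (toIntervalMonoid S w) := fun _ _ h =>
  Subtype.ext (congrArg (IntervalMonoid.toGroup S w) h)

/-- The length has values in `Multiplicative ℕ`, so `1` on the left means length zero. -/
theorem IntervalMonoid.length_eq_one_iff (hS : Submonoid.closure S = ⊤)
    {x : IntervalMonoid S w} : IntervalMonoid.length S w x = 1 ↔ x = 1 := by
  refine ⟨fun h => ?_, fun h => by rw [h, map_one]⟩
  induction x using IntervalMonoid.induction with
  | one => rfl
  | mul a x ih =>
    rw [map_mul, length_of, ← toAdd_eq_zero, toAdd_mul, toAdd_ofAdd, Nat.add_eq_zero_iff] at h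
    have ha : a = ⟨1, one_mem_interval S w⟩ := Subtype.ext ((wordLength_eq_zero_iff hS).mp h.1)
    rw [ih (by rw [← toAdd_eq_zero]; exact h.2), ha, toIntervalMonoid_one, one_mul]

end IntervalMonoid

/-! ### Greatest simple divisors, left cancellation, lcms and gcds -/

namespace IsLeftGarsideInterval

variable {W : Type*} [Group W] {S : Set W} {w : W}

theorem exists_inf (H : IsLeftGarsideInterval S w) (a b : interval S w) : ∃ m : interval S w, Precedes S (m : W) a ∧
    Precedes S (m : W) b ∧ ∀ c : interval S w, Precedes S (c : W) a → Precedes S (c : W) b →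
      Precedes S (c : W) m := by
  obtain ⟨L, hL⟩ := H.lattice
  exact ⟨a ⊓ b, (hL _ _).mpr inf_le_left, (hL _ _).mpr inf_le_right, fun c ha hb =>
    (hL _ _).mpr (le_inf ((hL _ _).mp ha) ((hL _ _).mp hb))⟩

theorem exists_sup (H : IsLeftGarsideInterval S w) (a b : interval S w) : ∃ m : interval S w, Precedes S (a : W) m ∧
    Precedes S (b : W) m ∧ ∀ c : interval S w, Precedes S (a : W) c → Precedes S (b : W) c →
      Precedes S (m : W) c := by
  obtain ⟨L, hL⟩ := H.lattice
  exact ⟨a ⊔ b, (hL _ _).mpr le_sup_left, (hL _ _).mpr le_sup_right, fun c ha hb =>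
    (hL _ _).mpr (sup_le ((hL _ _).mp ha) ((hL _ _).mp hb))⟩

theorem wordLength_compl (_H : IsLeftGarsideInterval S w) (v : interval S w) :
    wordLength S ((v : W) * ((v : W)⁻¹ * w)) =
      wordLength S (v : W) + wordLength S ((v : W)⁻¹ * w) := by
  rw [mul_inv_cancel_left]
  exact precedes_iff.mp (mem_interval_iff.mp v.2)

theorem compl_mem (H : IsLeftGarsideInterval S w) (v : interval S w) : (v : W)⁻¹ * w ∈ interval S w :=
  H.balanced.right_mem H.generates (a := (v : W))
    (by rw [mul_inv_cancel_left]; exact self_mem_interval S w) (H.wordLength_compl v)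

theorem quotient_mem (H : IsLeftGarsideInterval S w) {u : W} (v : interval S w) (h : Precedes S u v) :
    u⁻¹ * v ∈ interval S w :=
  H.balanced.right_mem H.generates (a := u) (by simp)
    (by simpa using precedes_iff.mp h)

theorem toIntervalMonoid_mul_quotient (H : IsLeftGarsideInterval S w) (u v : interval S w) (h : Precedes S (u : W) v) :
    toIntervalMonoid S w u * toIntervalMonoid S w ⟨(u : W)⁻¹ * v, H.quotient_mem v h⟩ =
      toIntervalMonoid S w v :=
  toIntervalMonoid_mul _ _ _ (by simp) (precedes_iff.mp h)

/-- The largest `g ≼ s` such that `a g` belongs to the interval. -/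
noncomputable def carry (H : IsLeftGarsideInterval S w) (a s : interval S w) : interval S w :=
  (H.exists_inf ⟨(a : W)⁻¹ * w, H.compl_mem a⟩ s).choose

theorem carry_compl (H : IsLeftGarsideInterval S w) (a s : interval S w) : Precedes S (H.carry a s : W) ((a : W)⁻¹ * w) :=
  (H.exists_inf ⟨(a : W)⁻¹ * w, H.compl_mem a⟩ s).choose_spec.1

theorem carry_precedes (H : IsLeftGarsideInterval S w) (a s : interval S w) : Precedes S (H.carry a s : W) s :=
  (H.exists_inf ⟨(a : W)⁻¹ * w, H.compl_mem a⟩ s).choose_spec.2.1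

theorem precedes_carry (H : IsLeftGarsideInterval S w) (a s : interval S w) {c : W} (h1 : Precedes S c ((a : W)⁻¹ * w))
    (h2 : Precedes S c s) : Precedes S c (H.carry a s : W) :=
  (H.exists_inf ⟨(a : W)⁻¹ * w, H.compl_mem a⟩ s).choose_spec.2.2
    ⟨c, mem_interval_of_precedes H.generates h2 s.2⟩ h1 h2

/-- The prefixes of the complement `a⁻¹ w` are the elements by which `a` can be prolonged inside the
interval with lengths adding. Hence the meet defining `carry a s` is the largest part of `s` that
`a` can absorb. -/
theorem precedes_compl_iff (H : IsLeftGarsideInterval S w) (a : interval S w) {c : W} :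
    Precedes S c ((a : W)⁻¹ * w) ↔ (a : W) * c ∈ interval S w ∧
      wordLength S ((a : W) * c) = wordLength S (a : W) + wordLength S c := by
  rw [← precedes_mul_left_iff H.generates (H.wordLength_compl a), mul_inv_cancel_left,
    mem_interval_iff]

theorem mul_carry_mem (H : IsLeftGarsideInterval S w) (a s : interval S w) : (a : W) * H.carry a s ∈ interval S w :=
  ((H.precedes_compl_iff a).mp (H.carry_compl a s)).1

theorem wordLength_mul_carry (H : IsLeftGarsideInterval S w) (a s : interval S w) : wordLength S ((a : W) * H.carry a s) =
    wordLength S (a : W) + wordLength S (H.carry a s : W) :=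
  ((H.precedes_compl_iff a).mp (H.carry_compl a s)).2

/-- The largest simple dividing `a s`. -/
noncomputable def head (H : IsLeftGarsideInterval S w) (a s : interval S w) : interval S w :=
  ⟨(a : W) * H.carry a s, H.mul_carry_mem a s⟩

/-- The complement of `head a s` in `a s`. -/
noncomputable def tail (H : IsLeftGarsideInterval S w) (a s : interval S w) : interval S w :=
  ⟨(H.carry a s : W)⁻¹ * s, H.quotient_mem s (H.carry_precedes a s)⟩

theorem head_one_right (H : IsLeftGarsideInterval S w) (a : interval S w) : H.head a ⟨1, one_mem_interval S w⟩ = a := by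
  have h := (H.carry_precedes a ⟨1, one_mem_interval S w⟩).antisymm H.generates
    (one_precedes S _)
  exact Subtype.ext (by simp [head, h])

/-- Coherence of absorption: `v` absorbs from `head u s` all of `u`, because `v u` is simple, and
then precisely what `t = v u` would absorb from `s`. Antisymmetry of `≼` combines the two
comparisons. -/
theorem carry_mul (H : IsLeftGarsideInterval S w) (v u t s : interval S w) (h : (v : W) * u = t)
    (hl : wordLength S (t : W) = wordLength S (v : W) + wordLength S (u : W)) :
    (H.carry v (H.head u s) : W) = u * H.carry t s := by
  have hS := H.generates
  have hu : Precedes S (u : W) ((v : W)⁻¹ * w) := (H.precedes_compl_iff v).mpr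
    (by rw [h]; exact ⟨t.2, hl⟩)
  have huh : Precedes S (u : W) (H.head u s) :=
    precedes_mul_right_iff.mpr (H.wordLength_mul_carry u s)
  have hg := (H.precedes_compl_iff t).mp (H.carry_compl t s)
  rw [← h, mul_assoc] at hg
  have l1 := wordLength_mul_le hS (v : W) ((u : W) * H.carry t s)
  have l2 := wordLength_mul_le hS (u : W) (H.carry t s : W)
  rw [h] at hg
  have h1 : Precedes S ((u : W) * H.carry t s) ((v : W)⁻¹ * w) :=
    (H.precedes_compl_iff v).mpr ⟨hg.1, by omega⟩
  have hug : (u : W) * H.carry t s ∈ interval S w :=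
    mem_interval_of_precedes hS h1 (H.compl_mem v)
  have h2 : Precedes S (H.carry t s : W) ((u : W)⁻¹ * w) :=
    (H.precedes_compl_iff u).mpr ⟨hug, by omega⟩
  refine Precedes.antisymm hS ?_ (H.precedes_carry _ _ h1 ?_)
  -- Since `u` precedes both elements whose meet is taken, the carry has the form `u x`; it remains
  -- to see that `t` can absorb `x` and that `x` precedes `s`.
  · obtain ⟨x, hx, hxl⟩ := H.precedes_carry v (H.head u s) hu huh
    have hc1 := H.carry_compl v (H.head u s)
    have hc2 := H.carry_precedes v (H.head u s)
    rw [hx] at hc1 hc2 hxl ⊢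
    refine Precedes.mul_left hS ?_ (by omega)
    have hv := (H.precedes_compl_iff v).mp hc1
    refine H.precedes_carry _ _ ((H.precedes_compl_iff t).mpr ?_) ?_
    · rw [← h, mul_assoc]
      refine ⟨hv.1, ?_⟩
      rw [h]
      omega
    · refine Precedes.trans hS ?_ (H.carry_precedes u s)
      exact (precedes_mul_left_iff hS (H.wordLength_mul_carry u s)).mp ⟨hc2, hxl⟩
  · exact Precedes.mul_left hS (H.precedes_carry _ _ h2 (H.carry_precedes t s))
      (H.wordLength_mul_carry u s)

theorem head_mul (H : IsLeftGarsideInterval S w) (v u t s : interval S w) (h : (v : W) * u = t)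
    (hl : wordLength S (t : W) = wordLength S (v : W) + wordLength S (u : W)) :
    H.head v (H.head u s) = H.head t s := by
  refine Subtype.ext ?_
  change (v : W) * H.carry v (H.head u s) = t * H.carry t s
  rw [H.carry_mul v u t s h hl, ← mul_assoc, h]

/-- The remainders of the two successive absorptions recombine, with lengths adding, to the
remainder of the single one. With `head_mul` this says that the rule `actOf` respects the defining
relations. -/
theorem tail_mul (H : IsLeftGarsideInterval S w) (v u t s : interval S w) (h : (v : W) * u = t)
    (hl : wordLength S (t : W) = wordLength S (v : W) + wordLength S (u : W)) :
    toIntervalMonoid S w (H.tail v (H.head u s)) * toIntervalMonoid S w (H.tail u s) =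
      toIntervalMonoid S w (H.tail t s) := by
  have e1 := precedes_iff.mp (H.carry_precedes u s)
  have e2 := precedes_iff.mp (H.carry_precedes t s)
  have e3 := precedes_iff.mp (H.carry_precedes v (H.head u s))
  have e4 := H.wordLength_mul_carry u s
  have hc := H.carry_mul v u t s h hl
  have e5 : wordLength S ((u : W) * H.carry t s) =
      wordLength S (u : W) + wordLength S (H.carry t s : W) := by
    have hg := (H.precedes_compl_iff t).mp (H.carry_compl t s)
    rw [← h, mul_assoc] at hg
    have l1 := wordLength_mul_le H.generates (v : W) ((u : W) * H.carry t s)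
    have l2 := wordLength_mul_le H.generates (u : W) (H.carry t s : W)
    rw [h] at hg
    omega
  refine toIntervalMonoid_mul _ _ _ ?_ ?_
  · change (H.carry v (H.head u s) : W)⁻¹ * (u * H.carry u s) * ((H.carry u s : W)⁻¹ * s) =
      (H.carry t s : W)⁻¹ * s
    rw [hc]
    group
  · rw [hc] at e3
    simp only [tail, hc]
    change wordLength S ((u : W) * H.carry u s) = _ at e3
    omega

theorem toIntervalMonoid_head_mul_tail (H : IsLeftGarsideInterval S w) (a s : interval S w) :
    toIntervalMonoid S w (H.head a s) * toIntervalMonoid S w (H.tail a s) =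
      toIntervalMonoid S w a * toIntervalMonoid S w s := by
  rw [← H.toIntervalMonoid_mul_quotient _ _ (H.carry_precedes a s), ← mul_assoc,
    toIntervalMonoid_mul a (H.carry a s) (H.head a s) rfl (H.wordLength_mul_carry a s)]
  rfl

/-- The simple `a` sends the pair `(s, m)` to `(head a s, tail a s * m)`. -/
noncomputable def actOf (H : IsLeftGarsideInterval S w) (a : interval S w) :
    Function.End (interval S w × IntervalMonoid S w) :=
  fun p => (H.head a p.1, toIntervalMonoid S w (H.tail a p.1) * p.2)

theorem actOf_mul (H : IsLeftGarsideInterval S w) (v u t : interval S w) (h : (v : W) * u = t)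
    (hl : wordLength S (t : W) = wordLength S (v : W) + wordLength S (u : W)) :
    H.actOf v * H.actOf u = H.actOf t := by
  funext p
  refine Prod.ext (H.head_mul v u t p.1 h hl) ?_
  change toIntervalMonoid S w (H.tail v (H.head u p.1)) *
    (toIntervalMonoid S w (H.tail u p.1) * p.2) = toIntervalMonoid S w (H.tail t p.1) * p.2
  rw [← mul_assoc, H.tail_mul v u t p.1 h hl]

theorem actOf_one (H : IsLeftGarsideInterval S w) : H.actOf ⟨1, one_mem_interval S w⟩ = 1 := by
  funext p
  have h1 : H.carry ⟨1, one_mem_interval S w⟩ p.1 = p.1 :=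
    Subtype.ext ((H.carry_precedes _ _).antisymm H.generates
      (H.precedes_carry _ _ (by simpa using mem_interval_iff.mp p.1.2)
        (precedes_refl S _)))
  have h2 : H.tail ⟨1, one_mem_interval S w⟩ p.1 = ⟨1, one_mem_interval S w⟩ :=
    Subtype.ext (by simp [tail, h1])
  refine Prod.ext (Subtype.ext ?_) ?_
  · change (1 : W) * H.carry ⟨1, one_mem_interval S w⟩ p.1 = p.1
    rw [h1, one_mul]
  · change toIntervalMonoid S w (H.tail ⟨1, one_mem_interval S w⟩ p.1) * p.2 = p.2
    rw [h2, toIntervalMonoid_one, one_mul]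

/-- The action of the interval monoid on pairs extending `actOf`. -/
noncomputable def act (H : IsLeftGarsideInterval S w) :
    IntervalMonoid S w →* Function.End (interval S w × IntervalMonoid S w) :=
  PresentedMonoid.lift (rels := IntervalRel S w) H.actOf (by
    rintro _ _ (⟨v, u, t, h, hl⟩ | _)
    · simpa only [map_mul, FreeMonoid.lift_eval_of] using H.actOf_mul v u t h hl.symm
    · simpa only [map_one, FreeMonoid.lift_eval_of] using H.actOf_one)

theorem act_of_mul (H : IsLeftGarsideInterval S w) (a : interval S w) (x : IntervalMonoid S w)
    (p : interval S w × IntervalMonoid S w) :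
    H.act (toIntervalMonoid S w a * x) p = H.actOf a (H.act x p) := by
  rw [map_mul]
  rfl

/-- The largest simple dividing `x`. -/
noncomputable def lead (H : IsLeftGarsideInterval S w) (x : IntervalMonoid S w) : interval S w :=
  (H.act x (⟨1, one_mem_interval S w⟩, 1)).1

/-- The complement of `lead x` in `x`. -/
noncomputable def rest (H : IsLeftGarsideInterval S w) (x : IntervalMonoid S w) : IntervalMonoid S w :=
  (H.act x (⟨1, one_mem_interval S w⟩, 1)).2

theorem lead_one (H : IsLeftGarsideInterval S w) : H.lead 1 = ⟨1, one_mem_interval S w⟩ := by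
  rw [lead, map_one]
  rfl

theorem lead_mul (H : IsLeftGarsideInterval S w) (a : interval S w) (x : IntervalMonoid S w) :
    H.lead (toIntervalMonoid S w a * x) = H.head a (H.lead x) := by
  rw [lead, act_of_mul]
  rfl

theorem rest_mul (H : IsLeftGarsideInterval S w) (a : interval S w) (x : IntervalMonoid S w) :
    H.rest (toIntervalMonoid S w a * x) =
      toIntervalMonoid S w (H.tail a (H.lead x)) * H.rest x := by
  rw [rest, act_of_mul]
  rfl

theorem lead_mul_rest (H : IsLeftGarsideInterval S w) (x : IntervalMonoid S w) :
    toIntervalMonoid S w (H.lead x) * H.rest x = x := by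
  induction x using IntervalMonoid.induction with
  | one =>
    rw [H.lead_one, toIntervalMonoid_one, rest, map_one, one_mul]
    rfl
  | mul a x ih =>
    rw [H.lead_mul, H.rest_mul, ← mul_assoc, H.toIntervalMonoid_head_mul_tail, mul_assoc, ih]

theorem lead_of (H : IsLeftGarsideInterval S w) (a : interval S w) : H.lead (toIntervalMonoid S w a) = a := by
  rw [← mul_one (toIntervalMonoid S w a), H.lead_mul, H.lead_one, H.head_one_right]

theorem precedes_lead_mul (H : IsLeftGarsideInterval S w) (a : interval S w) (x : IntervalMonoid S w) :
    Precedes S (a : W) (H.lead (toIntervalMonoid S w a * x)) := by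
  rw [H.lead_mul]
  exact precedes_mul_right_iff.mpr (H.wordLength_mul_carry _ _)

/-- The right-hand side is computed from `a` and the product `a x` alone, by a division that takes
place in the group. So `x` is determined by `a` and `a x`, which is left cancellation by a simple.
-/
theorem eq_of_lead_mul (H : IsLeftGarsideInterval S w) (a : interval S w) (x : IntervalMonoid S w) :
    x = toIntervalMonoid S w ⟨(a : W)⁻¹ * H.lead (toIntervalMonoid S w a * x),
      H.quotient_mem _ (H.precedes_lead_mul a x)⟩ * H.rest (toIntervalMonoid S w a * x) := by
  conv_lhs => rw [← H.lead_mul_rest x, ← H.toIntervalMonoid_mul_quotient _ _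
    (H.carry_precedes a (H.lead x))]
  rw [H.rest_mul, mul_assoc]
  congr 2
  exact Subtype.ext (by simp [H.lead_mul, head])

theorem of_mul_cancel (H : IsLeftGarsideInterval S w) {a : interval S w} {x y : IntervalMonoid S w}
    (h : toIntervalMonoid S w a * x = toIntervalMonoid S w a * y) : x = y := by
  rw [H.eq_of_lead_mul a x, H.eq_of_lead_mul a y]
  simp only [h]

theorem mul_left_cancel' (H : IsLeftGarsideInterval S w) {f x y : IntervalMonoid S w} (h : f * x = f * y) : x = y := by
  induction f using IntervalMonoid.induction with
  | one => simpa using h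
  | mul a f ih => exact ih (H.of_mul_cancel (by simpa only [mul_assoc] using h))

theorem of_dvd_iff (H : IsLeftGarsideInterval S w) {a : interval S w} {x : IntervalMonoid S w} :
    toIntervalMonoid S w a ∣ x ↔ Precedes S (a : W) (H.lead x) := by
  constructor
  · rintro ⟨y, rfl⟩
    exact H.precedes_lead_mul a y
  · intro h
    rw [← H.lead_mul_rest x, ← H.toIntervalMonoid_mul_quotient _ _ h, mul_assoc]
    exact Dvd.intro _ rfl

theorem of_dvd_of_iff (H : IsLeftGarsideInterval S w) {a b : interval S w} :
    toIntervalMonoid S w a ∣ toIntervalMonoid S w b ↔ Precedes S (a : W) b := by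
  rw [H.of_dvd_iff, H.lead_of]

/-- If `a x` divides the simple `b`, then cancelling `a` leaves `x` dividing the simple `a⁻¹ b`, and
the induction continues. -/
theorem dvd_of_iff (H : IsLeftGarsideInterval S w) {b : interval S w} {x : IntervalMonoid S w} :
    x ∣ toIntervalMonoid S w b ↔ ∃ a, x = toIntervalMonoid S w a ∧ Precedes S (a : W) b := by
  constructor
  · intro h
    induction x using IntervalMonoid.induction generalizing b with
    | one => exact ⟨_, toIntervalMonoid_one.symm, one_precedes S _⟩
    | mul a x ih =>
      have hab := H.of_dvd_of_iff.mp ((Dvd.intro _ rfl).trans h)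
      obtain ⟨y, hy⟩ := h
      rw [← H.toIntervalMonoid_mul_quotient _ _ hab, mul_assoc] at hy
      obtain ⟨c, rfl, hc⟩ := ih ⟨y, H.of_mul_cancel hy⟩
      have hl := precedes_iff.mp hab
      have h1 := Precedes.mul_left H.generates (x := (a : W)) hc (by simpa using hl)
      have h2 := Precedes.wordLength_mul H.generates (x := (a : W)) hc (by simpa using hl)
      simp only [mul_inv_cancel_left] at h1
      exact ⟨⟨a * c, mem_interval_of_precedes H.generates h1 b.2⟩,
        toIntervalMonoid_mul _ _ _ rfl h2, h1⟩
  · rintro ⟨a, rfl, h⟩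
    exact H.of_dvd_of_iff.mpr h

theorem mul_dvd_mul_left_iff' (H : IsLeftGarsideInterval S w) {f x y : IntervalMonoid S w} : f * x ∣ f * y ↔ x ∣ y := by
  refine ⟨?_, fun h => mul_dvd_mul_left f h⟩
  rintro ⟨z, hz⟩
  exact ⟨z, H.mul_left_cancel' (by rw [hz, mul_assoc])⟩

/-- The join of two simples remains a least common multiple in the whole monoid, because simples
divide `z` exactly when they precede `lead z`. The cofactor of `b` is recorded as a simple so that
it can be fed to the induction in `exists_lcm_of`. -/
theorem exists_lcm_of_of (H : IsLeftGarsideInterval S w) (a b : interval S w) : ∃ c d, toIntervalMonoid S w a * c =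
    toIntervalMonoid S w b * toIntervalMonoid S w d ∧
    ∀ z, toIntervalMonoid S w a ∣ z → toIntervalMonoid S w b ∣ z →
      toIntervalMonoid S w a * c ∣ z := by
  obtain ⟨m, ha, hb, hm⟩ := H.exists_sup a b
  refine ⟨toIntervalMonoid S w ⟨_, H.quotient_mem _ ha⟩, ⟨_, H.quotient_mem _ hb⟩, ?_,
    fun z h1 h2 => ?_⟩
  · rw [H.toIntervalMonoid_mul_quotient _ _ ha, H.toIntervalMonoid_mul_quotient _ _ hb]
  · rw [H.toIntervalMonoid_mul_quotient _ _ ha, H.of_dvd_iff]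
    exact hm _ (H.of_dvd_iff.mp h1) (H.of_dvd_iff.mp h2)

theorem exists_lcm_of (H : IsLeftGarsideInterval S w) (a : interval S w) (x : IntervalMonoid S w) : ∃ c d,
    toIntervalMonoid S w a * c = x * d ∧
    ∀ z, toIntervalMonoid S w a ∣ z → x ∣ z → toIntervalMonoid S w a * c ∣ z := by
  induction x using IntervalMonoid.induction generalizing a with
  | one => exact ⟨1, toIntervalMonoid S w a, by simp, fun z h _ => by simpa using h⟩
  | mul b x ih =>
    obtain ⟨c, d, h, hm⟩ := H.exists_lcm_of_of a b
    obtain ⟨e, f, h', hm'⟩ := ih d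
    refine ⟨c * e, f, ?_, ?_⟩
    · rw [← mul_assoc, h, mul_assoc, h', mul_assoc]
    · intro z h1 h2
      have h3 := hm z h1 ((Dvd.intro _ rfl).trans h2)
      rw [← mul_assoc, h, mul_assoc]
      rw [h] at h3
      obtain ⟨y, rfl⟩ := (Dvd.intro _ rfl).trans h3
      rw [H.mul_dvd_mul_left_iff'] at h2 h3 ⊢
      exact hm' y h3 h2

/-- The lcm of `a x` and `y` is `a` times the lcm of `x` and `c`, where `a c` is the lcm of `a` and
`y`. -/
theorem exists_lcm (H : IsLeftGarsideInterval S w) (x y : IntervalMonoid S w) : ∃ c d, x * c = y * d ∧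
    ∀ z, x ∣ z → y ∣ z → x * c ∣ z := by
  induction x using IntervalMonoid.induction generalizing y with
  | one => exact ⟨y, 1, by simp, fun z _ h => by simpa using h⟩
  | mul a x ih =>
    obtain ⟨c, d, h, hm⟩ := H.exists_lcm_of a y
    obtain ⟨e, f, h', hm'⟩ := ih c
    refine ⟨e, d * f, ?_, ?_⟩
    · rw [mul_assoc, h', ← mul_assoc, h, mul_assoc]
    · intro z h1 h2
      have h3 := hm z ((Dvd.intro _ rfl).trans h1) h2
      obtain ⟨z, rfl⟩ := (Dvd.intro _ rfl).trans h1
      rw [mul_assoc]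
      rw [H.mul_dvd_mul_left_iff'] at h1 h3 ⊢
      exact hm' z h1 h3

theorem hasGcdsAndLcms (H : IsLeftGarsideInterval S w) : HasGcdsAndLcms (fun f g : IntervalMonoid S w => f ∣ g) := by
  intro f g
  constructor
  · let len : IntervalMonoid S w → ℕ := fun x => (IntervalMonoid.length S w x).toAdd
    have hlen : ∀ x y, len (x * y) = len x + len y := fun x y => by simp [len]
    have hb : ∃ n, ∃ d, (d ∣ f ∧ d ∣ g) ∧ len d = n := ⟨_, 1, ⟨one_dvd _, one_dvd _⟩, rfl⟩
    have hle : ∀ n, (∃ d, (d ∣ f ∧ d ∣ g) ∧ len d = n) → n ≤ len f := by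
      rintro _ ⟨d, ⟨⟨c, rfl⟩, -⟩, rfl⟩
      rw [hlen]
      exact Nat.le_add_right _ _
    classical
    -- A common divisor of maximal length is a gcd: its lcm with any other common divisor is again a
    -- common divisor, so it cannot be longer.
    obtain ⟨d, ⟨hf, hg⟩, hd⟩ := Nat.findGreatest_spec
      (P := fun n => ∃ d, (d ∣ f ∧ d ∣ g) ∧ len d = n) (hle _ hb.choose_spec) hb.choose_spec
    refine ⟨d, hf, hg, fun c hcf hcg => ?_⟩
    obtain ⟨p, q, h, hm⟩ := H.exists_lcm d c
    have hmax := Nat.le_findGreatest (P := fun n => ∃ d, (d ∣ f ∧ d ∣ g) ∧ len d = n)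
      (hle _ ⟨d * p, ⟨hm f hf hcf, hm g hg hcg⟩, rfl⟩) ⟨d * p, ⟨hm f hf hcf, hm g hg hcg⟩, rfl⟩
    rw [← hd, hlen] at hmax
    have hp : p = 1 := (IntervalMonoid.length_eq_one_iff H.generates).mp
      (toAdd_eq_zero.mp (show len p = 0 by omega))
    exact ⟨q, by rw [← h, hp, mul_one]⟩
  · obtain ⟨c, d, h, hm⟩ := H.exists_lcm f g
    exact ⟨f * c, Dvd.intro _ rfl, h ▸ Dvd.intro _ rfl, hm⟩

theorem setOf_dvd_eq (H : IsLeftGarsideInterval S w) : {f | f ∣ toIntervalMonoid S w ⟨w, self_mem_interval S w⟩} =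
    Set.range (toIntervalMonoid S w) := by
  ext x
  rw [Set.mem_ofPred_eq, H.dvd_of_iff]
  constructor
  · rintro ⟨a, rfl, -⟩
    exact ⟨a, rfl⟩
  · rintro ⟨a, rfl⟩
    exact ⟨a, rfl, mem_interval_iff.mp a.2⟩

end IsLeftGarsideInterval

/-! ### Inversion and the right-hand Garside properties -/

section Opposite

open MulOpposite

variable {W : Type*} [Group W] {S : Set W}

/-- Inversion keeps the length and reverses products, so it exchanges prefixes and suffixes. -/
theorem precedes_inv_iff (hS : Submonoid.closure S = ⊤) (hinv : ∀ x ∈ S, x⁻¹ ∈ S) {v w : W} :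
    Precedes S v⁻¹ w⁻¹ ↔ PrecedesR S v w := by
  rw [precedes_iff, PrecedesR, wordLength_inv hS hinv, wordLength_inv hS hinv,
    ← wordLength_inv hS hinv (v⁻¹⁻¹ * w⁻¹), mul_inv_rev, inv_inv, inv_inv]
  omega

theorem inv_mem_interval_iff (hS : Submonoid.closure S = ⊤) (hinv : ∀ x ∈ S, x⁻¹ ∈ S) {v w : W} :
    v⁻¹ ∈ interval S w⁻¹ ↔ v ∈ intervalR S w := by
  rw [mem_interval_iff, mem_intervalR_iff, precedes_inv_iff hS hinv]

theorem IsBalanced.inv_mem (hS : Submonoid.closure S = ⊤) (hinv : ∀ x ∈ S, x⁻¹ ∈ S) {w : W}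
    (hb : IsBalanced S w) {v : W} (hv : v ∈ interval S w) : v⁻¹ ∈ interval S w⁻¹ := by
  rw [inv_mem_interval_iff hS hinv]
  exact hb ▸ hv

/-- The homomorphism `v̲ ↦ v⁻¹` from an interval monoid to the opposite of another one. -/
noncomputable def IntervalMonoid.opHom (hS : Submonoid.closure S = ⊤)
    (hinv : ∀ x ∈ S, x⁻¹ ∈ S) {w w' : W} (h : ∀ v ∈ interval S w, v⁻¹ ∈ interval S w') :
    IntervalMonoid S w →* (IntervalMonoid S w')ᵐᵒᵖ :=
  PresentedMonoid.lift (rels := IntervalRel S w)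
    (fun v : interval S w => op (toIntervalMonoid S w' ⟨(v : W)⁻¹, h v v.2⟩)) (by
    rintro _ _ (⟨v, u, t, ht, hl⟩ | _)
    · simp only [map_mul, FreeMonoid.lift_eval_of]
      rw [← op_mul, toIntervalMonoid_mul]
      · simp [← ht]
      · simp only [wordLength_inv hS hinv]
        omega
    · simp only [map_one, FreeMonoid.lift_eval_of, inv_one, toIntervalMonoid_one, op_one])

/-- The isomorphism `v̲ ↦ v⁻¹` from `M([1, w])` to the opposite of `M([1, w⁻¹])`. -/
noncomputable def IntervalMonoid.opEquiv (hS : Submonoid.closure S = ⊤)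
    (hinv : ∀ x ∈ S, x⁻¹ ∈ S) {w w' : W} (h : ∀ v ∈ interval S w, v⁻¹ ∈ interval S w')
    (h' : ∀ v ∈ interval S w', v⁻¹ ∈ interval S w) :
    IntervalMonoid S w ≃* (IntervalMonoid S w')ᵐᵒᵖ :=
  MonoidHom.toMulEquiv (opHom hS hinv h)
    ((MulEquiv.opOp _).symm.toMonoidHom.comp (MonoidHom.op (opHom hS hinv h')))
    (PresentedMonoid.ext _ fun v => congrArg (toIntervalMonoid S w) (Subtype.ext (inv_inv _)))
    (by
      apply MonoidHom.op.symm.injective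
      exact PresentedMonoid.ext _ fun v => congrArg (toIntervalMonoid S w')
        (Subtype.ext (inv_inv _)))

theorem rightDivides_iff_of_op {M N : Type*} [Monoid M] [Monoid N] (e : M ≃* Nᵐᵒᵖ) {f g : M} :
    RightDivides f g ↔ unop (e f) ∣ unop (e g) := by
  constructor
  · rintro ⟨c, rfl⟩
    exact ⟨unop (e c), by simp⟩
  · rintro ⟨c, hc⟩
    refine ⟨e.symm (op c), e.injective ?_⟩
    rw [map_mul, MulEquiv.apply_symm_apply]
    exact unop_injective (by simp [hc])

theorem hasGcdsAndLcms_rightDivides_of_op {M N : Type*} [Monoid M] [Monoid N] (e : M ≃* Nᵐᵒᵖ)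
    (h : HasGcdsAndLcms (fun f g : N => f ∣ g)) :
    HasGcdsAndLcms (fun f g : M => RightDivides f g) := by
  intro f g
  simp only [rightDivides_iff_of_op e]
  obtain ⟨⟨d, h1, h2, h3⟩, m, h4, h5, h6⟩ := h (unop (e f)) (unop (e g))
  exact ⟨⟨e.symm (op d), by simpa using h1, by simpa using h2,
    fun c hc hc' => by simpa using h3 _ hc hc'⟩, e.symm (op m), by simpa using h4,
    by simpa using h5, fun c hc hc' => by simpa using h6 _ hc hc'⟩

theorem IsLeftGarsideInterval.isIntervalGarside (hinv : ∀ x ∈ S, x⁻¹ ∈ S) {w : W}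
    (H : IsLeftGarsideInterval S w) (H' : IsLeftGarsideInterval S w⁻¹) :
    IsIntervalGarside S w := by
  have hS := H.generates
  have hmem : ∀ v ∈ interval S w⁻¹, v⁻¹ ∈ interval S w := fun v hv => by
    simpa using H'.balanced.inv_mem hS hinv hv
  let e := IntervalMonoid.opEquiv hS hinv (w := w) (w' := w⁻¹)
    (fun v hv => H.balanced.inv_mem hS hinv hv) hmem
  have he : ∀ v : interval S w, unop (e (toIntervalMonoid S w v)) =
    toIntervalMonoid S w⁻¹ ⟨(v : W)⁻¹, H.balanced.inv_mem hS hinv v.2⟩ := fun v => rfl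
  refine
    { generates := hS
      balanced := H.balanced
      lattice_left := H.lattice
      lattice_right := ?_
      garside :=
        { exists_length := ⟨fun x => (IntervalMonoid.length S w x).toAdd, fun f g => by simp,
            fun g hg h => hg ((IntervalMonoid.length_eq_one_iff hS).mp (toAdd_eq_zero.mp h))⟩
          cancel := fun f g h k hfg => ?_
          left_gcd_lcm := H.hasGcdsAndLcms
          right_gcd_lcm := hasGcdsAndLcms_rightDivides_of_op e H'.hasGcdsAndLcms
          divisors_eq := ?_
          divisors_generate := ?_ }
      simples_injective := toIntervalMonoid_injective
      simples_range := H.setOf_dvd_eq.symm }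
  · obtain ⟨L, hL⟩ := H'.lattice
    -- The lattice structure for `≼_r` is pulled back along inversion from the one for `≼` on `[1,
    -- w⁻¹]`.
    let φ : intervalR S w ≃ interval S w⁻¹ :=
      (Equiv.inv W).subtypeEquiv fun v => (inv_mem_interval_iff hS hinv).symm
    have hφ : ∀ a b : intervalR S w, PrecedesR S (a : W) b ↔ φ a ≤ φ b := fun a b => by
      rw [← hL, ← precedes_inv_iff hS hinv]
      rfl
    let : PartialOrder (intervalR S w) := PartialOrder.lift φ φ.injective
    refine ⟨{
      sup a b := φ.symm (φ a ⊔ φ b)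
      inf a b := φ.symm (φ a ⊓ φ b)
      le_sup_left a b := show φ a ≤ φ (φ.symm _) by simp
      le_sup_right a b := show φ b ≤ φ (φ.symm _) by simp
      sup_le a b c h h' := show φ (φ.symm _) ≤ φ c by simpa using ⟨h, h'⟩
      inf_le_left a b := show φ (φ.symm _) ≤ φ a by simp
      inf_le_right a b := show φ (φ.symm _) ≤ φ b by simp
      le_inf a b c h h' := show φ a ≤ φ (φ.symm _) by simpa using ⟨h, h'⟩ }, hφ⟩
  -- The factor `h` is cancelled in `M([1, w])`; the right factor `k` becomes a left factor in
  -- `M([1, w⁻¹])`.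
  · have h1 := H.mul_left_cancel' ((mul_assoc h f k).symm.trans (hfg.trans (mul_assoc h g k)))
    apply e.injective
    apply unop_injective
    refine H'.mul_left_cancel' (f := unop (e k)) ?_
    rw [← unop_mul, ← unop_mul, ← map_mul, ← map_mul, h1]
  · rw [H.setOf_dvd_eq]
    ext x
    rw [Set.mem_ofPred_eq, rightDivides_iff_of_op e, he]
    have h2 := Set.ext_iff.mp H'.setOf_dvd_eq (unop (e x))
    rw [Set.mem_ofPred_eq] at h2
    refine Iff.trans ?_ h2.symm
    constructor
    · rintro ⟨a, rfl⟩
      exact ⟨_, (he a).symm⟩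
    · rintro ⟨a, ha⟩
      refine ⟨⟨(a : W)⁻¹, hmem a a.2⟩, e.injective (unop_injective ?_)⟩
      rw [he, ← ha]
      exact congrArg _ (Subtype.ext (inv_inv _))
  · rw [H.setOf_dvd_eq]
    exact PresentedMonoid.closure_range_of _

end Opposite

/-! ### Groups of fractions and Ore's theorem -/

section Fractions

variable {M N : Type*} [Monoid M] [Monoid N]

/-- The universal property of the universal group of a monoid. -/
def FractionGroup.lift {G : Type*} [Group G] (f : M →* G) : FractionGroup M →* G :=
  PresentedGroup.toGroup (f := f) (by
    rintro _ ⟨a, b, rfl⟩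
    simp)

@[simp]
theorem FractionGroup.lift_of {G : Type*} [Group G] (f : M →* G) (a : M) :
    FractionGroup.lift f (FractionGroup.of M a) = f a :=
  PresentedGroup.toGroup.of _

theorem FractionGroup.hom_ext {G : Type*} [Group G] {f g : FractionGroup M →* G}
    (h : ∀ a, f (FractionGroup.of M a) = g (FractionGroup.of M a)) : f = g :=
  PresentedGroup.ext h

theorem FractionGroup.closure_range_of :
    Subgroup.closure (Set.range (FractionGroup.of M)) = ⊤ :=
  PresentedGroup.closure_range_of _

/-- Isomorphic monoids have isomorphic universal groups. -/
def FractionGroup.congr (e : M ≃* N) : FractionGroup M ≃* FractionGroup N :=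
  MonoidHom.toMulEquiv
    (FractionGroup.lift ((FractionGroup.of N).comp e.toMonoidHom))
    (FractionGroup.lift ((FractionGroup.of M).comp e.symm.toMonoidHom))
    (FractionGroup.hom_ext fun a => by simp) (FractionGroup.hom_ext fun a => by simp)

-- Localize at the whole monoid. Each fraction `r/s` has the inverse `s/r`, so `M` maps to the units
-- of the localization, injectively by cancellation; this map factors through the universal group.
open OreLocalization in
theorem FractionGroup.of_injective (hr : ∀ a b c : M, a * c = b * c → a = b)
    (hl : ∀ a b c : M, c * a = c * b → a = b)
    (hm : ∀ a b : M, ∃ c d, c * a = d * b) : Function.Injective (FractionGroup.of M) := by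
  choose p q hpq using hm
  let : OreSet (⊤ : Submonoid M) :=
    { ore_right_cancel := fun a b c h => ⟨1, by rw [hr a b c h]⟩
      oreNum := fun a b => q a b
      oreDenom := fun a b => ⟨p a b, trivial⟩
      ore_eq := fun a b => hpq a b }
  have hu : ∀ x : OreLocalization (⊤ : Submonoid M) M, IsUnit x := fun x => by
    induction x using OreLocalization.ind with | _ r s
    have h := OreLocalization.mul_inv (⟨r, trivial⟩ : (⊤ : Submonoid M)) s
    have h' := OreLocalization.mul_inv s (⟨r, trivial⟩ : (⊤ : Submonoid M))
    exact ⟨⟨_, _, h, h'⟩, rfl⟩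
  let f : M →* (OreLocalization (⊤ : Submonoid M) M)ˣ :=
    IsUnit.liftRight numeratorHom fun a => hu _
  have hf : Function.Injective f := fun a b hab => by
    have h : (numeratorHom a : OreLocalization (⊤ : Submonoid M) M) = numeratorHom b :=
      congrArg Units.val hab
    rw [numeratorHom_apply, numeratorHom_apply, oreDiv_eq_iff] at h
    obtain ⟨u, v, h1, h2⟩ := h
    simp only [Submonoid.coe_one, mul_one] at h2
    rw [← h2] at h1
    exact (hl _ _ _ h1).symm
  intro a b hab
  apply hf
  rw [← FractionGroup.lift_of f, hab, FractionGroup.lift_of]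

theorem FractionGroup.isFractionEmbedding_of (hr : ∀ a b c : M, a * c = b * c → a = b)
    (hl : ∀ a b c : M, c * a = c * b → a = b)
    (hm : ∀ a b : M, ∃ c d, c * a = d * b) (hm' : ∀ a b : M, ∃ c d, a * c = b * d) :
    IsFractionEmbedding (FractionGroup.of M) := by
  have hR : ∀ g : FractionGroup M, ∃ a b, g = FractionGroup.of M a * (FractionGroup.of M b)⁻¹ := by
    intro g
    have hg : g ∈ Subgroup.closure (Set.range (FractionGroup.of M)) := by
      rw [FractionGroup.closure_range_of]; trivial
    induction hg using Subgroup.closure_induction with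
    | mem x hx =>
      obtain ⟨a, rfl⟩ := hx
      exact ⟨a, 1, by simp⟩
    | one => exact ⟨1, 1, by simp⟩
    | mul x y _ _ hx hy =>
      obtain ⟨a, b, rfl⟩ := hx
      obtain ⟨c, d, rfl⟩ := hy
      -- A common right multiple `b u = c v` rewrites the inner factor `b⁻¹ c` as `u v⁻¹`.
      obtain ⟨u, v, h⟩ := hm' b c
      refine ⟨a * u, d * v, ?_⟩
      have h' := congrArg (FractionGroup.of M) h
      rw [map_mul, map_mul, ← eq_inv_mul_iff_mul_eq, ← mul_assoc] at h'
      rw [map_mul, map_mul, h']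
      group
    | inv x _ hx =>
      obtain ⟨a, b, rfl⟩ := hx
      exact ⟨b, a, by simp⟩
  refine ⟨FractionGroup.of_injective hr hl hm, hR, fun g => ?_⟩
  obtain ⟨a, b, rfl⟩ := hR g
  obtain ⟨c, d, h⟩ := hm a b
  refine ⟨c, d, ?_⟩
  rw [mul_inv_eq_iff_eq_mul, mul_assoc, eq_inv_mul_iff_mul_eq, ← map_mul, ← map_mul, h]

theorem IsGarsideMonoid.isFractionEmbedding_of_mulEquiv {Δ : N} (h : IsGarsideMonoid N Δ)
    (e : M ≃* N) : IsFractionEmbedding (FractionGroup.of M) := by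
  refine FractionGroup.isFractionEmbedding_of (fun a b c hc => ?_) (fun a b c hc => ?_)
    (fun a b => ?_) (fun a b => ?_)
  · exact e.injective (h.cancel _ _ 1 (e c) (by rw [one_mul, one_mul, ← map_mul, hc, map_mul]))
  · exact e.injective (h.cancel _ _ (e c) 1 (by rw [mul_one, mul_one, ← map_mul, hc, map_mul]))
  · obtain ⟨m, ⟨c, hc⟩, ⟨d, hd⟩, -⟩ := (h.right_gcd_lcm (e a) (e b)).2
    exact ⟨e.symm c, e.symm d, e.injective (by simp [hc, hd])⟩
  · obtain ⟨m, ⟨c, hc⟩, ⟨d, hd⟩, -⟩ := (h.left_gcd_lcm (e a) (e b)).2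
    exact ⟨e.symm c, e.symm d, e.injective (by simp [← hc, ← hd])⟩

end Fractions

/-- Descents produce a word with `h w / 2` letters, and subadditivity with value 2 on generators
forbids a shorter one. The factor 2 is there because the height used later counts each pair of rows
twice. -/
theorem closure_eq_top_and_height_eq {W : Type*} [Group W] {S : Set W} {h : W → ℕ}
    (h_one : h 1 = 0) (h_mul : ∀ u v, h (u * v) ≤ h u + h v) (h_gen : ∀ x ∈ S, h x = 2)
    (h_descent : ∀ w, w ≠ 1 → ∃ x ∈ S, h w = 2 + h (x⁻¹ * w)) :
    Submonoid.closure S = ⊤ ∧ ∀ w, 2 * wordLength S w = h w := by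
  have key : ∀ m w, h w = m → ∃ l : List W, (∀ x ∈ l, x ∈ S) ∧ l.prod = w ∧ 2 * l.length = m := by
    intro m
    induction m using Nat.strong_induction_on with
    | _ m ih =>
      intro w hw
      by_cases h1 : w = 1
      · exact ⟨[], by simp, h1.symm, by simp [← hw, h1, h_one]⟩
      · obtain ⟨x, hx, hd⟩ := h_descent w h1
        obtain ⟨l, hl, hp, hc⟩ := ih (h (x⁻¹ * w)) (by omega) _ rfl
        refine ⟨x :: l, ?_, by simp [hp], ?_⟩
        · simpa using ⟨hx, hl⟩
        · rw [List.length_cons]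
          omega
  have hle : ∀ l : List W, (∀ x ∈ l, x ∈ S) → h l.prod ≤ 2 * l.length := by
    intro l
    induction l with
    | nil => simp [h_one]
    | cons a l ih =>
      intro hl
      have h1 := h_mul a l.prod
      have h2 := h_gen a (hl a (by simp))
      have h3 := ih fun x hx => hl x (by simp [hx])
      rw [List.prod_cons, List.length_cons]
      omega
  have hS : Submonoid.closure S = ⊤ := by
    rw [Submonoid.eq_top_iff']
    intro w
    obtain ⟨l, hl, rfl, -⟩ := key _ w rfl
    exact Submonoid.list_prod_mem _ fun x hx => Submonoid.subset_closure (hl x hx)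
  refine ⟨hS, fun w => ?_⟩
  obtain ⟨l, hl, rfl, hc⟩ := key _ w rfl
  obtain ⟨m, hm, hp, hc'⟩ := exists_reduced_word hS l.prod
  have h1 := wordLength_prod_le hl
  have h2 := hle m hm
  rw [hp] at h2
  omega

/-! ### Coordinates and the length formula on `G(∞,∞,n)` -/

namespace GInf

variable {n : ℕ}

theorem T_injective {a b : ℤ} (h : (LaurentPolynomial.T a : ℤ[T;T⁻¹]) = LaurentPolynomial.T b) :
    a = b :=
  (Finsupp.single_left_inj one_ne_zero).mp (congrArg AddMonoidAlgebra.coeff h)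

theorem T_ne_zero (a : ℤ) : (LaurentPolynomial.T a : ℤ[T;T⁻¹]) ≠ 0 :=
  (LaurentPolynomial.isUnit_T a).ne_zero

theorem monomialMatrix_injective {σ τ : Equiv.Perm (Fin n)} {a b : Fin n → ℤ}
    (h : monomialMatrix σ a = monomialMatrix τ b) : σ = τ ∧ a = b := by
  have key : ∀ i, τ i = σ i ∧ a i = b i := fun i => by
    have hi := congrFun (congrFun h i) (σ i)
    simp only [monomialMatrix, Matrix.of_apply, if_true] at hi
    split_ifs at hi with h1
    · exact ⟨h1, T_injective hi⟩
    · exact absurd hi (T_ne_zero _)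
  exact ⟨Equiv.ext fun i => (key i).1.symm, funext fun i => (key i).2⟩

/-- The permutation underlying a monomial matrix. -/
noncomputable def perm (g : GInf n) : Equiv.Perm (Fin n) := g.2.choose

/-- The exponents of the nonzero entries of a monomial matrix, row by row. -/
noncomputable def exp (g : GInf n) : Fin n → ℤ := g.2.choose_spec.choose

theorem val_eq (g : GInf n) : ((g : (Matrix (Fin n) (Fin n) ℤ[T;T⁻¹])ˣ) : Matrix _ _ _) =
    monomialMatrix (perm g) (exp g) :=
  g.2.choose_spec.choose_spec.1

theorem sum_exp (g : GInf n) : ∑ i, exp g i = 0 := by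
  have h : ∏ i, (LaurentPolynomial.T (exp g i) : ℤ[T;T⁻¹]) = 1 :=
    g.2.choose_spec.choose_spec.2
  rw [prod_T, ← LaurentPolynomial.T_zero] at h
  exact T_injective h

theorem perm_exp_of_val_eq {g : GInf n} {σ : Equiv.Perm (Fin n)} {a : Fin n → ℤ}
    (h : ((g : (Matrix (Fin n) (Fin n) ℤ[T;T⁻¹])ˣ) : Matrix _ _ _) = monomialMatrix σ a) :
    perm g = σ ∧ exp g = a :=
  monomialMatrix_injective ((val_eq g).symm.trans h)

theorem ext {g h : GInf n} (hp : perm g = perm h) (he : exp g = exp h) : g = h := by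
  apply Subtype.ext
  apply Units.ext
  rw [val_eq, val_eq, hp, he]

theorem val_mul (g h : GInf n) :
    (((g * h : GInf n) : (Matrix (Fin n) (Fin n) ℤ[T;T⁻¹])ˣ) : Matrix _ _ _) =
    monomialMatrix ((perm g).trans (perm h)) (fun i => exp g i + exp h (perm g i)) := by
  rw [Subgroup.coe_mul, Units.val_mul, val_eq g, val_eq h, monomialMatrix_mul]

@[simp]
theorem perm_mul (g h : GInf n) (i : Fin n) : perm (g * h) i = perm h (perm g i) := by
  rw [(perm_exp_of_val_eq (val_mul g h)).1, Equiv.trans_apply]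

@[simp]
theorem exp_mul (g h : GInf n) (i : Fin n) : exp (g * h) i = exp g i + exp h (perm g i) := by
  rw [(perm_exp_of_val_eq (val_mul g h)).2]

theorem val_one : (((1 : GInf n) : (Matrix (Fin n) (Fin n) ℤ[T;T⁻¹])ˣ) :
    Matrix (Fin n) (Fin n) ℤ[T;T⁻¹]) =
    monomialMatrix 1 (fun _ => 0) := by
  rw [monomialMatrix_one]
  rfl

@[simp]
theorem perm_one : perm (1 : GInf n) = 1 := (perm_exp_of_val_eq val_one).1

@[simp]
theorem exp_one (i : Fin n) : exp (1 : GInf n) i = 0 := by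
  rw [(perm_exp_of_val_eq val_one).2]

/-- The element of `G(∞,∞,n)` with given permutation and exponents. -/
noncomputable def ofPermExp (σ : Equiv.Perm (Fin n)) (a : Fin n → ℤ) (h : ∑ i, a i = 0) :
    GInf n :=
  ⟨{ val := monomialMatrix σ a
     inv := monomialMatrix σ.symm (fun i => -a (σ.symm i))
     val_inv := by
      rw [monomialMatrix_mul, ← monomialMatrix_one]
      congr 1
      · ext i
        simp
      · ext i
        simp
     inv_val := by
      rw [monomialMatrix_mul, ← monomialMatrix_one]
      congr 1
      · ext i
        simp
      · ext i
        simp },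
   σ, a, rfl, by rw [prod_T, h, LaurentPolynomial.T_zero]⟩

@[simp]
theorem perm_ofPermExp (σ : Equiv.Perm (Fin n)) (a : Fin n → ℤ) (h : ∑ i, a i = 0) :
    perm (ofPermExp σ a h) = σ :=
  (perm_exp_of_val_eq rfl).1

@[simp]
theorem exp_ofPermExp (σ : Equiv.Perm (Fin n)) (a : Fin n → ℤ) (h : ∑ i, a i = 0) :
    exp (ofPermExp σ a h) = a :=
  (perm_exp_of_val_eq rfl).2

theorem perm_lam : perm (lam n) = 1 := (perm_exp_of_val_eq rfl).1

theorem exp_lam : exp (lam n) = lamExp n := (perm_exp_of_val_eq rfl).2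

theorem lam_inv : (lam n)⁻¹ = ofPermExp 1 (fun i => -lamExp n i) (by simp [sum_lamExp]) := by
  apply inv_eq_of_mul_eq_one_right
  refine ext (Equiv.ext fun i => ?_) (funext fun i => ?_)
  · simp [perm_lam]
  · simp [perm_lam, exp_lam]

/-- The row of the upper nonzero off-diagonal entry of a generator, numbered from `0`. -/
def row : Gen ℤ n → ℕ
  | .t _ => 0
  | .s j => j.val - 2

/-- The exponent of `x` in the lower nonzero off-diagonal entry of a generator. -/
def shift : Gen ℤ n → ℤ
  | .t i => i
  | .s _ => 0

theorem shift_eq_zero {y : Gen ℤ n} (h : row y ≠ 0) : shift y = 0 := by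
  cases y with
  | t i => exact absurd rfl h
  | s j => rfl

section Generators

variable [hn : Fact (2 ≤ n)]

theorem row_lt (y : Gen ℤ n) : row y + 1 < n := by
  cases y with
  | t i => exact hn.out
  | s j =>
    have := j.2
    simp only [row]
    omega

/-- The smaller of the two rows moved by a generator. -/
def lo (y : Gen ℤ n) : Fin n := ⟨row y, (Nat.lt_succ_self _).trans (row_lt y)⟩

/-- The larger of the two rows moved by a generator. -/
def hi (y : Gen ℤ n) : Fin n := ⟨row y + 1, row_lt y⟩

theorem lo_lt_hi (y : Gen ℤ n) : lo y < hi y := Nat.lt_succ_self _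

/-- The exponents of a generator. -/
def genExp (y : Gen ℤ n) (r : Fin n) : ℤ :=
  if r = lo y then -shift y else if r = hi y then shift y else 0

theorem sum_genExp (y : Gen ℤ n) : ∑ r, genExp y r = 0 := by
  have h : ∀ r, genExp y r = (if r = lo y then -shift y else 0) +
      (if r = hi y then shift y else 0) := fun r => by
    have := lo_lt_hi y
    unfold genExp
    split_ifs with h1 h2 <;> simp_all
  simp [h, Finset.sum_add_distrib]

/-- The generator of `G(∞,∞,n)` attached to a symbol. -/
noncomputable def gen (y : Gen ℤ n) : GInf n :=
  ofPermExp (Equiv.swap (lo y) (hi y)) (genExp y) (sum_genExp y)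

@[simp]
theorem perm_gen (y : Gen ℤ n) : perm (gen y) = Equiv.swap (lo y) (hi y) := perm_ofPermExp _ _ _

@[simp]
theorem exp_gen (y : Gen ℤ n) : exp (gen y) = genExp y := exp_ofPermExp _ _ _

theorem gen_mul_self (y : Gen ℤ n) : gen y * gen y = 1 := by
  have h := lo_lt_hi y
  refine ext (Equiv.ext fun i => by simp) (funext fun i => ?_)
  simp only [exp_mul, exp_gen, perm_gen, exp_one, genExp]
  by_cases h1 : i = lo y
  · simp [h1, h.ne']
  · by_cases h2 : i = hi y
    · simp [h2, h.ne']
    · simp [h1, h2, Equiv.swap_apply_of_ne_of_ne]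

theorem gen_inv (y : Gen ℤ n) : (gen y)⁻¹ = gen y := inv_eq_of_mul_eq_one_right (gen_mul_self y)

theorem tMatrix_eq (i : ℤ) : tMatrix n i =
    monomialMatrix (Equiv.swap (lo (.t i)) (hi (.t i))) (genExp (.t i)) := by
  ext1 r c
  have hn2 := hn.out
  simp only [tMatrix, monomialMatrix, Matrix.of_apply, genExp, Equiv.swap_apply_def]
  simp only [Fin.ext_iff, lo, hi, row, shift]
  rcases r with ⟨r, hr⟩
  rcases c with ⟨c, hc⟩
  rcases r with _ | _ | r
  · simp [eq_comm]
  · simp [eq_comm]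
  · simp

theorem sMatrix_eq (j : SIndex n) : sMatrix n j.val =
    monomialMatrix (Equiv.swap (lo (.s j)) (hi (.s j))) (genExp (.s j)) := by
  ext1 r c
  obtain ⟨j, h3, hj⟩ := j
  obtain ⟨j, rfl⟩ : ∃ k, j = k + 2 := ⟨j - 2, by omega⟩
  simp only [sMatrix, monomialMatrix, Matrix.of_apply, genExp, Equiv.swap_apply_def, shift,
    neg_zero, ite_self, LaurentPolynomial.T_zero]
  simp only [Fin.ext_iff, lo, hi, row, Nat.add_sub_cancel, apply_ite Fin.val]
  split_ifs <;> first | rfl | omega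

theorem genX_eq_range : genX n = Set.range gen := by
  ext g
  constructor
  · rintro (⟨i, h⟩ | ⟨j, h3, hj, h⟩)
    · rw [tMatrix_eq] at h
      refine ⟨.t i, ext ?_ ?_⟩
      · rw [(perm_exp_of_val_eq h).1, perm_gen]
      · rw [(perm_exp_of_val_eq h).2, exp_gen]
    · rw [sMatrix_eq ⟨j, h3, hj⟩] at h
      refine ⟨.s ⟨j, h3, hj⟩, ext ?_ ?_⟩
      · rw [(perm_exp_of_val_eq h).1, perm_gen]
      · rw [(perm_exp_of_val_eq h).2, exp_gen]
  · rintro ⟨y, rfl⟩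
    cases y with
    | t i => exact Or.inl ⟨i, (tMatrix_eq i).symm⟩
    | s j => exact Or.inr ⟨j, j.2.1, j.2.2, (sMatrix_eq j).symm⟩

theorem inv_mem_genX : ∀ x ∈ genX n, x⁻¹ ∈ genX n := by
  rw [genX_eq_range]
  rintro _ ⟨y, rfl⟩
  exact ⟨y, (gen_inv y).symm⟩

end Generators

/-- The contribution of a pair of rows to twice the length. -/
noncomputable def weight (g : GInf n) (i j : Fin n) : ℕ :=
  if i = j then 0
  else if i < j ↔ perm g i < perm g j then (if exp g (max i j) = 0 then 0 else 2) else 1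

/-- Twice the length, as a sum over all ordered pairs of rows. -/
noncomputable def height (g : GInf n) : ℕ := ∑ i, ∑ j, weight g i j

theorem weight_comm (g : GInf n) (i j : Fin n) : weight g i j = weight g j i := by
  rcases lt_trichotomy i j with h | rfl | h
  · rcases lt_or_gt_of_ne ((perm g).injective.ne h.ne) with h' | h' <;>
      simp [weight, h.ne, h.ne', h, h', h.not_gt, h'.not_gt, h.le]
  · rfl
  · rcases lt_or_gt_of_ne ((perm g).injective.ne h.ne) with h' | h' <;>
      simp [weight, h.ne, h.ne', h, h', h.not_gt, h'.not_gt, h.le]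

/-- The working form of the weight: an inverted pair costs one letter; a pair in order costs
nothing, or two letters when the exponent of its larger row is nonzero. -/
theorem weight_of_lt (g : GInf n) {i j : Fin n} (h : i < j) : weight g i j =
    if perm g i < perm g j then (if exp g j = 0 then 0 else 2) else 1 := by
  simp [weight, h.ne, h, max_eq_right h.le]

theorem weight_of_gt (g : GInf n) {i j : Fin n} (h : j < i) : weight g i j =
    if perm g j < perm g i then (if exp g i = 0 then 0 else 2) else 1 := by
  rw [weight_comm, weight_of_lt g h]

/-- If `u` keeps the pair in order, a nonzero exponent of the product comes from one of the factors.
If `u` inverts it, either `v` inverts it back and the cost `1 + 1` is already the maximum, or the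
product inverts it at cost 1. -/
theorem weight_mul_le_of_lt (u v : GInf n) {i j : Fin n} (h : i < j) :
    weight (u * v) i j ≤ weight u i j + weight v (perm u i) (perm u j) := by
  rw [weight_of_lt _ h, weight_of_lt _ h]
  have hv := (perm v).injective.ne ((perm u).injective.ne h.ne)
  rcases lt_or_gt_of_ne ((perm u).injective.ne h.ne) with h' | h'
  · rw [weight_of_lt _ h', perm_mul, perm_mul, exp_mul, if_pos h']
    split_ifs <;> omega
  · rw [weight_of_gt _ h', perm_mul, perm_mul, if_neg h'.not_gt]
    split_ifs with h1 h2 h3 <;> omega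

theorem weight_self (g : GInf n) (i : Fin n) : weight g i i = 0 := if_pos rfl

theorem weight_mul_le (u v : GInf n) (i j : Fin n) :
    weight (u * v) i j ≤ weight u i j + weight v (perm u i) (perm u j) := by
  rcases lt_trichotomy i j with h | rfl | h
  · exact weight_mul_le_of_lt u v h
  · simp [weight_self]
  · rw [weight_comm _ i j, weight_comm u i j, weight_comm v]
    exact weight_mul_le_of_lt u v h

theorem height_eq_sum_perm (u v : GInf n) :
    height v = ∑ i, ∑ j, weight v (perm u i) (perm u j) := by
  rw [height, ← Equiv.sum_comp (perm u)]
  exact Finset.sum_congr rfl fun i _ => (Equiv.sum_comp (perm u) _).symm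

theorem height_mul_le (u v : GInf n) : height (u * v) ≤ height u + height v := by
  rw [height_eq_sum_perm u v, height, height, ← Finset.sum_add_distrib]
  refine Finset.sum_le_sum fun i _ => ?_
  rw [← Finset.sum_add_distrib]
  exact Finset.sum_le_sum fun j _ => weight_mul_le u v i j

/-- A sum of termwise inequalities is an equality only if every term is; this is what makes `≼` a
condition on separate pairs of rows. -/
theorem height_mul_eq_iff (u v : GInf n) : height (u * v) = height u + height v ↔
    ∀ i j, i < j → weight (u * v) i j = weight u i j + weight v (perm u i) (perm u j) := by
  rw [height_eq_sum_perm u v, height, height, ← Finset.sum_add_distrib]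
  simp only [← Finset.sum_add_distrib]
  rw [Finset.sum_eq_sum_iff_of_le fun i _ => Finset.sum_le_sum fun j _ => weight_mul_le u v i j]
  simp only [Finset.mem_univ, true_imp_iff]
  simp only [Finset.sum_eq_sum_iff_of_le fun j _ => weight_mul_le u v _ j]
  simp only [Finset.mem_univ, true_imp_iff]
  refine ⟨fun h i j _ => h i j, fun h i j => ?_⟩
  rcases lt_trichotomy i j with h' | rfl | h'
  · exact h i j h'
  · simp [weight_self]
  · rw [weight_comm _ i j, weight_comm u i j, weight_comm v, h j i h']

/-- The condition for `u ≼ v` on the rows `i < j`. -/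
def PairLE (u v : GInf n) (i j : Fin n) : Prop :=
  (perm u i < perm u j → exp u j = 0 ∨ (perm v i < perm v j ∧ exp u j = exp v j)) ∧
  (perm u j < perm u i →
    (perm v i < perm v j ∧ exp v j ≠ 0) ∨ (perm v j < perm v i ∧ exp u i = exp v i))

theorem weight_mul_eq_iff (u v : GInf n) {i j : Fin n} (h : i < j) :
    weight (u * v) i j = weight u i j + weight v (perm u i) (perm u j) ↔
      PairLE u (u * v) i j := by
  rw [weight_of_lt _ h, weight_of_lt _ h, PairLE]
  have hv := (perm v).injective.ne ((perm u).injective.ne h.ne)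
  simp only [perm_mul, exp_mul]
  rcases lt_or_gt_of_ne ((perm u).injective.ne h.ne) with h' | h'
  · rw [weight_of_lt _ h', if_pos h']
    rcases lt_or_gt_of_ne hv with h2 | h2
    · simp only [h', h2, h'.not_gt, if_true, true_imp_iff, true_and, false_imp_iff, and_true]
      split_ifs <;> (try rw [false_iff]) <;> omega
    · simp only [h', h2.not_gt, h'.not_gt, if_false, true_imp_iff, false_and, false_imp_iff,
        and_true, or_false]
      split_ifs <;> omega
  · rw [weight_of_gt _ h', if_neg h'.not_gt]
    rcases lt_or_gt_of_ne hv with h2 | h2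
    · simp only [h', h2, h2.not_gt, h'.not_gt, if_true, if_false, true_imp_iff, true_and,
        false_imp_iff, false_and, or_false]
      split_ifs <;> (try rw [false_iff]) <;> omega
    · simp only [h', h2, h2.not_gt, h'.not_gt, if_true, if_false, true_imp_iff, true_and,
        false_imp_iff, false_and, false_or]
      split_ifs <;> omega

theorem height_eq_iff (u v : GInf n) : height v = height u + height (u⁻¹ * v) ↔
    ∀ i j, i < j → PairLE u v i j := by
  conv_lhs => rw [← mul_inv_cancel_left u v, inv_mul_cancel_left, height_mul_eq_iff]
  conv_rhs => rw [← mul_inv_cancel_left u v]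
  exact forall₃_congr fun i j h => weight_mul_eq_iff u (u⁻¹ * v) h

theorem height_one : height (1 : GInf n) = 0 := by
  simp only [height, Finset.sum_eq_zero_iff]
  intro i _ j _
  simp [weight]

/-! ### Descents and the identification of the length -/

section Length

variable [hn : Fact (2 ≤ n)]

/-- An adjacent transposition inverts only the pair it exchanges. -/
theorem swap_lt_swap_iff (y : Gen ℤ n) {i j : Fin n} (h : i < j) :
    Equiv.swap (lo y) (hi y) j < Equiv.swap (lo y) (hi y) i ↔ i = lo y ∧ j = hi y := by
  simp only [Equiv.swap_apply_def]
  simp only [Fin.lt_def, Fin.ext_iff, lo, hi] at *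
  split_ifs <;> (try simp only) <;> omega

/-- Only some `t_i` has nonzero exponents, in rows 0 and 1. Row 0 is never the larger row of a pair,
and row 1 is so only in the pair that `t_i` exchanges. Hence a generator has weight 1 on one pair
and 0 on the others. -/
theorem genExp_hi_of_lt (y : Gen ℤ n) {i j : Fin n} (h : i < j)
    (hij : ¬(i = lo y ∧ j = hi y)) : genExp y j = 0 := by
  have hs := shift_eq_zero (y := y)
  unfold genExp
  simp only [Fin.lt_def, Fin.ext_iff, lo, hi] at *
  split_ifs
  · rw [hs (by omega), neg_zero]
  · exact hs (by omega)
  · rfl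

theorem weight_gen (y : Gen ℤ n) (i j : Fin n) : weight (gen y) i j =
    (if i = lo y then (if j = hi y then 1 else 0) else 0) +
      (if i = hi y then (if j = lo y then 1 else 0) else 0) := by
  have hlt := lo_lt_hi y
  have key : ∀ i j, i < j → weight (gen y) i j = if i = lo y ∧ j = hi y then 1 else 0 := by
    intro i j h
    rw [weight_of_lt _ h, perm_gen, exp_gen]
    by_cases h1 : i = lo y ∧ j = hi y
    · rw [if_pos h1, if_neg ((swap_lt_swap_iff y h).mpr h1).not_gt]
    · have h2 := mt (swap_lt_swap_iff y h).mp h1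
      rw [if_neg h1, if_pos (lt_of_le_of_ne (not_lt.mp h2)
        ((Equiv.swap (lo y) (hi y)).injective.ne h.ne)), if_pos (genExp_hi_of_lt y h h1)]
  rcases lt_trichotomy i j with h | rfl | h
  · rw [key i j h]
    split_ifs <;> grind
  · rw [weight_self]
    split_ifs <;> grind
  · rw [weight_comm, key j i h]
    split_ifs <;> grind

theorem height_gen (y : Gen ℤ n) : height (gen y) = 2 := by
  simp [height, weight_gen, Finset.sum_add_distrib]

/-- The condition for a generator to precede an element. -/
def IsDescent (y : Gen ℤ n) (v : GInf n) : Prop :=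
  (perm v (lo y) < perm v (hi y) ∧ exp v (hi y) ≠ 0) ∨
    (perm v (hi y) < perm v (lo y) ∧ exp v (lo y) = -shift y)

theorem height_gen_iff (y : Gen ℤ n) (v : GInf n) :
    height v = height (gen y) + height ((gen y)⁻¹ * v) ↔ IsDescent y v := by
  rw [height_eq_iff]
  have hlt := lo_lt_hi y
  constructor
  · intro h
    have := (h _ _ hlt).2 (by simp [hlt])
    simpa [exp_gen, genExp, eq_comm, IsDescent] using this
  · intro h i j hij
    simp only [PairLE, perm_gen, exp_gen]
    rw [swap_lt_swap_iff y hij]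
    refine ⟨fun h1 => Or.inl (genExp_hi_of_lt y hij fun h2 =>
      h1.not_gt ((swap_lt_swap_iff y hij).mpr h2)), ?_⟩
    rintro ⟨rfl, rfl⟩
    simpa [genExp, IsDescent, eq_comm] using h

/-- Row after row, the missing descents force the permutation to increase and the exponents from row
1 on to vanish. The exponent in row 0 then vanishes because the exponents sum to zero. -/
theorem eq_one_of_forall_not_isDescent {v : GInf n} (h : ∀ y, ¬IsDescent y v) : v = 1 := by
  have h2 := hn.out
  have key : ∀ k, (hk : k + 1 < n) →
      perm v ⟨k, by omega⟩ < perm v ⟨k + 1, hk⟩ ∧ exp v ⟨k + 1, hk⟩ = 0 := by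
    have hne : ∀ k, (hk : k + 1 < n) → perm v ⟨k, by omega⟩ ≠ perm v ⟨k + 1, hk⟩ :=
      fun k hk => (perm v).injective.ne (by simp)
    intro k
    induction k with
    | zero =>
      intro hk
      -- This `t_i` matches the exponent in row 0, so it would be a descent if the first two rows
      -- were inverted; hence they are in order.
      have h0 := h (.t (-exp v ⟨0, by omega⟩))
      have h1 := hne _ hk
      simp only [IsDescent, lo, hi, row, shift, neg_neg, and_true, not_or, not_and, not_not] at h0
      have h3 := lt_of_le_of_ne (not_lt.mp h0.2) h1
      exact ⟨h3, h0.1 h3⟩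
    | succ k ih =>
      intro hk
      -- `s_{k+3}` exchanges the rows `k + 1` and `k + 2`, numbered from 0.
      have h0 := h (.s ⟨k + 3, by omega, by omega⟩)
      have h1 := hne _ hk
      have h4 := (ih (by omega)).2
      simp only [IsDescent, lo, hi, row, shift, neg_zero, not_or, not_and, not_not,
        Nat.reduceSubDiff] at h0
      have h3 := lt_of_le_of_ne (not_lt.mp fun h5 => h0.2 h5 h4) h1
      exact ⟨h3, h0.1 h3⟩
  obtain ⟨m, rfl⟩ : ∃ m, n = m + 1 := ⟨n - 1, by omega⟩
  have hmono : StrictMono (perm v) := Fin.strictMono_iff_lt_succ.mpr fun i =>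
    (key i.val (by omega)).1
  have hperm : perm v = 1 := Equiv.ext fun i => congrFun
    ((StrictMono.range_inj hmono strictMono_id).mp (by simp)) i
  have hexp : ∀ i : Fin m, exp v i.succ = 0 := fun i => (key i.val (by omega)).2
  have hsum := sum_exp v
  rw [Fin.sum_univ_succ, Finset.sum_eq_zero fun i _ => hexp i, add_zero] at hsum
  refine ext (by rw [hperm, perm_one]) (funext fun i => ?_)
  rw [exp_one]
  exact Fin.cases hsum hexp i

theorem closure_genX_and_length : Submonoid.closure (genX n) = ⊤ ∧
    ∀ g : GInf n, 2 * wordLength (genX n) g = height g := by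
  refine closure_eq_top_and_height_eq height_one height_mul_le ?_ fun w hw => ?_
  · rw [genX_eq_range]
    rintro _ ⟨y, rfl⟩
    exact height_gen y
  · rw [genX_eq_range]
    obtain ⟨y, hy⟩ := not_forall_not.mp (mt eq_one_of_forall_not_isDescent hw)
    exact ⟨gen y, ⟨y, rfl⟩, by rw [(height_gen_iff y w).mpr hy, height_gen]⟩

theorem closure_genX : Submonoid.closure (genX n) = ⊤ := closure_genX_and_length.1

theorem two_mul_length (g : GInf n) : 2 * wordLength (genX n) g = height g :=
  closure_genX_and_length.2 g

theorem precedes_iff_pairLE {u v : GInf n} :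
    Precedes (genX n) u v ↔ ∀ i j, i < j → PairLE u v i j := by
  rw [precedes_iff, ← height_eq_iff, ← two_mul_length, ← two_mul_length, ← two_mul_length]
  omega

theorem gen_precedes_iff {y : Gen ℤ n} {v : GInf n} :
    Precedes (genX n) (gen y) v ↔ IsDescent y v := by
  rw [precedes_iff_pairLE, ← height_eq_iff, height_gen_iff]

theorem length_gen (y : Gen ℤ n) : wordLength (genX n) (gen y) = 1 := by
  have h := two_mul_length (gen y)
  rw [height_gen] at h
  omega

end Length

end GInf

/-! ### From local least upper bounds to a lattice -/

section Lattice

variable {W : Type*} [Group W] {S : Set W} {w : W}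

theorem exists_precedes_of_ne_one (hS : Submonoid.closure S = ⊤) {v : W} (hv : v ≠ 1) :
    ∃ y ∈ S, y ≠ 1 ∧ Precedes S y v := by
  obtain ⟨l, hl, rfl, hlen⟩ := exists_reduced_word hS v
  cases l with
  | nil => simp at hv
  | cons y l =>
    have h1 := wordLength_prod_le (S := S) (l := l) fun x hx => hl x (by simp [hx])
    have h2 := wordLength_mul_le hS y l.prod
    have h3 := wordLength_prod_le (S := S) (l := [y]) (by simpa using hl y (by simp))
    simp only [List.prod_cons, List.length_cons, List.prod_nil, mul_one, List.length_nil] at *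
    refine ⟨y, hl y (by simp), ?_, precedes_mul_right_iff.mpr (by omega)⟩
    rw [Ne, ← wordLength_eq_zero_iff hS]
    omega

/-- In a balanced interval in which any two distinct generators have a local least upper bound,
any two elements have a join. -/
theorem exists_join (hS : Submonoid.closure S = ⊤) (hb : IsBalanced S w)
    (hloc : ∀ y ∈ S, ∀ z ∈ S, y ≠ z → ∃ m, Precedes S y m ∧ Precedes S z m ∧
      ∀ v ∈ interval S w, Precedes S y v → Precedes S z v → Precedes S m v)
    {x u v : W} (hu : u ∈ interval S w) (hv : v ∈ interval S w) (hxu : Precedes S x u)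
    (hxv : Precedes S x v) : ∃ p ∈ interval S w, Precedes S u p ∧ Precedes S v p ∧
      ∀ c ∈ interval S w, Precedes S u c → Precedes S v c → Precedes S p c := by
  -- The common lower bound `x` climbs towards `w`. Balancedness puts each quotient `x⁻¹ c` back in
  -- the interval, where the local hypothesis applies.
  induction hd : wordLength S w - wordLength S x using Nat.strong_induction_on
    generalizing x u v with
  | _ d ih =>
    by_cases hu1 : x⁻¹ * u = 1
    · obtain rfl := inv_mul_eq_one.mp hu1
      exact ⟨v, hv, hxv, precedes_refl S v, fun c _ _ h => h⟩
    by_cases hv1 : x⁻¹ * v = 1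
    · obtain rfl := inv_mul_eq_one.mp hv1
      exact ⟨u, hu, precedes_refl S u, hxu, fun c _ h _ => h⟩
    obtain ⟨y, hy, hy1, hyu⟩ := exists_precedes_of_ne_one hS hu1
    obtain ⟨z, hz, hz1, hzv⟩ := exists_precedes_of_ne_one hS hv1
    have hmul : ∀ {a c : W}, Precedes S x c → Precedes S a (x⁻¹ * c) →
        Precedes S (x * a) c ∧ wordLength S (x * a) = wordLength S x + wordLength S a :=
      fun {a c} hc ha => by
        have h := (precedes_mul_left_iff hS (x := x) (u := a) (v := x⁻¹ * c)
          (by simpa using precedes_iff.mp hc)).mpr ha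
        simpa using h
    have hdiv : ∀ {c : W}, c ∈ interval S w → Precedes S x c → x⁻¹ * c ∈ interval S w :=
      fun {c} hc hxc => hb.right_mem hS (a := x) (by simpa using hc)
        (by simpa using precedes_iff.mp hxc)
    have hdiv' : ∀ {a c : W}, Precedes S (x * a) c →
        wordLength S (x * a) = wordLength S x + wordLength S a →
        Precedes S x c → Precedes S a (x⁻¹ * c) := fun {a c} hac hl hc => by
      refine (precedes_mul_left_iff hS (x := x) (by simpa using precedes_iff.mp hc)).mp ?_
      simpa using ⟨hac, hl⟩
    obtain ⟨hyu', hyl⟩ := hmul hxu hyu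
    obtain ⟨hzv', hzl⟩ := hmul hxv hzv
    have hwu := (hyu'.trans hS (mem_interval_iff.mp hu)).wordLength_le
    have hwv := (hzv'.trans hS (mem_interval_iff.mp hv)).wordLength_le
    have hy0 := mt (wordLength_eq_zero_iff hS).mp hy1
    have hz0 := mt (wordLength_eq_zero_iff hS).mp hz1
    by_cases hyz : y = z
    · subst hyz
      exact ih _ (by omega) hu hv hyu' hzv' rfl
    obtain ⟨m, hym, hzm, hm⟩ := hloc y hy z hz hyz
    have hle : ∀ c ∈ interval S w, Precedes S u c → Precedes S v c →
        Precedes S (x * m) c ∧ wordLength S (x * m) = wordLength S x + wordLength S m := by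
      intro c hc huc hvc
      have hxc := hxu.trans hS huc
      exact hmul hxc (hm _ (hdiv hc hxc) (hdiv' (hyu'.trans hS huc) hyl hxc)
        (hdiv' (hzv'.trans hS hvc) hzl hxc))
    obtain ⟨hmw, hml⟩ := hle w (self_mem_interval S w) (mem_interval_iff.mp hu)
      (mem_interval_iff.mp hv)
    -- With `m` bounding `y` and `z`, first join `u` with `x m`, both above `x y`; then join the
    -- result with `v`, both above `x z`. Any upper bound of `u` and `v` lies above `x m`, so
    -- nothing is lost.
    obtain ⟨p, hp, hup, hmp, hpm⟩ := ih _ (by omega) hu (mem_interval_iff.mpr hmw) hyu'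
      (hym.mul_left hS hml) rfl
    obtain ⟨q, hq, hpq, hvq, hqm⟩ := ih _ (by omega) hp hv ((hzm.mul_left hS hml).trans hS hmp)
      hzv' rfl
    exact ⟨q, hq, hup.trans hS hpq, hvq, fun c hc huc hvc =>
      hqm c hc (hpm c hc huc (hle c hc huc hvc).1) hvc⟩

/-- Joins come from `exists_join` with lower bound 1. A meet is a common lower bound of maximal
length: its join with another common lower bound is again one. -/
theorem isLatticeOrder_of_local (hS : Submonoid.closure S = ⊤) (hb : IsBalanced S w)
    (hloc : ∀ y ∈ S, ∀ z ∈ S, y ≠ z → ∃ m, Precedes S y m ∧ Precedes S z m ∧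
      ∀ v ∈ interval S w, Precedes S y v → Precedes S z v → Precedes S m v) :
    IsLatticeOrder (fun a b : interval S w => Precedes S (a : W) b) := by
  have hsup : ∀ u v : interval S w, ∃ p : interval S w, Precedes S (u : W) p ∧
      Precedes S (v : W) p ∧ ∀ c : interval S w, Precedes S (u : W) c → Precedes S (v : W) c →
        Precedes S (p : W) c := fun u v => by
    obtain ⟨p, hp, h1, h2, h3⟩ := exists_join hS hb hloc u.2 v.2 (one_precedes S _)
      (one_precedes S _)
    exact ⟨⟨p, hp⟩, h1, h2, fun c => h3 c c.2⟩
  have hinf : ∀ u v : interval S w, ∃ p : interval S w, Precedes S (p : W) u ∧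
      Precedes S (p : W) v ∧ ∀ c : interval S w, Precedes S (c : W) u → Precedes S (c : W) v →
        Precedes S (c : W) p := fun u v => by
    classical
    let P : ℕ → Prop := fun m => ∃ c : interval S w,
      (Precedes S (c : W) u ∧ Precedes S (c : W) v) ∧ wordLength S (c : W) = m
    have hP : P 0 := ⟨⟨1, one_mem_interval S w⟩, ⟨one_precedes S _, one_precedes S _⟩,
      wordLength_one S⟩
    obtain ⟨p, ⟨hpu, hpv⟩, hp⟩ := Nat.findGreatest_spec (P := P)
      (Nat.zero_le (wordLength S (u : W))) hP
    refine ⟨p, hpu, hpv, fun c hcu hcv => ?_⟩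
    obtain ⟨q, hpq, hcq, hq⟩ := hsup p c
    have hqu := hq u hpu hcu
    have hmax := Nat.le_findGreatest (P := P) hqu.wordLength_le ⟨q, ⟨hqu, hq v hpv hcv⟩, rfl⟩
    rw [← hp] at hmax
    rw [hpq.eq_of_wordLength_le hS hmax]
    exact hcq
  choose sup h1 h2 h3 using hsup
  choose inf h4 h5 h6 using hinf
  exact ⟨{
    le a b := Precedes S (a : W) b
    le_refl a := precedes_refl S _
    le_trans a b c h h' := h.trans hS h'
    le_antisymm a b h h' := Subtype.ext (h.antisymm hS h')
    sup := sup
    inf := inf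
    le_sup_left := h1
    le_sup_right := h2
    sup_le a b c := h3 a b c
    inf_le_left := h4
    inf_le_right := h5
    le_inf a b c := h6 b c a }, fun a b => Iff.rfl⟩

end Lattice

/-! ### The intervals `[1, λ^k]` and the monoids `B^{⊕k}(∞,∞,n)` -/

namespace GInf

variable {n : ℕ}

theorem perm_lam_zpow {k : ℤ} (hk : k = 1 ∨ k = -1) : perm (lam n ^ k) = 1 := by
  rcases hk with rfl | rfl
  · rw [zpow_one, perm_lam]
  · rw [zpow_neg_one, lam_inv, perm_ofPermExp]

theorem exp_lam_zpow {k : ℤ} (hk : k = 1 ∨ k = -1) {i j : Fin n} (hij : i < j) :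
    exp (lam n ^ k) j = k := by
  have hj : j.val ≠ 0 := by
    have := Fin.lt_def.mp hij
    omega
  rcases hk with rfl | rfl
  · rw [zpow_one, exp_lam, lamExp, if_neg hj]
  · rw [zpow_neg_one, lam_inv, exp_ofPermExp, lamExp, if_neg hj]

theorem perm_inv (g : GInf n) : perm g⁻¹ = (perm g).symm := by
  refine Equiv.ext fun i => ?_
  have h := perm_mul g⁻¹ g i
  rw [inv_mul_cancel, perm_one, Equiv.Perm.one_apply] at h
  rw [Equiv.eq_symm_apply, ← h]

theorem exp_inv (g : GInf n) (i : Fin n) : exp g⁻¹ (perm g i) = -exp g i := by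
  have h := exp_mul g g⁻¹ i
  rw [mul_inv_cancel, exp_one] at h
  omega

/-- The element of `B^{⊕k}(∞,∞,n)` represented by a word in the generators. -/
def braidWord (k : ℤ) (l : List (Gen ℤ n)) : BPlus n k :=
  (l.map (PresentedMonoid.of (BPlusRel n k))).prod

theorem braidWord_cons (k : ℤ) (y : Gen ℤ n) (l : List (Gen ℤ n)) :
    braidWord k (y :: l) = PresentedMonoid.of (BPlusRel n k) y * braidWord k l := by
  simp [braidWord]

theorem braidWord_append (k : ℤ) (l m : List (Gen ℤ n)) :
    braidWord k (l ++ m) = braidWord k l * braidWord k m := by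
  simp [braidWord]

theorem braidWord_ofList (k : ℤ) (l : List (Gen ℤ n)) :
    PresentedMonoid.mk (BPlusRel n k) (FreeMonoid.ofList l) = braidWord k l := by
  induction l with
  | nil => rfl
  | cons y l ih => rw [braidWord_cons, ← ih, FreeMonoid.ofList_cons, map_mul]; rfl

theorem braidWord_braid (k : ℤ) {y z : Gen ℤ n} (h : row z = row y + 1) :
    braidWord k [y, z, y] = braidWord k [z, y, z] := by
  rw [← braidWord_ofList, ← braidWord_ofList]
  cases z with
  | t i => simp [row] at h
  | s a =>
    cases y with
    | t i =>
      refine (PresentedMonoid.mk_eq_mk_of_rel (BPlusRel.braid_t a ?_ i)).symm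
      have := a.2
      simp only [row] at h
      omega
    | s b =>
      refine PresentedMonoid.mk_eq_mk_of_rel (BPlusRel.braid_s b a ?_)
      have := a.2
      have := b.2
      simp only [row] at h
      omega

theorem braidWord_comm (k : ℤ) {y z : Gen ℤ n} (h : row y + 1 < row z) :
    braidWord k [y, z] = braidWord k [z, y] := by
  rw [← braidWord_ofList, ← braidWord_ofList]
  cases z with
  | t i => simp [row] at h
  | s a =>
    cases y with
    | t i =>
      refine (PresentedMonoid.mk_eq_mk_of_rel (BPlusRel.comm_t a ?_ i)).symm
      simp only [row] at h
      omega
    | s b =>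
      refine PresentedMonoid.mk_eq_mk_of_rel (BPlusRel.comm_s b a ?_)
      have := b.2
      simp only [row] at h
      omega

theorem braidWord_dual (k i j : ℤ) : braidWord k [Gen.t i, Gen.t (i - k)] =
    braidWord k ([Gen.t j, Gen.t (j - k)] : List (Gen ℤ n)) := by
  rw [← braidWord_ofList, ← braidWord_ofList]
  exact PresentedMonoid.mk_eq_mk_of_rel (BPlusRel.dual i j)

section Interval

variable [hn : Fact (2 ≤ n)] {k : ℤ}

/-- For `λ^k` all pairs are in order and all exponents outside row 0 equal `k ≠ 0`, so the condition
on pairs inverted by `g` holds automatically and only the other pairs constrain `g`. -/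
theorem mem_interval_lam (hk : k = 1 ∨ k = -1) {g : GInf n} :
    g ∈ interval (genX n) (lam n ^ k) ↔
      ∀ i j, i < j → perm g i < perm g j → exp g j = 0 ∨ exp g j = k := by
  rw [mem_interval_iff, precedes_iff_pairLE]
  refine forall₃_congr fun i j hij => ?_
  simp only [PairLE, perm_lam_zpow hk, exp_lam_zpow hk hij, Equiv.Perm.one_apply]
  have hk0 : k ≠ 0 := by omega
  simp [hij, hk0]

/-- Passing to `g⁻¹` relabels rows by columns and changes the sign of the exponents, so the
criterion for `k` becomes the criterion for `-k`. -/
theorem isBalanced_lam (hk : k = 1 ∨ k = -1) : IsBalanced (genX n) (lam n ^ k) := by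
  ext g
  rw [← inv_mem_interval_iff closure_genX inv_mem_genX, ← zpow_neg, mem_interval_lam hk,
    mem_interval_lam (by omega)]
  constructor
  · intro h i j hij hg
    obtain ⟨i, rfl⟩ := (perm g).surjective i
    obtain ⟨j, rfl⟩ := (perm g).surjective j
    rw [perm_inv, Equiv.symm_apply_apply, Equiv.symm_apply_apply] at hg
    have := h i j hg hij
    rw [exp_inv]
    omega
  · intro h i j hij hg
    have := h _ _ hg (by simpa [perm_inv] using hij)
    rw [exp_inv] at this
    omega

theorem isDescent_lam (hk : k = 1 ∨ k = -1) (y : Gen ℤ n) : IsDescent y (lam n ^ k) := by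
  refine Or.inl ⟨?_, ?_⟩
  · rw [perm_lam_zpow hk]
    exact lo_lt_hi y
  · rw [exp_lam_zpow hk (lo_lt_hi y)]
    omega

/-- The element represented by a word in the generators. -/
noncomputable def wordProd (l : List (Gen ℤ n)) : GInf n := (l.map gen).prod

/-- All the letters of the word `l` can be successively removed from the left of `v`. -/
def IsLeftReduced : List (Gen ℤ n) → GInf n → Prop
  | [], _ => True
  | y :: l, v => IsDescent y v ∧ IsLeftReduced l (gen y * v)

@[simp]
theorem wordProd_nil : wordProd ([] : List (Gen ℤ n)) = 1 := rfl

@[simp]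
theorem wordProd_cons (y : Gen ℤ n) (l : List (Gen ℤ n)) :
    wordProd (y :: l) = gen y * wordProd l := by
  simp [wordProd]

@[simp]
theorem wordProd_append (l m : List (Gen ℤ n)) :
    wordProd (l ++ m) = wordProd l * wordProd m := by
  simp [wordProd]

theorem length_wordProd_le (l : List (Gen ℤ n)) :
    wordLength (genX n) (wordProd l) ≤ l.length := by
  refine (wordLength_prod_le fun x hx => ?_).trans (by simp)
  rw [genX_eq_range]
  obtain ⟨y, -, rfl⟩ := List.mem_map.mp hx
  exact ⟨y, rfl⟩

theorem IsLeftReduced.length_eq {l : List (Gen ℤ n)} {v : GInf n} (h : IsLeftReduced l v) :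
    wordLength (genX n) v = l.length + wordLength (genX n) ((wordProd l)⁻¹ * v) := by
  induction l generalizing v with
  | nil => simp
  | cons y l ih =>
    have h1 := precedes_iff.mp (gen_precedes_iff.mpr h.1)
    rw [length_gen, gen_inv] at h1
    rw [h1, ih h.2, wordProd_cons, mul_inv_rev, gen_inv, List.length_cons, mul_assoc]
    omega

theorem IsLeftReduced.length_wordProd {l : List (Gen ℤ n)} {v : GInf n}
    (h : IsLeftReduced l v) : wordLength (genX n) (wordProd l) = l.length := by
  have h1 := h.length_eq
  have h2 := wordLength_mul_le closure_genX (wordProd l) ((wordProd l)⁻¹ * v)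
  have h3 := length_wordProd_le l
  rw [mul_inv_cancel_left] at h2
  omega

theorem IsLeftReduced.precedes {l : List (Gen ℤ n)} {v : GInf n}
    (h : IsLeftReduced l v) : Precedes (genX n) (wordProd l) v := by
  rw [precedes_iff, h.length_wordProd]
  exact h.length_eq

theorem wordProd_braid {y z : Gen ℤ n} (h : row z = row y + 1) :
    wordProd [y, z, y] = wordProd [z, y, z] := by
  have hz : lo z = hi y := Fin.ext h
  have h1 := (lo_lt_hi y).ne
  have h2 := (lo_lt_hi z).ne
  have h3 := ((lo_lt_hi y).trans_eq hz.symm |>.trans (lo_lt_hi z)).ne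
  have hs := shift_eq_zero (y := z) (by omega)
  rw [hz] at h2
  simp only [wordProd_cons, wordProd_nil, mul_one]
  refine ext (Equiv.ext fun i => ?_) (funext fun i => ?_)
  · simp only [perm_mul, perm_gen, hz]
    by_cases i1 : i = lo y
    · simp [i1, Equiv.swap_apply_of_ne_of_ne, h1, h3, h2.symm, h3.symm]
    by_cases i2 : i = hi y
    · simp [i2, Equiv.swap_apply_of_ne_of_ne, h1, h3, h2.symm, h3.symm]
    by_cases i3 : i = hi z
    · simp [i3, Equiv.swap_apply_of_ne_of_ne, h1, h3, h2.symm, h3.symm]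
    simp [Equiv.swap_apply_of_ne_of_ne, i1, i2, i3]
  · simp only [exp_mul, exp_gen, perm_gen, hz, genExp, hs, neg_zero, ite_self]
    by_cases i1 : i = lo y
    · simp [i1, Equiv.swap_apply_of_ne_of_ne, h1, h3, h2.symm, h3.symm]
    by_cases i2 : i = hi y
    · simp [i2, Equiv.swap_apply_of_ne_of_ne, h1, h3, h1.symm, h2.symm, h3.symm]
    by_cases i3 : i = hi z
    · simp [i3, Equiv.swap_apply_of_ne_of_ne, h1.symm, h2.symm, h3.symm]
    simp [Equiv.swap_apply_of_ne_of_ne, i1, i2, i3]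

theorem isLeftReduced_braid {y z : Gen ℤ n} (h : row z = row y + 1) {v : GInf n}
    (hy : IsDescent y v) (hv : IsDescent z v) :
    IsLeftReduced [y, z, y] v ∧ IsLeftReduced [z, y, z] v := by
  have hz : lo z = hi y := Fin.ext h
  have h1 := (lo_lt_hi y).ne
  have h2 := (lo_lt_hi z).ne
  have h3 := ((lo_lt_hi y).trans_eq hz.symm |>.trans (lo_lt_hi z)).ne
  have hs := shift_eq_zero (y := z) (by omega)
  rw [hz] at h2
  -- Two adjacent descents imply the descent condition for the outer two rows, with the shift of
  -- `y`. This is the middle letter of both braid words.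
  have key : (perm v (lo y) < perm v (hi z) ∧ exp v (hi z) ≠ 0) ∨
      (perm v (hi z) < perm v (lo y) ∧ exp v (lo y) = -shift y) := by
    have h4 := (perm v).injective.ne h3
    simp only [IsDescent, hz, hs, neg_zero] at hy hv
    rcases lt_or_gt_of_ne h4 with h4 | h4
    · grind
    · grind
  simp only [IsLeftReduced, IsDescent, perm_mul, exp_mul, perm_gen, exp_gen, genExp, hz, hs,
    neg_zero, and_true] at hy hv ⊢
  simp only [h1, h2, h3, h1.symm, h2.symm, h3.symm, Equiv.swap_apply_left,
    Equiv.swap_apply_right, Equiv.swap_apply_of_ne_of_ne, ne_eq, not_false_eq_true, if_true,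
    if_false, ite_self, zero_add] at hy hv key ⊢
  grind

theorem wordProd_comm {y z : Gen ℤ n} (h : row y + 1 < row z) :
    wordProd [y, z] = wordProd [z, y] := by
  have h1 : lo y ≠ lo z := fun h1 => by have := Fin.ext_iff.mp h1; simp only [lo] at this; omega
  have h2 : lo y ≠ hi z := fun h1 => by have := Fin.ext_iff.mp h1; simp only [lo, hi] at this; omega
  have h3 : hi y ≠ lo z := fun h1 => by have := Fin.ext_iff.mp h1; simp only [lo, hi] at this; omega
  have h4 : hi y ≠ hi z := fun h1 => by have := Fin.ext_iff.mp h1; simp only [hi] at this; omega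
  have hs := shift_eq_zero (y := z) (by omega)
  simp only [wordProd_cons, wordProd_nil, mul_one]
  refine ext (Equiv.ext fun i => ?_) (funext fun i => ?_)
  · simp only [perm_mul, perm_gen]
    by_cases i1 : i = lo y
    · simp [i1, Equiv.swap_apply_of_ne_of_ne, h1, h2, h3, h4]
    by_cases i2 : i = hi y
    · simp [i2, Equiv.swap_apply_of_ne_of_ne, h1, h2, h3, h4]
    by_cases i3 : i = lo z
    · simp [i3, Equiv.swap_apply_of_ne_of_ne, h1.symm, h2.symm, h3.symm, h4.symm]
    by_cases i4 : i = hi z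
    · simp [i4, Equiv.swap_apply_of_ne_of_ne, h1.symm, h2.symm, h3.symm, h4.symm]
    simp [Equiv.swap_apply_of_ne_of_ne, i1, i2, i3, i4]
  · simp only [exp_mul, exp_gen, perm_gen, genExp, hs, neg_zero, ite_self]
    by_cases i3 : i = lo z
    · simp [i3, h1.symm, h2.symm, h3.symm, h4.symm]
    by_cases i4 : i = hi z
    · simp [i4, h1.symm, h2.symm, h3.symm, h4.symm]
    simp [Equiv.swap_apply_of_ne_of_ne, i3, i4]

theorem isLeftReduced_comm {y z : Gen ℤ n} (h : row y + 1 < row z) {v : GInf n}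
    (hy : IsDescent y v) (hv : IsDescent z v) :
    IsLeftReduced [y, z] v ∧ IsLeftReduced [z, y] v := by
  have h1 : lo y ≠ lo z := fun h1 => by have := Fin.ext_iff.mp h1; simp only [lo] at this; omega
  have h2 : lo y ≠ hi z := fun h1 => by have := Fin.ext_iff.mp h1; simp only [lo, hi] at this; omega
  have h3 : hi y ≠ lo z := fun h1 => by have := Fin.ext_iff.mp h1; simp only [lo, hi] at this; omega
  have h4 : hi y ≠ hi z := fun h1 => by have := Fin.ext_iff.mp h1; simp only [hi] at this; omega
  simp only [IsLeftReduced, IsDescent, perm_mul, exp_mul, perm_gen, exp_gen, genExp,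
    and_true] at hy hv ⊢
  simp only [h1, h2, h3, h4, h1.symm, h2.symm, h3.symm, h4.symm,
    Equiv.swap_apply_of_ne_of_ne, ne_eq, not_false_eq_true, if_false, zero_add]
  exact ⟨⟨hy, hv⟩, hv, hy⟩

/-- The product is diagonal with exponents `-k` and `k` in the first two rows, independently of `i`.
-/
theorem wordProd_dual (k i j : ℤ) : wordProd [Gen.t i, Gen.t (i - k)] =
    wordProd ([Gen.t j, Gen.t (j - k)] : List (Gen ℤ n)) := by
  have h1 : ∀ a b : ℤ, lo (.t a : Gen ℤ n) = lo (.t b : Gen ℤ n) := fun a b => rfl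
  have h2 : ∀ a b : ℤ, hi (.t a : Gen ℤ n) = hi (.t b : Gen ℤ n) := fun a b => rfl
  have h3 := (lo_lt_hi (.t 0 : Gen ℤ n)).ne
  simp only [wordProd_cons, wordProd_nil, mul_one]
  refine ext (Equiv.ext fun r => ?_) (funext fun r => ?_)
  · simp only [perm_mul, perm_gen, h1 _ 0, h2 _ 0, Equiv.swap_apply_self]
  · simp only [exp_mul, exp_gen, perm_gen, genExp, h1 _ 0, h2 _ 0, shift]
    by_cases r1 : r = lo (.t 0)
    · simp only [r1, Equiv.swap_apply_left, h3.symm, if_true, if_false]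
      ring
    by_cases r2 : r = hi (.t 0)
    · simp only [r2, Equiv.swap_apply_right, h3.symm, if_true, if_false]
      ring
    simp [Equiv.swap_apply_of_ne_of_ne, r1, r2]

/-- If the first two rows of `v` were inverted, the exponent in row 0 would determine the index of
the descent. So they are in order with nonzero exponent in row 1, which equals `k` by membership in
the interval; after removal of `t_i` the next letter is `t_{i-k}`. -/
theorem isLeftReduced_dual (hk : k = 1 ∨ k = -1) {i j : ℤ} (hij : i ≠ j) {v : GInf n}
    (hv : v ∈ interval (genX n) (lam n ^ k)) (hi' : IsDescent (.t i) v)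
    (hj : IsDescent (.t j) v) : IsLeftReduced [.t i, .t (i - k)] v := by
  have h1 : ∀ a b : ℤ, lo (.t a : Gen ℤ n) = lo (.t b : Gen ℤ n) := fun a b => rfl
  have h2 : ∀ a b : ℤ, hi (.t a : Gen ℤ n) = hi (.t b : Gen ℤ n) := fun a b => rfl
  have h3 := (lo_lt_hi (.t 0 : Gen ℤ n)).ne
  have h4 := (mem_interval_lam hk).mp hv _ _ (lo_lt_hi (.t 0))
  refine ⟨hi', ?_, trivial⟩
  simp only [IsDescent, h1 _ 0, h2 _ 0, shift, perm_mul, perm_gen, exp_mul, exp_gen, genExp,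
    Equiv.swap_apply_left, Equiv.swap_apply_right, if_true] at *
  rcases hi' with ⟨h5, h6⟩ | ⟨h5, h6⟩
  · rcases h4 h5 with h4 | h4
    · exact absurd h4 h6
    · exact Or.inr ⟨h5, by omega⟩
  · rcases hj with ⟨h7, -⟩ | ⟨-, h7⟩
    · exact absurd h7 h5.not_gt
    · omega

/-- Two distinct generators have a common multiple given by a defining relation of
`B^{⊕k}(∞,∞,n)`, which precedes every element of the interval preceded by both. -/
theorem exists_local_lcm (hk : k = 1 ∨ k = -1) {y z : Gen ℤ n} (hyz : y ≠ z) :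
    ∃ p q : List (Gen ℤ n), braidWord k (y :: p) = braidWord k (z :: q) ∧
      wordProd (y :: p) = wordProd (z :: q) ∧
      ∀ v ∈ interval (genX n) (lam n ^ k), IsDescent y v → IsDescent z v →
        IsLeftReduced (y :: p) v ∧ IsLeftReduced (z :: q) v := by
  rcases lt_trichotomy (row y) (row z) with h | h | h
  · rcases Nat.lt_or_eq_of_le (Nat.succ_le_of_lt h) with h' | h'
    · exact ⟨[z], [y], braidWord_comm k h', wordProd_comm h', fun v _ => isLeftReduced_comm h'⟩
    · exact ⟨[z, y], [y, z], braidWord_braid k h'.symm, wordProd_braid h'.symm,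
        fun v _ => isLeftReduced_braid h'.symm⟩
  · cases y with
    | t i =>
      cases z with
      | t j =>
        have hij : i ≠ j := fun hij => hyz (by rw [hij])
        exact ⟨[.t (i - k)], [.t (j - k)], braidWord_dual k i j, wordProd_dual k i j,
          fun v hv h1 h2 => ⟨isLeftReduced_dual hk hij hv h1 h2,
            isLeftReduced_dual hk hij.symm hv h2 h1⟩⟩
      | s b =>
        have := b.2
        simp only [row] at h
        omega
    | s a =>
      have := a.2
      cases z with
      | t j =>
        simp only [row] at h
        omega
      | s b =>
        have := b.2
        simp only [row] at h
        exact absurd (congrArg Gen.s (Subtype.ext (by omega))) hyz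
  · rcases Nat.lt_or_eq_of_le (Nat.succ_le_of_lt h) with h' | h'
    · exact ⟨[z], [y], (braidWord_comm k h').symm, (wordProd_comm h').symm,
        fun v _ h1 h2 => (isLeftReduced_comm h' h2 h1).symm⟩
    · exact ⟨[z, y], [y, z], (braidWord_braid k h'.symm).symm, (wordProd_braid h'.symm).symm,
        fun v _ h1 h2 => (isLeftReduced_braid h'.symm h2 h1).symm⟩

theorem isLeftGarsideInterval_lam (hk : k = 1 ∨ k = -1) :
    IsLeftGarsideInterval (genX n) (lam n ^ k) where
  generates := closure_genX
  balanced := isBalanced_lam hk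
  lattice := by
    refine isLatticeOrder_of_local closure_genX (isBalanced_lam hk) ?_
    rw [genX_eq_range]
    rintro _ ⟨y, rfl⟩ _ ⟨z, rfl⟩ hyz
    obtain ⟨p, q, -, heq, h⟩ := exists_local_lcm hk (ne_of_apply_ne gen hyz)
    rw [← genX_eq_range]
    -- Since all generators are descents of `λ^k`, the common multiple is a reduced word and really
    -- lies above both generators.
    have hlam := h _ (self_mem_interval _ _) (isDescent_lam hk y) (isDescent_lam hk z)
    have hpre : ∀ (y : Gen ℤ n) (p : List (Gen ℤ n)), IsLeftReduced (y :: p) (lam n ^ k) →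
        Precedes (genX n) (gen y) (wordProd (y :: p)) := fun y p hp => by
      rw [wordProd_cons, precedes_mul_right_iff, ← wordProd_cons, hp.length_wordProd,
        hp.2.length_wordProd, length_gen, List.length_cons, add_comm]
    refine ⟨wordProd (y :: p), hpre y p hlam.1, heq ▸ hpre z q hlam.2, fun v hv hyv hzv => ?_⟩
    exact (h v hv (gen_precedes_iff.mp hyv) (gen_precedes_iff.mp hzv)).1.precedes

/-- A word of minimal length representing `v`. -/
def IsReducedWord (l : List (Gen ℤ n)) (v : GInf n) : Prop :=
  wordProd l = v ∧ wordLength (genX n) v = l.length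

theorem exists_isReducedWord (v : GInf n) : ∃ l, IsReducedWord l v := by
  obtain ⟨l, hl, rfl, hlen⟩ := exists_reduced_word closure_genX v
  rw [genX_eq_range] at hl
  obtain ⟨m, rfl⟩ : ∃ m : List (Gen ℤ n), m.map gen = l := by
    rw [← Set.mem_range, Set.range_list_map]
    exact hl
  exact ⟨m, rfl, by simpa using hlen.symm⟩

theorem IsReducedWord.tail {y : Gen ℤ n} {l : List (Gen ℤ n)} {v : GInf n}
    (h : IsReducedWord (y :: l) v) : IsReducedWord l ((gen y)⁻¹ * v) ∧
      Precedes (genX n) (gen y) v := by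
  obtain ⟨rfl, hl⟩ := h
  rw [wordProd_cons, List.length_cons] at hl
  have h1 := length_wordProd_le l
  have h2 := wordLength_mul_le closure_genX (gen y) (wordProd l)
  rw [length_gen] at h2
  rw [wordProd_cons, inv_mul_cancel_left, precedes_mul_right_iff, length_gen]
  exact ⟨⟨rfl, by omega⟩, by omega⟩

/-- Two reduced words for the same element of the interval are equal in `B^{⊕k}(∞,∞,n)`. -/
theorem braidWord_eq_of_isReducedWord (hk : k = 1 ∨ k = -1) {v : GInf n}
    (hv : v ∈ interval (genX n) (lam n ^ k)) {l m : List (Gen ℤ n)} (hl : IsReducedWord l v)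
    (hm : IsReducedWord m v) : braidWord k l = braidWord k m := by
  induction hd : wordLength (genX n) v generalizing v l m with
  | zero =>
    rw [List.length_eq_zero_iff.mp (hl.2.symm.trans hd),
      List.length_eq_zero_iff.mp (hm.2.symm.trans hd)]
  | succ d ih =>
    cases l with
    | nil => simp [hl.2] at hd
    | cons y l =>
    cases m with
    | nil => simp [hm.2] at hd
    | cons z m =>
    have hstep : ∀ {y : Gen ℤ n} {l m : List (Gen ℤ n)}, IsReducedWord (y :: l) v →
        IsReducedWord (y :: m) v → braidWord k (y :: l) = braidWord k (y :: m) := by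
      intro y l m hl hm
      have hd' := hl.tail.1.2
      rw [hl.2, List.length_cons] at hd
      rw [braidWord_cons, braidWord_cons, ih ?_ hl.tail.1 hm.tail.1 (by omega)]
      exact (isLeftGarsideInterval_lam hk).quotient_mem ⟨v, hv⟩ hl.tail.2
    by_cases hyz : y = z
    · subst hyz
      exact hstep hl hm
    · obtain ⟨p, q, hB, hG, h⟩ := exists_local_lcm hk hyz
      obtain ⟨h1, h2⟩ := h v hv (gen_precedes_iff.mp hl.tail.2) (gen_precedes_iff.mp hm.tail.2)
      -- A reduced word of the remainder completes both sides of the relation to reduced words of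
      -- `v`, one beginning with `y` and one with `z`; each is compared with the given word by the
      -- induction hypothesis.
      obtain ⟨r, hr, hr'⟩ := exists_isReducedWord ((wordProd (y :: p))⁻¹ * v)
      have e1 := h1.length_eq
      have e2 := h2.length_eq
      rw [← hG] at e2
      have r1 : IsReducedWord (y :: (p ++ r)) v := by
        rw [← List.cons_append]
        refine ⟨by rw [wordProd_append, hr, mul_inv_cancel_left], ?_⟩
        rw [List.length_append]
        omega
      have r2 : IsReducedWord (z :: (q ++ r)) v := by
        rw [← List.cons_append]
        refine ⟨by rw [wordProd_append, hr, ← hG, mul_inv_cancel_left], ?_⟩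
        rw [List.length_append]
        omega
      rw [hstep hl r1, hstep hm r2, ← List.cons_append, ← List.cons_append, braidWord_append,
        braidWord_append, hB]

theorem gen_mem_interval (hk : k = 1 ∨ k = -1) (y : Gen ℤ n) :
    gen y ∈ interval (genX n) (lam n ^ k) :=
  mem_interval_iff.mpr (gen_precedes_iff.mpr (isDescent_lam hk y))

/-- The simple attached to a generator. -/
noncomputable def simpleGen (hk : k = 1 ∨ k = -1) (y : Gen ℤ n) :
    IntervalMonoid (genX n) (lam n ^ k) :=
  toIntervalMonoid _ _ ⟨gen y, gen_mem_interval hk y⟩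

theorem prod_simpleGen (hk : k = 1 ∨ k = -1) (v : interval (genX n) (lam n ^ k))
    {l : List (Gen ℤ n)} (hl : IsReducedWord l v) :
    (l.map (simpleGen hk)).prod = toIntervalMonoid _ _ v := by
  induction l generalizing v with
  | nil =>
    have : v = ⟨1, one_mem_interval _ _⟩ := Subtype.ext hl.1.symm
    rw [this, toIntervalMonoid_one]
    rfl
  | cons y l ih =>
    have hmem := (isLeftGarsideInterval_lam hk).quotient_mem v hl.tail.2
    rw [List.map_cons, List.prod_cons, ih ⟨_, hmem⟩ hl.tail.1]
    exact (isLeftGarsideInterval_lam hk).toIntervalMonoid_mul_quotient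
      ⟨gen y, gen_mem_interval hk y⟩ v hl.tail.2

theorem prod_simpleGen_eq (hk : k = 1 ∨ k = -1) {l m : List (Gen ℤ n)}
    (h : wordProd l = wordProd m) (hl : IsLeftReduced l (lam n ^ k))
    (hm : IsLeftReduced m (lam n ^ k)) :
    (l.map (simpleGen hk)).prod = (m.map (simpleGen hk)).prod := by
  rw [prod_simpleGen hk ⟨wordProd l, mem_interval_iff.mpr hl.precedes⟩
    ⟨rfl, hl.length_wordProd⟩, prod_simpleGen hk ⟨wordProd l, mem_interval_iff.mpr hl.precedes⟩
    ⟨h.symm, (congrArg _ h).trans hm.length_wordProd⟩]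

/-- As every generator is a descent of `λ^k`, both sides of each relation are reduced words of one
prefix of `λ^k`, and hence have the same image in the interval monoid. -/
theorem simpleGen_rel (hk : k = 1 ∨ k = -1) (a b : FreeMonoid (Gen ℤ n))
    (h : BPlusRel n k a b) :
    FreeMonoid.lift (simpleGen hk) a = FreeMonoid.lift (simpleGen hk) b := by
  have hD := isDescent_lam (n := n) hk
  have braid : ∀ {y z : Gen ℤ n}, row z = row y + 1 →
      simpleGen hk y * simpleGen hk z * simpleGen hk y =
        simpleGen hk z * simpleGen hk y * simpleGen hk z := fun {y z} hyz => by
    have hr := isLeftReduced_braid hyz (hD y) (hD z)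
    simpa [mul_assoc] using prod_simpleGen_eq hk (wordProd_braid hyz) hr.1 hr.2
  have comm : ∀ {y z : Gen ℤ n}, row y + 1 < row z →
      simpleGen hk y * simpleGen hk z = simpleGen hk z * simpleGen hk y := fun {y z} hyz => by
    have hr := isLeftReduced_comm hyz (hD y) (hD z)
    simpa using prod_simpleGen_eq hk (wordProd_comm hyz) hr.1 hr.2
  cases h with
  | braid_s i j h =>
    have := i.2
    have := j.2
    simp only [map_mul, FreeMonoid.lift_eval_of]
    rcases h with h | h
    · exact braid (by simp only [row]; omega)
    · exact (braid (by simp only [row]; omega)).symm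
  | comm_s i j h =>
    have := i.2
    have := j.2
    simp only [map_mul, FreeMonoid.lift_eval_of]
    rcases h with h | h
    · exact comm (by simp only [row]; omega)
    · exact (comm (by simp only [row]; omega)).symm
  | braid_t j hj i =>
    simp only [map_mul, FreeMonoid.lift_eval_of]
    exact (braid (by simp only [row]; omega)).symm
  | comm_t j hj i =>
    simp only [map_mul, FreeMonoid.lift_eval_of]
    exact (comm (by simp only [row]; omega)).symm
  | dual i j =>
    simp only [map_mul, FreeMonoid.lift_eval_of]
    by_cases hij : i = j
    · rw [hij]
    · have hmem := self_mem_interval (genX n) (lam n ^ k)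
      simpa using prod_simpleGen_eq hk (wordProd_dual k i j)
        (isLeftReduced_dual hk hij hmem (hD _) (hD _))
        (isLeftReduced_dual hk (Ne.symm hij) hmem (hD _) (hD _))

/-- The monoid `B^{⊕k}(∞,∞,n)` is the interval monoid of `[1, λ^k]`. -/
theorem nonempty_BPlus_mulEquiv (hk : k = 1 ∨ k = -1) :
    Nonempty (BPlus n k ≃* IntervalMonoid (genX n) (lam n ^ k)) := by
  choose word hword using fun v : GInf n => exists_isReducedWord v
  let f : BPlus n k →* IntervalMonoid (genX n) (lam n ^ k) :=
    PresentedMonoid.lift (rels := BPlusRel n k) (simpleGen hk) (simpleGen_rel hk)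
  let g : IntervalMonoid (genX n) (lam n ^ k) →* BPlus n k :=
    PresentedMonoid.lift (rels := IntervalRel (genX n) (lam n ^ k))
      (fun v : interval (genX n) (lam n ^ k) => braidWord k (word v)) (by
        rintro _ _ (⟨v, u, t, h, hl⟩ | _)
        · simp only [map_mul, FreeMonoid.lift_eval_of]
          rw [← braidWord_append]
          refine braidWord_eq_of_isReducedWord hk t.2 ⟨?_, ?_⟩ (hword t)
          · rw [wordProd_append, (hword v).1, (hword u).1, h]
          · rw [List.length_append, ← (hword v).2, ← (hword u).2, hl]
        · simp only [map_one, FreeMonoid.lift_eval_of]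
          exact braidWord_eq_of_isReducedWord hk (one_mem_interval _ _) (hword 1)
            ⟨wordProd_nil, wordLength_one _⟩)
  refine ⟨MonoidHom.toMulEquiv f g ?_ ?_⟩
  · refine PresentedMonoid.ext _ fun y => ?_
    have h : braidWord k (word (gen y)) = braidWord k [y] :=
      braidWord_eq_of_isReducedWord hk (gen_mem_interval hk y) (hword _)
        ⟨by simp, length_gen y⟩
    exact h.trans (by simp [braidWord])
  · refine PresentedMonoid.ext _ fun v => ?_
    have h : f (braidWord k (word v)) = toIntervalMonoid _ _ v := by
      rw [braidWord, map_list_prod, List.map_map]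
      exact prod_simpleGen hk v (hword v)
    exact h

end Interval

end GInf

/-! ### Shi's relations and the affine braid relations in an arbitrary group -/

section Braid

variable {H : Type*} [Group H]

/-- The braid relation of length three. -/
def Braid (x y : H) : Prop := x * y * x = y * x * y

theorem Braid.symm {x y : H} (h : Braid x y) : Braid y x := Eq.symm h

theorem braid_conj_iff (g x y : H) : Braid (g * x * g⁻¹) (g * y * g⁻¹) ↔ Braid x y := by
  rw [Braid, Braid, conj_mul, conj_mul, conj_mul, conj_mul, mul_left_inj, mul_right_inj]

theorem Braid.inv_conj {x y : H} (h : Braid x y) : y⁻¹ * x * y = x * y * x⁻¹ := by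
  rw [eq_mul_inv_iff_mul_eq, mul_assoc, mul_assoc, inv_mul_eq_iff_eq_mul, ← mul_assoc,
    ← mul_assoc]
  exact h

/-- Multiplying both sides of the braid relation on the right by `b s a` gives the two sides of the
six-letter relation. -/
theorem braid_mul_conj_iff {s a b : H} (ha : Braid s a) (hb : Braid s b) :
    Braid s (b * a * b⁻¹) ↔
      s * b * a * s * b * a = b * a * s * b * a * s := by
  have h1 : s * (b * a * b⁻¹) * s * (b * s * a) = s * b * a * s * b * a := by
    rw [show s * (b * a * b⁻¹) * s * (b * s * a) = s * b * a * (b⁻¹ * s * b) * s * a by group,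
      hb.inv_conj]
    group
  have h2 : b * a * b⁻¹ * s * (b * a * b⁻¹) * (b * s * a) = b * a * s * b * a * s := by
    rw [show b * a * b⁻¹ * s * (b * a * b⁻¹) * (b * s * a) =
      b * a * (b⁻¹ * s * b) * a * s * a by group, hb.inv_conj,
      show b * a * (s * b * s⁻¹) * a * s * a = b * a * s * b * (s⁻¹ * a * s) * a by group,
      ha.symm.inv_conj]
    group
  rw [Braid, ← h1, ← h2, mul_left_inj]

/-- The companion for the opposite direction along a dual sequence: here both sides are multiplied
on the left by `b s a`, and they come out exchanged. -/
theorem braid_inv_mul_conj_iff {s a b : H} (ha : Braid s a) (hb : Braid s b) :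
    Braid s (a⁻¹ * b * a) ↔
      s * b * a * s * b * a = b * a * s * b * a * s := by
  have h1 : b * s * a * (s * (a⁻¹ * b * a) * s) = b * a * s * b * a * s := by
    rw [show b * s * a * (s * (a⁻¹ * b * a) * s) = b * s * (a * s * a⁻¹) * b * a * s by group,
      ← ha.symm.inv_conj]
    group
  have h2 : b * s * a * (a⁻¹ * b * a * s * (a⁻¹ * b * a)) = s * b * a * s * b * a := by
    rw [show b * s * a * (a⁻¹ * b * a * s * (a⁻¹ * b * a)) =
      b * s * b * (a * s * a⁻¹) * b * a by group, ← ha.symm.inv_conj,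
      show b * s * b * (s⁻¹ * a * s) * b * a = b * (s * b * s⁻¹) * a * s * b * a by group,
      ← hb.inv_conj]
    group
  rw [Braid, ← h1, ← h2, mul_right_inj, eq_comm]

/-- The product `r (m - 1) ⋯ r 1 r 0`. -/
def descProd (r : ℕ → H) : ℕ → H
  | 0 => 1
  | m + 1 => r m * descProd r m

theorem commute_descProd {r : ℕ → H} {x : H} {m : ℕ} (h : ∀ i < m, Commute x (r i)) :
    Commute x (descProd r m) := by
  induction m with
  | zero => exact Commute.one_right x
  | succ m ih => exact (h m (by omega)).mul_right (ih fun i hi => h i (by omega))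

/-- The braid relations of type `A` for the elements `r 0, …, r (N - 1)`. -/
structure IsBraidFamily (N : ℕ) (r : ℕ → H) : Prop where
  braid : ∀ m, m + 1 < N → Braid (r m) (r (m + 1))
  comm : ∀ i j, i + 1 < j → j < N → Commute (r i) (r j)

/-- Conjugation by the descending product shifts the indices of the `r m` by one, as in the usual
braid group. -/
theorem IsBraidFamily.mul_descProd {N : ℕ} {r : ℕ → H} (h : IsBraidFamily N r) {m M : ℕ}
    (hm : m + 1 < M) (hM : M ≤ N) : r m * descProd r M = descProd r M * r (m + 1) := by
  obtain ⟨d, rfl⟩ := Nat.exists_eq_add_of_le hm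
  induction d with
  | zero =>
    have hc : Commute (r (m + 1)) (descProd r m) :=
      commute_descProd fun i hi => (h.comm i (m + 1) (by omega) (by omega)).symm
    change r m * (r (m + 1) * (r m * descProd r m)) = r (m + 1) * (r m * descProd r m) * r (m + 1)
    rw [mul_assoc (r (m + 1)), mul_assoc (r m), ← hc.eq]
    simp only [← mul_assoc]
    rw [show r m * r (m + 1) * r m = _ from h.braid m (by omega)]
  | succ d ih =>
    have hc := h.comm m ((m + 1).succ + d) (by omega) (by omega)
    change r m * (r ((m + 1).succ + d) * descProd r ((m + 1).succ + d)) =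
      r ((m + 1).succ + d) * descProd r ((m + 1).succ + d) * r (m + 1)
    rw [← mul_assoc, hc.eq, mul_assoc, ih (by omega) (by omega), mul_assoc]

theorem descProd_succ_conj (r : ℕ → H) (m : ℕ) (t : H) :
    descProd r (m + 1) * t * (descProd r (m + 1))⁻¹ =
      r m * (descProd r m * t * (descProd r m)⁻¹) * (r m)⁻¹ := by
  simp only [descProd]
  group

/-- Conjugating by `b⁻¹` turns `b y b⁻¹` into `y` and `a` into `a b a⁻¹`, and then conjugating by
`a⁻¹`, which fixes `y`, leaves `b`. -/
theorem braid_conj_of_commute_iff {a b y : H} (hay : Commute a y) (hab : Braid a b) :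
    Braid a (b * y * b⁻¹) ↔ Braid b y := by
  rw [← braid_conj_iff b⁻¹ a, ← braid_conj_iff a b y, inv_inv, hab.inv_conj,
    show b⁻¹ * (b * y * b⁻¹) * b = y by group, hay.eq, mul_inv_cancel_right]

theorem IsBraidFamily.braid_descProd_conj_iff {N : ℕ} {r : ℕ → H} (h : IsBraidFamily N r) {t : H}
    (ht : ∀ m, 0 < m → m < N → Commute (r m) t) {m : ℕ} (hm : m < N) :
    Braid (r m) (descProd r (m + 1) * t * (descProd r (m + 1))⁻¹) ↔ Braid (r 0) t := by
  have key : Braid (r m) (descProd r m * t * (descProd r m)⁻¹) ↔ Braid (r 0) t := by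
    induction m with
    | zero => simp [descProd]
    | succ m ih =>
      have hc : Commute (r (m + 1)) (descProd r m) :=
        commute_descProd fun i hi => (h.comm i (m + 1) (by omega) hm).symm
      rw [← ih (by omega), descProd_succ_conj, braid_conj_of_commute_iff
        ((hc.mul_right (ht _ (by omega) hm)).mul_right hc.inv_right) (h.braid m hm).symm]
  rw [← key, descProd_succ_conj]
  nth_rewrite 1 [← mul_inv_cancel_right (r m) (r m)]
  exact braid_conj_iff _ _ _

/-- The letters `r m` with `m > 0` fix `u` under conjugation, so only the innermost conjugation by
`r 0` matters. -/
theorem braid_descProd_conj_iff_of_commute {N : ℕ} {r : ℕ → H} {t u : H}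
    (hu : ∀ m, 0 < m → m < N → Commute (r m) u) {m : ℕ} (hm : m < N) :
    Braid u (descProd r (m + 1) * t * (descProd r (m + 1))⁻¹) ↔ Braid u (r 0 * t * (r 0)⁻¹) := by
  induction m with
  | zero => simp [descProd]
  | succ m ih =>
    rw [← ih (by omega), descProd_succ_conj r (m + 1)]
    nth_rewrite 1 [← mul_inv_cancel_right u (r (m + 1)), ← (hu (m + 1) (by omega) hm).eq]
    exact braid_conj_iff _ _ _

/-- The relations of Shi's presentation of `B(∞,∞,N+2)`. -/
structure IsShiFamily (N : ℕ) (r : ℕ → H) (t₀ t₁ : H) : Prop extends IsBraidFamily N r where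
  braid_zero : 0 < N → Braid (r 0) t₀
  braid_one : 0 < N → Braid (r 0) t₁
  comm_zero : ∀ m, 0 < m → m < N → Commute (r m) t₀
  comm_one : ∀ m, 0 < m → m < N → Commute (r m) t₁
  six : 0 < N → r 0 * t₁ * t₀ * r 0 * t₁ * t₀ = t₁ * t₀ * r 0 * t₁ * t₀ * r 0

/-- The relations of the affine Artin group, for generators `σ, t₀, r 0, …, r (N - 1)` arranged in
a cycle. -/
structure IsAffineFamily (N : ℕ) (r : ℕ → H) (t₀ σ : H) : Prop extends IsBraidFamily N r where
  braid_zero : 0 < N → Braid (r 0) t₀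
  comm_zero : ∀ m, 0 < m → m < N → Commute (r m) t₀
  comm_affine : ∀ m, m + 1 < N → Commute (r m) σ
  braid_last : ∀ m, m + 1 = N → Braid (r m) σ
  braid_affine : 0 < N → Braid t₀ σ

/-- Put `σ = D t₁ D⁻¹`, with `D` the descending product. Commutation of `σ` with `r m` is
commutation of `t₁` with `r (m + 1)`, the relation of `σ` with the last letter is that of `t₁` with
`r 0`, and the braid relation of `σ` with `t₀` is the six-letter relation. -/
theorem isShiFamily_iff_isAffineFamily {N : ℕ} {r : ℕ → H} {t₀ t₁ : H} :
    IsShiFamily N r t₀ t₁ ↔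
      IsAffineFamily N r t₀ (descProd r N * t₁ * (descProd r N)⁻¹) := by
  have hcomm : ∀ (_ : IsBraidFamily N r) m, m + 1 < N →
      (Commute (r m) (descProd r N * t₁ * (descProd r N)⁻¹) ↔ Commute (r (m + 1)) t₁) :=
    fun h m hm => by
      have h1 := h.mul_descProd hm le_rfl
      rw [← eq_mul_inv_iff_mul_eq] at h1
      rw [h1]
      exact Commute.conj_iff _
  have hsix : ∀ (_ : 0 < N) (_ : Braid (r 0) t₀) (_ : Braid (r 0) t₁)
      (_ : ∀ m, 0 < m → m < N → Commute (r m) t₀),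
      (r 0 * t₁ * t₀ * r 0 * t₁ * t₀ = t₁ * t₀ * r 0 * t₁ * t₀ * r 0 ↔
        Braid t₀ (descProd r N * t₁ * (descProd r N)⁻¹)) := fun hN h0 h1 hc => by
    obtain ⟨m, rfl⟩ : ∃ m, N = m + 1 := ⟨N - 1, by omega⟩
    -- The conjugate `r 0 t₁ (r 0)⁻¹` equals `t₁⁻¹ (r 0) t₁`; conjugating the relation by `t₁`
    -- leaves `r 0` and `t₁ t₀ t₁⁻¹`.
    rw [braid_descProd_conj_iff_of_commute hc (Nat.lt_succ_self m), ← braid_mul_conj_iff h0 h1,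
      ← h1.inv_conj, ← braid_conj_iff t₁ t₀, show t₁ * (t₁⁻¹ * r 0 * t₁) * t₁⁻¹ = r 0 by group]
    exact ⟨Braid.symm, Braid.symm⟩
  constructor
  · intro h
    refine ⟨h.toIsBraidFamily, h.braid_zero, h.comm_zero, fun m hm => ?_, ?_, fun hN => ?_⟩
    · exact (hcomm h.toIsBraidFamily m hm).mpr (h.comm_one _ (by omega) hm)
    · rintro m rfl
      exact (h.toIsBraidFamily.braid_descProd_conj_iff h.comm_one (by omega)).mpr
        (h.braid_one (by omega))
    · exact (hsix hN (h.braid_zero hN) (h.braid_one hN) h.comm_zero).mp (h.six hN)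
  · intro h
    have hc : ∀ m, 0 < m → m < N → Commute (r m) t₁ := fun m hm hmN => by
      obtain ⟨m, rfl⟩ : ∃ k, m = k + 1 := ⟨m - 1, by omega⟩
      exact (hcomm h.toIsBraidFamily m hmN).mp (h.comm_affine m hmN)
    have hb : 0 < N → Braid (r 0) t₁ := fun hN => by
      obtain ⟨m, rfl⟩ : ∃ m, N = m + 1 := ⟨N - 1, by omega⟩
      exact (h.toIsBraidFamily.braid_descProd_conj_iff hc (by omega)).mp (h.braid_last m rfl)
    exact ⟨h.toIsBraidFamily, h.braid_zero, hb, h.comm_zero, hc, fun hN =>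
      (hsix hN (h.braid_zero hN) (hb hN) h.comm_zero).mpr (h.braid_affine hN)⟩

theorem descProd_map {K : Type*} [Group K] (f : H →* K) (r : ℕ → H) (m : ℕ) :
    f (descProd r m) = descProd (fun i => f (r i)) m := by
  induction m with
  | zero => exact map_one f
  | succ m ih => rw [descProd, map_mul, ih, descProd]

theorem descProd_congr {r r' : ℕ → H} {m : ℕ} (h : ∀ i < m, r i = r' i) :
    descProd r m = descProd r' m := by
  induction m with
  | zero => rfl
  | succ m ih => rw [descProd, h m (by omega), ih fun i hi => h i (by omega), descProd]

end Braid

/-! ### The universal property of `B(∞,∞,n)`, with `n = N + 2` -/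

section ShiGroup

variable {N : ℕ}

/-- The generators `s̃_3, …, s̃_n` of `B(∞,∞,n)`, numbered from `0`. -/
def shiS (N m : ℕ) : BInf (N + 2) :=
  -- The value 1 outside the range is arbitrary: the families and the product of the first `N`
  -- letters involve only indices below `N`.
  if h : m < N then PresentedGroup.of (.s ⟨m + 3, by omega, by omega⟩) else 1

/-- The generators `t̃_0, t̃_1` of `B(∞,∞,n)`. -/
def shiT (N : ℕ) (i : Fin 2) : BInf (N + 2) := PresentedGroup.of (.t i)

theorem BInf.mk_eq_mk {n : ℕ} {a b : FreeGroup (Gen (Fin 2) n)} (h : ShiRel n a b) :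
    PresentedGroup.mk {r : FreeGroup (Gen (Fin 2) n) | ∃ a b, ShiRel n a b ∧ r = a * b⁻¹} a =
      PresentedGroup.mk _ b := by
  have := PresentedGroup.one_of_mem
    (rels := {r : FreeGroup (Gen (Fin 2) n) | ∃ a b, ShiRel n a b ∧ r = a * b⁻¹}) ⟨a, b, h, rfl⟩
  rwa [map_mul, map_inv, mul_inv_eq_one] at this

theorem isShiFamily_BInf (N : ℕ) : IsShiFamily N (shiS N) (shiT N 0) (shiT N 1) where
  braid m hm := by
    rw [shiS, shiS, dif_pos (by omega), dif_pos hm]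
    exact BInf.mk_eq_mk (ShiRel.braid_s _ _ (Or.inl rfl))
  comm i j hij hj := by
    rw [shiS, shiS, dif_pos (by omega), dif_pos hj]
    exact BInf.mk_eq_mk (ShiRel.comm_s _ _ (Or.inl (by simp only; omega)))
  braid_zero hN := by
    rw [shiS, dif_pos hN]
    exact BInf.mk_eq_mk (ShiRel.braid_t _ rfl 0)
  braid_one hN := by
    rw [shiS, dif_pos hN]
    exact BInf.mk_eq_mk (ShiRel.braid_t _ rfl 1)
  comm_zero m hm hN := by
    rw [shiS, dif_pos hN]
    exact BInf.mk_eq_mk (ShiRel.comm_t _ (by simp; omega) 0)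
  comm_one m hm hN := by
    rw [shiS, dif_pos hN]
    exact BInf.mk_eq_mk (ShiRel.comm_t _ (by simp; omega) 1)
  six hN := by
    rw [shiS, dif_pos hN]
    exact BInf.mk_eq_mk (ShiRel.six _ rfl)

variable {H : Type*} [Group H]

/-- The images of the generators of `B(∞,∞,N+2)`. -/
def shiMap (N : ℕ) (r : ℕ → H) (t₀ t₁ : H) : Gen (Fin 2) (N + 2) → H
  | .t i => if i = 0 then t₀ else t₁
  | .s j => r (j.val - 3)

/-- The universal property of `B(∞,∞,N+2)`. -/
def BInf.lift {r : ℕ → H} {t₀ t₁ : H} (h : IsShiFamily N r t₀ t₁) : BInf (N + 2) →* H :=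
  PresentedGroup.toGroup (f := shiMap N r t₀ t₁) (by
    rintro _ ⟨a, b, hab, rfl⟩
    rw [map_mul, map_inv, mul_inv_eq_one]
    have ht : ∀ (i : Fin 2), 0 < N → Braid (r 0) (if i = 0 then t₀ else t₁) := fun i hN => by
      split_ifs
      · exact h.braid_zero hN
      · exact h.braid_one hN
    have ht' : ∀ (i : Fin 2) m, 0 < m → m < N → Commute (r m) (if i = 0 then t₀ else t₁) :=
      fun i m hm hN => by
        split_ifs
        · exact h.comm_zero m hm hN
        · exact h.comm_one m hm hN
    cases hab with
    | braid_s i j hij =>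
      obtain ⟨i, hi, hi'⟩ := i
      obtain ⟨j, hj, hj'⟩ := j
      obtain ⟨i, rfl⟩ := Nat.exists_eq_add_of_le' hi
      obtain ⟨j, rfl⟩ := Nat.exists_eq_add_of_le' hj
      simp only [map_mul, FreeGroup.lift_apply_of, shiMap, Nat.add_sub_cancel]
      rcases hij with hij | hij
      · obtain rfl : j = i + 1 := by simp only at hij; omega
        exact h.braid i (by omega)
      · obtain rfl : i = j + 1 := by simp only at hij; omega
        exact (h.braid j (by omega)).symm
    | comm_s i j hij =>
      simp only [map_mul, FreeGroup.lift_apply_of, shiMap]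
      have := i.2
      have := j.2
      rcases hij with hij | hij
      · exact h.comm _ _ (by omega) (by omega)
      · exact (h.comm _ _ (by omega) (by omega)).symm
    | braid_t j hj i =>
      have := j.2
      simp only [map_mul, FreeGroup.lift_apply_of, shiMap, hj]
      exact ht i (by omega)
    | comm_t j hj i =>
      have := j.2
      simp only [map_mul, FreeGroup.lift_apply_of, shiMap]
      exact ht' i _ (by omega) (by omega)
    | six j hj =>
      have := j.2
      simp only [map_mul, FreeGroup.lift_apply_of, shiMap, hj]
      exact h.six (by omega))

theorem BInf.lift_shiS {r : ℕ → H} {t₀ t₁ : H} (h : IsShiFamily N r t₀ t₁) {m : ℕ}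
    (hm : m < N) : BInf.lift h (shiS N m) = r m := by
  rw [shiS, dif_pos hm]
  exact PresentedGroup.toGroup.of _

theorem BInf.lift_shiT_zero {r : ℕ → H} {t₀ t₁ : H} (h : IsShiFamily N r t₀ t₁) :
    BInf.lift h (shiT N 0) = t₀ :=
  PresentedGroup.toGroup.of _

theorem BInf.lift_shiT_one {r : ℕ → H} {t₀ t₁ : H} (h : IsShiFamily N r t₀ t₁) :
    BInf.lift h (shiT N 1) = t₁ :=
  PresentedGroup.toGroup.of _

theorem BInf.hom_ext {f g : BInf (N + 2) →* H} (h0 : f (shiT N 0) = g (shiT N 0))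
    (h1 : f (shiT N 1) = g (shiT N 1)) (hs : ∀ m < N, f (shiS N m) = g (shiS N m)) : f = g := by
  refine PresentedGroup.ext fun x => ?_
  cases x with
  | t i =>
    fin_cases i
    · exact h0
    · exact h1
  | s j =>
    have h3 := j.2
    have := hs (j.val - 3) (by omega)
    rw [shiS, dif_pos (by omega)] at this
    simpa [Nat.sub_add_cancel h3.1] using this

end ShiGroup

/-! ### The affine Artin group and its isomorphism with `B(∞,∞,n)` -/

section ArtinGroup

variable {N : ℕ} {H : Type*} [Group H]

theorem affineA_apply_of_lt {i j : Fin (N + 2)} (hij : i < j) : affineA (N + 2) i j =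
    if j.val = i.val + 1 ∨ (i.val = 0 ∧ j.val = N + 1) then (if N = 0 then 0 else 3) else 2 := by
  have h1 := Fin.lt_def.mp hij
  have h2 : (i.val + 1) % (N + 2) = i.val + 1 := Nat.mod_eq_of_lt (by omega)
  have h3 : (j.val + 1) % (N + 2) = i.val ↔ i.val = 0 ∧ j.val = N + 1 := by
    rcases Nat.lt_or_eq_of_le (Nat.succ_le_of_lt j.2) with h | h
    · rw [Nat.mod_eq_of_lt h]
      omega
    · rw [← Nat.succ_eq_add_one, h, Nat.mod_self]
      omega
  change (if i = j then 1 else if (i.val + 1) % (N + 2) = j.val ∨ (j.val + 1) % (N + 2) = i.val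
    then (if N + 2 = 2 then 0 else 3) else 2) = _
  rw [if_neg hij.ne, h2]
  simp only [h3, eq_comm (a := i.val + 1), Nat.add_eq_right]

/-- The defining relations of an Artin group. -/
abbrev artinRels {B : Type*} (M : CoxeterMatrix B) : Set (FreeGroup B) :=
  {r : FreeGroup B | ∃ i j : B,
    r = ((CoxeterSystem.alternatingWord i j (M i j)).map FreeGroup.of).prod *
      (((CoxeterSystem.alternatingWord j i (M i j)).map FreeGroup.of).prod)⁻¹}

theorem artin_braid {i j : Fin (N + 2)} (hij : i < j)
    (h : j.val = i.val + 1 ∨ (i.val = 0 ∧ j.val = N + 1)) (hN : 0 < N) :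
    Braid (PresentedGroup.of i : ArtinGroup (affineA (N + 2))) (PresentedGroup.of j) := by
  have := PresentedGroup.one_of_mem (rels := artinRels (affineA (N + 2))) ⟨i, j, rfl⟩
  rw [map_mul, map_inv, mul_inv_eq_one, affineA_apply_of_lt hij, if_pos h, if_neg (by omega)] at this
  simp only [CoxeterSystem.alternatingWord, List.concat_eq_append, List.nil_append,
    List.cons_append, List.map_cons, List.map_nil, List.prod_cons, List.prod_nil, mul_one,
    map_mul] at this
  rw [← mul_assoc, ← mul_assoc] at this
  -- `alternatingWord i j 3` ends in `j`, so it reads `j i j`.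
  exact this.symm

theorem artin_comm {i j : Fin (N + 2)} (hij : i < j)
    (h : ¬(j.val = i.val + 1 ∨ (i.val = 0 ∧ j.val = N + 1))) :
    Commute (PresentedGroup.of i : ArtinGroup (affineA (N + 2))) (PresentedGroup.of j) := by
  have := PresentedGroup.one_of_mem (rels := artinRels (affineA (N + 2))) ⟨i, j, rfl⟩
  rw [map_mul, map_inv, mul_inv_eq_one, affineA_apply_of_lt hij, if_neg h] at this
  simp only [CoxeterSystem.alternatingWord, List.concat_eq_append, List.nil_append,
    List.cons_append, List.map_cons, List.map_nil, List.prod_cons, List.prod_nil, mul_one,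
    map_mul] at this
  exact this

/-- The images of the generators of the affine Artin group. -/
def artinMap (r : ℕ → H) (t₀ σ : H) : ℕ → H
  | 0 => σ
  | 1 => t₀
  | m + 2 => r m

/-- The universal property of the affine Artin group. -/
def ArtinGroup.lift {r : ℕ → H} {t₀ σ : H} (h : IsAffineFamily N r t₀ σ) :
    ArtinGroup (affineA (N + 2)) →* H :=
  PresentedGroup.toGroup (f := fun i : Fin (N + 2) => artinMap r t₀ σ i.val) (by
    have braid : ∀ i j : ℕ, j < N + 2 → 0 < N → (j = i + 1 ∨ (i = 0 ∧ j = N + 1)) →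
        Braid (artinMap r t₀ σ i) (artinMap r t₀ σ j) := by
      rintro i j hj hN (rfl | ⟨rfl, rfl⟩)
      · rcases i with _ | _ | i
        · exact (h.braid_affine hN).symm
        · exact (h.braid_zero hN).symm
        · exact h.braid i (by omega)
      · obtain ⟨m, rfl⟩ : ∃ m, N = m + 1 := ⟨N - 1, by omega⟩
        exact (h.braid_last m rfl).symm
    have comm : ∀ i j : ℕ, j < N + 2 → i + 1 < j → ¬(i = 0 ∧ j = N + 1) →
        Commute (artinMap r t₀ σ i) (artinMap r t₀ σ j) := by
      intro i j hj hij hne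
      obtain ⟨j, rfl⟩ : ∃ k, j = k + 2 := ⟨j - 2, by omega⟩
      rcases i with _ | _ | i
      · exact (h.comm_affine j (by omega)).symm
      · exact (h.comm_zero j (by omega) (by omega)).symm
      · exact h.comm i j (by omega) (by omega)
    have key : ∀ i j : Fin (N + 2), i < j → ∀ x y : FreeGroup (Fin (N + 2)),
        x = ((CoxeterSystem.alternatingWord i j (affineA (N + 2) i j)).map FreeGroup.of).prod →
        y = ((CoxeterSystem.alternatingWord j i (affineA (N + 2) i j)).map FreeGroup.of).prod →
        FreeGroup.lift (fun i : Fin (N + 2) => artinMap r t₀ σ i.val) x =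
          FreeGroup.lift (fun i : Fin (N + 2) => artinMap r t₀ σ i.val) y := by
      rintro i j hij _ _ rfl rfl
      have hij' := Fin.lt_def.mp hij
      rw [affineA_apply_of_lt hij]
      split_ifs with h1 h2
      · rfl
      · have hb := braid i j j.2 (by omega) h1
        rw [Braid, mul_assoc, mul_assoc] at hb
        simpa [CoxeterSystem.alternatingWord] using hb.symm
      · simpa [CoxeterSystem.alternatingWord] using (comm i j j.2 (by omega) (by omega)).eq
    rintro _ ⟨i, j, rfl⟩
    rw [map_mul, map_inv, mul_inv_eq_one]
    rcases lt_trichotomy i j with hij | rfl | hij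
    · exact key i j hij _ _ rfl rfl
    · rfl
    · rw [(affineA (N + 2)).symmetric i j]
      exact (key j i hij _ _ rfl rfl).symm)

theorem ArtinGroup.lift_of {r : ℕ → H} {t₀ σ : H} (h : IsAffineFamily N r t₀ σ)
    (i : Fin (N + 2)) : ArtinGroup.lift h (PresentedGroup.of i) = artinMap r t₀ σ i.val :=
  PresentedGroup.toGroup.of _

/-- The generators `2, …, N + 1` of the affine Artin group, numbered from `0`. -/
def artinS (N m : ℕ) : ArtinGroup (affineA (N + 2)) :=
  if h : m < N then PresentedGroup.of ⟨m + 2, by omega⟩ else 1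

theorem isAffineFamily_artinGroup (N : ℕ) :
    IsAffineFamily N (artinS N) (PresentedGroup.of 1) (PresentedGroup.of 0) where
  braid m hm := by
    rw [artinS, artinS, dif_pos (by omega), dif_pos hm]
    exact artin_braid (Fin.mk_lt_mk.mpr (by omega)) (Or.inl rfl) (by omega)
  comm i j hij hj := by
    rw [artinS, artinS, dif_pos (by omega), dif_pos hj]
    exact artin_comm (Fin.mk_lt_mk.mpr (by omega)) (by simp only; omega)
  braid_zero hN := by
    rw [artinS, dif_pos hN]
    exact (artin_braid (Fin.lt_def.mpr (by simp)) (Or.inl (by simp)) hN).symm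
  comm_zero m hm hN := by
    rw [artinS, dif_pos hN]
    exact (artin_comm (Fin.lt_def.mpr (by simp)) (by simp; omega)).symm
  comm_affine m hm := by
    rw [artinS, dif_pos (by omega)]
    exact (artin_comm (Fin.lt_def.mpr (by simp)) (by simp; omega)).symm
  braid_last m hm := by
    rw [artinS, dif_pos (by omega)]
    exact (artin_braid (Fin.lt_def.mpr (by simp)) (Or.inr (by simp; omega)) (by omega)).symm
  braid_affine hN := (artin_braid (Fin.lt_def.mpr (by simp)) (Or.inl (by simp)) hN).symm

/-- The group `B(∞,∞,N+2)` is the affine Artin group of type `Ã_{N+1}`. -/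
theorem nonempty_BInf_mulEquiv (N : ℕ) :
    Nonempty (BInf (N + 2) ≃* ArtinGroup (affineA (N + 2))) := by
  have hA := isAffineFamily_artinGroup N
  have hB := isShiFamily_BInf N
  -- The generator of index 0 plays the role of `σ`, so `t₁` is recovered from it by the inverse
  -- conjugation.
  have hA' : IsShiFamily N (artinS N) (PresentedGroup.of 1)
      ((descProd (artinS N) N)⁻¹ * PresentedGroup.of 0 * descProd (artinS N) N) := by
    rw [isShiFamily_iff_isAffineFamily]
    convert hA using 1
    group
  have hB' := isShiFamily_iff_isAffineFamily.mp hB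
  have hf : ∀ m < N, BInf.lift hA' (shiS N m) = artinS N m := fun m hm => BInf.lift_shiS hA' hm
  have hg : ∀ m < N, ArtinGroup.lift hB' (artinS N m) = shiS N m := fun m hm => by
    rw [artinS, dif_pos hm, ArtinGroup.lift_of]
    rfl
  have hg0 : ArtinGroup.lift hB' (PresentedGroup.of 0) = _ := ArtinGroup.lift_of hB' 0
  have hg1 : ArtinGroup.lift hB' (PresentedGroup.of 1) = shiT N 0 := ArtinGroup.lift_of hB' 1
  refine ⟨MonoidHom.toMulEquiv (BInf.lift hA') (ArtinGroup.lift hB') ?_ ?_⟩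
  · refine BInf.hom_ext ?_ ?_ fun m hm => ?_
    · rw [MonoidHom.comp_apply, BInf.lift_shiT_zero, hg1]
      rfl
    · rw [MonoidHom.comp_apply, BInf.lift_shiT_one, map_mul, map_mul, map_inv, descProd_map,
        descProd_congr hg, hg0]
      simp only [Fin.val_zero, artinMap, MonoidHom.id_apply]
      group
    · rw [MonoidHom.comp_apply, hf m hm, hg m hm]
      rfl
  · refine PresentedGroup.ext fun i => ?_
    rw [MonoidHom.comp_apply, ArtinGroup.lift_of, MonoidHom.id_apply]
    obtain ⟨i, hi⟩ := i
    rcases i with _ | _ | i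
    · simp only [artinMap]
      rw [map_mul, map_mul, map_inv, descProd_map, descProd_congr hf, BInf.lift_shiT_one,
        show (⟨0, hi⟩ : Fin (N + 2)) = 0 from rfl]
      group
    · exact BInf.lift_shiT_zero hA'
    · simp only [artinMap]
      rw [hf i (by omega), artinS, dif_pos (by omega)]

end ArtinGroup

/-! ### Sequences with constant product `T (i + 1) * T i` -/

section DualSequence

variable {H : Type*} [Group H]

theorem exists_dual_sequence (a b : H) :
    ∃ T : ℤ → H, T 0 = a ∧ T 1 = b ∧ ∀ i, T (i + 1) * T i = b * a := by
  -- The relation forces `T (i + 2)` to be the conjugate of `T i` by the constant product `b a`,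
  -- whence this formula, with Euclidean division so that it covers negative `i`.
  refine ⟨fun i => (b * a) ^ (i / 2) * (if i % 2 = 0 then a else b) * (b * a) ^ (-(i / 2)),
    by simp, by simp, fun i => ?_⟩
  obtain ⟨m, rfl | rfl⟩ := i.even_or_odd'
  · have h1 : (2 * m + 1) / 2 = m := by omega
    have h2 : 2 * m / 2 = m := by omega
    have h3 : (2 * m + 1) % 2 ≠ 0 := by omega
    have h4 : 2 * m % 2 = 0 := by omega
    simp only [h1, h2, h3, h4, if_true, if_false]
    rw [show (b * a) ^ m * b * (b * a) ^ (-m) * ((b * a) ^ m * a * (b * a) ^ (-m)) =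
      (b * a) ^ m * (b * a) * (b * a) ^ (-m) by rw [zpow_neg]; group]
    rw [← zpow_add_one, ← zpow_add]
    simp
  · have h1 : (2 * m + 1 + 1) / 2 = m + 1 := by omega
    have h2 : (2 * m + 1) / 2 = m := by omega
    have h3 : (2 * m + 1) % 2 ≠ 0 := by omega
    have h4 : (2 * m + 1 + 1) % 2 = 0 := by omega
    simp only [h1, h2, h3, h4, if_true, if_false]
    rw [zpow_neg, zpow_neg, zpow_add_one, show (b * a) ^ m * (b * a) * a * ((b * a) ^ m * (b * a))⁻¹ *
      ((b * a) ^ m * b * ((b * a) ^ m)⁻¹) = (b * a) ^ m * (b * a) * ((b * a) ^ m)⁻¹ by group]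
    rw [← zpow_add_one, ← zpow_neg, ← zpow_add]
    simp

theorem dual_sequence_induction {P : ℤ → Prop} (h0 : P 0) (h1 : P 1)
    (up : ∀ i, P i → P (i + 1) → P (i + 2)) (down : ∀ i, P i → P (i + 1) → P (i - 1)) (i : ℤ) :
    P i := by
  have key : P i ∧ P (i + 1) := by
    induction i with
    | zero => exact ⟨h0, by simpa using h1⟩
    | succ m ih => exact ⟨ih.2, by simpa [add_assoc] using up _ ih.1 ih.2⟩
    | pred m ih => exact ⟨down _ ih.1 ih.2, by simpa using ih.1⟩
  exact key.1

theorem dual_sequence_ext {T T' : ℤ → H} {c : H} (h : ∀ i, T (i + 1) * T i = c)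
    (h' : ∀ i, T' (i + 1) * T' i = c) (h0 : T 0 = T' 0) (i : ℤ) : T i = T' i := by
  induction i with
  | zero => exact h0
  | succ m ih => exact mul_right_cancel ((h m).trans ((h' m).symm.trans (by rw [ih])))
  | pred m ih =>
    have e := h (-(m : ℤ) - 1)
    have e' := h' (-(m : ℤ) - 1)
    rw [sub_add_cancel] at e e'
    rw [ih] at e
    exact mul_left_cancel (e.trans e'.symm)

/-- The six-letter relation involves `T (i + 1)` and `T i` only through their product, so it holds
for all `i`. Given the braid relation at `i` and `i + 1`, it is equivalent to the one at `i + 2` and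
to the one at `i - 1`. -/
theorem braid_dual_sequence {T : ℤ → H} {s : H} (h : ∀ i, T (i + 1) * T i = T 1 * T 0)
    (h0 : Braid s (T 0)) (h1 : Braid s (T 1))
    (hsix : s * T 1 * T 0 * s * T 1 * T 0 = T 1 * T 0 * s * T 1 * T 0 * s) (i : ℤ) :
    Braid s (T i) := by
  have six : ∀ i, s * T (i + 1) * T i * s * T (i + 1) * T i =
      T (i + 1) * T i * s * T (i + 1) * T i * s := fun i => by
    simpa only [mul_assoc, ← h i] using (by simpa only [mul_assoc, h i] using hsix :
      s * (T 1 * T 0) * s * (T 1 * T 0) = (T 1 * T 0) * s * (T 1 * T 0) * s)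
  refine dual_sequence_induction (P := fun i => Braid s (T i)) h0 h1 (fun i hi hi' => ?_) (fun i hi hi' => ?_) i
  · have e : T (i + 2) = T (i + 1) * T i * (T (i + 1))⁻¹ := by
      rw [h i, ← h (i + 1), mul_inv_cancel_right, add_assoc]
      rfl
    rw [e]
    exact (braid_mul_conj_iff hi hi').mpr (six i)
  · have e : T (i - 1) = (T i)⁻¹ * T (i + 1) * T i := by
      rw [mul_assoc, h i, ← h (i - 1), sub_add_cancel, inv_mul_cancel_left]
    rw [e]
    exact (braid_inv_mul_conj_iff hi hi').mpr (six i)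

theorem commute_dual_sequence {T : ℤ → H} {s : H} (h : ∀ i, T (i + 1) * T i = T 1 * T 0)
    (h0 : Commute s (T 0)) (h1 : Commute s (T 1)) (i : ℤ) : Commute s (T i) := by
  refine dual_sequence_induction (P := fun i => Commute s (T i)) h0 h1 (fun i hi hi' => ?_)
    (fun i hi hi' => ?_) i
  · have e : T (i + 2) = T (i + 1) * T i * (T (i + 1))⁻¹ := by
      rw [h i, ← h (i + 1), mul_inv_cancel_right, add_assoc]
      rfl
    rw [e]
    exact (hi'.mul_right hi).mul_right hi'.inv_right
  · have e : T (i - 1) = (T i)⁻¹ * T (i + 1) * T i := by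
      rw [mul_assoc, h i, ← h (i - 1), sub_add_cancel, inv_mul_cancel_left]
    rw [e]
    exact (hi.inv_right.mul_right hi').mul_right hi

end DualSequence

/-! ### The group of fractions of `B^{⊕k}(∞,∞,n)` -/

section FractionGroupOfBPlus

variable {n : ℕ}

/-- The substitution `t̃_i ↦ t̃_{-i}`. -/
def negT : Gen ℤ n → Gen ℤ n
  | .t i => .t (-i)
  | .s j => .s j

theorem negT_negT (y : Gen ℤ n) : negT (negT y) = y := by
  cases y <;> simp [negT]

/-- The homomorphism `t̃_i ↦ t̃_{-i}`. -/
def BPlus.negHom (n : ℕ) (k k' : ℤ) (h : k' = -k) : BPlus n k →* BPlus n k' :=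
  PresentedMonoid.lift (rels := BPlusRel n k) (fun y => PresentedMonoid.of _ (negT y)) (by
    intro a b hab
    cases hab with
    | braid_s i j h =>
      simp only [map_mul, FreeMonoid.lift_eval_of, negT]
      exact PresentedMonoid.mk_eq_mk_of_rel (BPlusRel.braid_s i j h)
    | comm_s i j h =>
      simp only [map_mul, FreeMonoid.lift_eval_of, negT]
      exact PresentedMonoid.mk_eq_mk_of_rel (BPlusRel.comm_s i j h)
    | braid_t j hj i =>
      simp only [map_mul, FreeMonoid.lift_eval_of, negT]
      exact PresentedMonoid.mk_eq_mk_of_rel (BPlusRel.braid_t j hj (-i))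
    | comm_t j hj i =>
      simp only [map_mul, FreeMonoid.lift_eval_of, negT]
      exact PresentedMonoid.mk_eq_mk_of_rel (BPlusRel.comm_t j hj (-i))
    | dual i j =>
      have e : ∀ i, -(i - k) = -i - k' := fun i => by omega
      simp only [map_mul, FreeMonoid.lift_eval_of, negT, e]
      exact PresentedMonoid.mk_eq_mk_of_rel (BPlusRel.dual (-i) (-j)))

/-- The monoids `B^{⊕k}(∞,∞,n)` and `B^{⊕(-k)}(∞,∞,n)` are isomorphic. -/
def BPlus.negEquiv (n : ℕ) (k : ℤ) : BPlus n k ≃* BPlus n (-k) :=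
  MonoidHom.toMulEquiv (negHom n k (-k) rfl) (negHom n (-k) k (neg_neg k).symm)
    (PresentedMonoid.ext _ fun y => congrArg (PresentedMonoid.of _) (negT_negT y))
    (PresentedMonoid.ext _ fun y => congrArg (PresentedMonoid.of _) (negT_negT y))

variable {N : ℕ} {H : Type*} [Group H]

/-- The images of the generators of `B^{⊕1}(∞,∞,N+2)`. -/
def dualMap (r : ℕ → H) (T : ℤ → H) : Gen ℤ (N + 2) → H
  | .t i => T i
  | .s j => r (j.val - 3)

/-- A family satisfying Shi's relations defines a homomorphism from `B^{⊕1}(∞,∞,N+2)`. -/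
def BPlus.lift {r : ℕ → H} {T : ℤ → H} (h : IsShiFamily N r (T 0) (T 1))
    (hT : ∀ i, T (i + 1) * T i = T 1 * T 0) : BPlus (N + 2) 1 →* H :=
  PresentedMonoid.lift (rels := BPlusRel (N + 2) 1) (dualMap r T) (by
    intro a b hab
    cases hab with
    | braid_s i j hij =>
      obtain ⟨i, hi, hi'⟩ := i
      obtain ⟨j, hj, hj'⟩ := j
      obtain ⟨i, rfl⟩ := Nat.exists_eq_add_of_le' hi
      obtain ⟨j, rfl⟩ := Nat.exists_eq_add_of_le' hj
      simp only [map_mul, FreeMonoid.lift_eval_of, dualMap, Nat.add_sub_cancel]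
      rcases hij with hij | hij
      · obtain rfl : j = i + 1 := by simp only at hij; omega
        exact h.braid i (by omega)
      · obtain rfl : i = j + 1 := by simp only at hij; omega
        exact (h.braid j (by omega)).symm
    | comm_s i j hij =>
      simp only [map_mul, FreeMonoid.lift_eval_of, dualMap]
      have := i.2
      have := j.2
      rcases hij with hij | hij
      · exact h.comm _ _ (by omega) (by omega)
      · exact (h.comm _ _ (by omega) (by omega)).symm
    | braid_t j hj i =>
      have := j.2
      simp only [map_mul, FreeMonoid.lift_eval_of, dualMap, hj]
      have hN : 0 < N := by omega
      exact braid_dual_sequence hT (h.braid_zero hN) (h.braid_one hN) (h.six hN) i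
    | comm_t j hj i =>
      have := j.2
      simp only [map_mul, FreeMonoid.lift_eval_of, dualMap]
      exact commute_dual_sequence hT (h.comm_zero _ (by omega) (by omega))
        (h.comm_one _ (by omega) (by omega)) i
    | dual i j =>
      simp only [map_mul, FreeMonoid.lift_eval_of, dualMap]
      have h1 : ∀ i, T i * T (i - 1) = T 1 * T 0 := fun i => by
        have := hT (i - 1)
        rwa [sub_add_cancel] at this
      rw [h1, h1])

/-- The generators `s̃_3, …, s̃_n` of the group of fractions, numbered from `0`. -/
def fracS (N m : ℕ) : BFrac (N + 2) 1 :=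
  if h : m < N then FractionGroup.of _ (PresentedMonoid.of _ (.s ⟨m + 3, by omega, by omega⟩))
  else 1

/-- The generators `t̃_i` of the group of fractions. -/
def fracT (N : ℕ) (i : ℤ) : BFrac (N + 2) 1 := FractionGroup.of _ (PresentedMonoid.of _ (.t i))

theorem BFrac.eq_of_rel {n : ℕ} {k : ℤ} {a b : FreeMonoid (Gen ℤ n)} (h : BPlusRel n k a b) :
    FractionGroup.of (BPlus n k) (PresentedMonoid.mk _ a) =
      FractionGroup.of (BPlus n k) (PresentedMonoid.mk _ b) :=
  congrArg _ (PresentedMonoid.mk_eq_mk_of_rel h)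

theorem fracT_mul (i : ℤ) : fracT N (i + 1) * fracT N i = fracT N 1 * fracT N 0 := by
  have := BFrac.eq_of_rel (BPlusRel.dual (n := N + 2) (k := 1) (i + 1) 1)
  rw [add_sub_cancel_right, sub_self] at this
  simp only [map_mul] at this
  exact this

theorem braid_fracT (hN : 0 < N) (i : ℤ) : Braid (fracS N 0) (fracT N i) := by
  rw [fracS, dif_pos hN]
  have := BFrac.eq_of_rel (BPlusRel.braid_t (n := N + 2) (k := 1) ⟨3, by omega, by omega⟩ rfl i)
  simp only [map_mul] at this
  exact this

theorem commute_fracT {m : ℕ} (hm : 0 < m) (hN : m < N) (i : ℤ) :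
    Commute (fracS N m) (fracT N i) := by
  rw [fracS, dif_pos hN]
  have := BFrac.eq_of_rel (BPlusRel.comm_t (n := N + 2) (k := 1) ⟨m + 3, by omega, by omega⟩
    (by simp only; omega) i)
  simp only [map_mul] at this
  exact this

theorem isShiFamily_BFrac (N : ℕ) : IsShiFamily N (fracS N) (fracT N 0) (fracT N 1) where
  braid m hm := by
    rw [fracS, fracS, dif_pos (by omega), dif_pos hm]
    have := BFrac.eq_of_rel (BPlusRel.braid_s (n := N + 2) (k := 1) ⟨m + 3, by omega, by omega⟩
      ⟨m + 1 + 3, by omega, by omega⟩ (Or.inl rfl))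
    simp only [map_mul] at this
    exact this
  comm i j hij hj := by
    rw [fracS, fracS, dif_pos (by omega), dif_pos hj]
    have := BFrac.eq_of_rel (BPlusRel.comm_s (n := N + 2) (k := 1) ⟨i + 3, by omega, by omega⟩
      ⟨j + 3, by omega, by omega⟩ (Or.inl (by simp only; omega)))
    simp only [map_mul] at this
    exact this
  braid_zero hN := braid_fracT hN 0
  braid_one hN := braid_fracT hN 1
  comm_zero m hm hN := commute_fracT hm hN 0
  comm_one m hm hN := commute_fracT hm hN 1
  six hN := by
    -- Conversely, the six-letter relation is the braid relation of `s̃_3` with `t̃_2`, the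
    -- conjugate of `t̃_0` by `t̃_1`.
    rw [← braid_mul_conj_iff (braid_fracT hN 0) (braid_fracT hN 1), ← fracT_mul 1,
      mul_inv_cancel_right]
    exact braid_fracT hN _

/-- The group of fractions of `B^{⊕1}(∞,∞,N+2)` is `B(∞,∞,N+2)`. -/
theorem nonempty_BFrac_one_mulEquiv (N : ℕ) : Nonempty (BFrac (N + 2) 1 ≃* BInf (N + 2)) := by
  obtain ⟨T, hT0, hT1, hT⟩ := exists_dual_sequence (shiT N 0) (shiT N 1)
  have hS : IsShiFamily N (shiS N) (T 0) (T 1) := by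
    rw [hT0, hT1]
    exact isShiFamily_BInf N
  rw [← hT0, ← hT1] at hT
  have hF := isShiFamily_BFrac N
  let f : BFrac (N + 2) 1 →* BInf (N + 2) := FractionGroup.lift (BPlus.lift hS hT)
  let g : BInf (N + 2) →* BFrac (N + 2) 1 := BInf.lift hF
  have hfT : ∀ i, f (fracT N i) = T i := fun i => FractionGroup.lift_of _ _
  have hfS : ∀ m < N, f (fracS N m) = shiS N m := fun m hm => by
    rw [fracS, dif_pos hm]
    exact FractionGroup.lift_of _ _
  have hgT : ∀ i, g (T i) = fracT N i := by
    -- Both sequences have the same constant product and agree at 0, and these data determine all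
    -- terms.
    refine dual_sequence_ext (T := fun i => g (T i)) (c := fracT N 1 * fracT N 0) (fun i => ?_)
      fracT_mul ?_
    · rw [← map_mul, hT, hT0, hT1, map_mul]
      rw [show g (shiT N 1) = _ from BInf.lift_shiT_one hF,
        show g (shiT N 0) = _ from BInf.lift_shiT_zero hF]
    · simp only [hT0]
      exact BInf.lift_shiT_zero hF
  refine ⟨MonoidHom.toMulEquiv f g (FractionGroup.hom_ext fun x => ?_) (BInf.hom_ext ?_ ?_ ?_)⟩
  · have : ((g.comp f).comp (FractionGroup.of _)) = FractionGroup.of (BPlus (N + 2) 1) := by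
      refine PresentedMonoid.ext _ fun y => ?_
      cases y with
      | t i => exact (congrArg g (hfT i)).trans (hgT i)
      | s j =>
        obtain ⟨j, hj, hj'⟩ := j
        obtain ⟨j, rfl⟩ := Nat.exists_eq_add_of_le' hj
        have h1 : fracS N j = FractionGroup.of _ (PresentedMonoid.of _ (.s ⟨j + 3, hj, hj'⟩)) := by
          rw [fracS, dif_pos (by omega)]
        have h2 : g (f (fracS N j)) = fracS N j := by
          rw [hfS j (by omega)]
          exact BInf.lift_shiS hF (by omega)
        rw [h1] at h2
        exact h2
    exact DFunLike.congr_fun this x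
  · exact (congrArg f (BInf.lift_shiT_zero hF)).trans ((hfT 0).trans hT0)
  · exact (congrArg f (BInf.lift_shiT_one hF)).trans ((hfT 1).trans hT1)
  · exact fun m hm => (congrArg f (BInf.lift_shiS hF hm)).trans (hfS m hm)

theorem nonempty_BFrac_mulEquiv (N : ℕ) {k : ℤ} (hk : k = 1 ∨ k = -1) :
    Nonempty (BFrac (N + 2) k ≃* BInf (N + 2)) := by
  obtain ⟨e⟩ := nonempty_BFrac_one_mulEquiv N
  rcases hk with rfl | rfl
  · exact ⟨e⟩
  · exact ⟨(FractionGroup.congr (BPlus.negEquiv (N + 2) 1)).symm.trans e⟩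

end FractionGroupOfBPlus

/-! ### Atoms of interval monoids -/

section Irreducible

variable {W : Type*} [Group W] {S : Set W} {w : W}

/-- The length is then invariant under conjugation, and `v⁻¹ w` and `w v⁻¹` are conjugate by `v`. -/
theorem isBalanced_of_conj_mem (hS : Submonoid.closure S = ⊤)
    (hconj : ∀ g : W, ∀ x ∈ S, g * x * g⁻¹ ∈ S) : IsBalanced S w := by
  have key : ∀ g v : W, wordLength S (g * v * g⁻¹) ≤ wordLength S v := fun g v => by
    obtain ⟨l, hl, rfl, hlen⟩ := exists_reduced_word hS v
    have h := map_list_prod (MulAut.conj g) l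
    rw [MulAut.conj_apply] at h
    rw [h, ← hlen, ← List.length_map (f := MulAut.conj g)]
    refine wordLength_prod_le fun x hx => ?_
    obtain ⟨y, hy, rfl⟩ := List.mem_map.mp hx
    exact hconj g y (hl y hy)
  ext v
  rw [mem_interval_iff, mem_intervalR_iff, precedes_iff, PrecedesR]
  have h1 := key v (v⁻¹ * w)
  have h2 := key v⁻¹ (w * v⁻¹)
  simp only [mul_inv_cancel_left, inv_inv, mul_assoc, inv_mul_cancel, mul_one] at h1 h2
  omega

theorem IntervalMonoid.isUnit_iff (hS : Submonoid.closure S = ⊤) {x : IntervalMonoid S w} :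
    IsUnit x ↔ x = 1 := by
  refine ⟨fun h => ?_, fun h => h ▸ isUnit_one⟩
  obtain ⟨y, hy⟩ := h.exists_right_inv
  have h1 := congrArg (fun z => (IntervalMonoid.length S w z).toAdd) hy
  simp only [map_mul, toAdd_mul, map_one, toAdd_one, Nat.add_eq_zero_iff] at h1
  exact (IntervalMonoid.length_eq_one_iff hS).mp (toAdd_eq_zero.mp h1.1)

theorem IntervalMonoid.irreducible_of_length_eq (hS : Submonoid.closure S = ⊤)
    {x : IntervalMonoid S w} (hx : (IntervalMonoid.length S w x).toAdd = 1) : Irreducible x := by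
  refine ⟨fun h => ?_, fun a b hab => ?_⟩
  · rw [(isUnit_iff hS).mp h, map_one] at hx
    exact absurd hx (by simp)
  · rw [isUnit_iff hS, isUnit_iff hS, ← length_eq_one_iff hS, ← length_eq_one_iff hS,
      ← toAdd_eq_zero, ← toAdd_eq_zero]
    rw [hab, map_mul, toAdd_mul] at hx
    omega

theorem IsBalanced.toIntervalMonoid_mul_quotient (hb : IsBalanced S w)
    (hS : Submonoid.closure S = ⊤) {u : W} (v : interval S w) (h : Precedes S u v) :
    ∃ hu : u ∈ interval S w, ∃ hq : u⁻¹ * v ∈ interval S w,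
      toIntervalMonoid S w v = toIntervalMonoid S w ⟨u, hu⟩ * toIntervalMonoid S w ⟨_, hq⟩ := by
  refine ⟨mem_interval_of_precedes hS h v.2, hb.right_mem hS (a := u) (by simp)
    (by simpa using precedes_iff.mp h), ?_⟩
  exact (toIntervalMonoid_mul _ _ _ (by simp) (precedes_iff.mp h)).symm

theorem wordLength_eq_one (hS : Submonoid.closure S = ⊤) {y : W} (hy : y ∈ S) (hy1 : y ≠ 1) :
    wordLength S y = 1 := by
  have h1 := wordLength_prod_le (S := S) (l := [y]) (by simpa using hy)
  have h2 := mt (wordLength_eq_zero_iff hS).mp hy1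
  simp only [List.prod_cons, List.prod_nil, mul_one, List.length_cons, List.length_nil] at h1
  omega

/-- The irreducible elements of an interval monoid are the generators in the interval. -/
theorem IntervalMonoid.exists_of_irreducible (hb : IsBalanced S w)
    (hS : Submonoid.closure S = ⊤) {x : IntervalMonoid S w} (hx : Irreducible x) :
    ∃ v : interval S w, x = toIntervalMonoid S w v ∧ wordLength S (v : W) = 1 := by
  induction x using IntervalMonoid.induction with
  | one => exact absurd isUnit_one hx.not_isUnit
  | mul a x ih =>
    rcases hx.isUnit_or_isUnit rfl with h | h
    · rw [isUnit_iff hS] at h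
      rw [h, one_mul] at hx ⊢
      exact ih hx
    · rw [isUnit_iff hS] at h
      rw [h, mul_one] at hx ⊢
      have ha : (a : W) ≠ 1 := fun ha => hx.not_isUnit ((isUnit_iff hS).mpr
        ((congrArg (toIntervalMonoid S w) (Subtype.ext ha)).trans toIntervalMonoid_one))
      obtain ⟨y, hy, hy1, hya⟩ := exists_precedes_of_ne_one hS ha
      obtain ⟨hu, hq, h⟩ := hb.toIntervalMonoid_mul_quotient hS a hya
      have hyl := wordLength_eq_one hS hy hy1
      refine ⟨⟨y, hu⟩, ?_, hyl⟩
      rcases hx.isUnit_or_isUnit h with h' | h'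
      · rw [isUnit_iff hS] at h'
        have := congrArg (fun z => (IntervalMonoid.length S w z).toAdd) h'
        simp [hyl] at this
      · rw [isUnit_iff hS] at h'
        rw [h, h', mul_one]

theorem IntervalMonoid.length_eq_of_irreducible (hb : IsBalanced S w)
    (hS : Submonoid.closure S = ⊤) {x : IntervalMonoid S w} (hx : Irreducible x) :
    (IntervalMonoid.length S w x).toAdd = 1 := by
  obtain ⟨v, rfl, hv⟩ := exists_of_irreducible hb hS hx
  simpa using hv

/-- The additive length makes factorization terminate: both factors of a proper factorization have
positive, hence smaller, length. -/
theorem IntervalMonoid.exists_irreducible_list (hS : Submonoid.closure S = ⊤)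
    (x : IntervalMonoid S w) :
    ∃ l : List (IntervalMonoid S w), (∀ a ∈ l, Irreducible a) ∧ l.prod = x := by
  induction hd : (IntervalMonoid.length S w x).toAdd using Nat.strong_induction_on generalizing x
  rename_i d ih
  by_cases hx : Irreducible x
  · exact ⟨[x], by simpa using hx, by simp⟩
  by_cases hu : IsUnit x
  · exact ⟨[], by simp, by simp [(isUnit_iff hS).mp hu]⟩
  rw [irreducible_iff] at hx
  push Not at hx
  obtain ⟨a, b, rfl, ha, hb⟩ := hx hu
  rw [isUnit_iff hS, ← length_eq_one_iff hS, ← toAdd_eq_zero] at ha hb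
  rw [map_mul, toAdd_mul] at hd
  obtain ⟨l, hl, rfl⟩ := ih _ (by omega) a rfl
  obtain ⟨m, hm, rfl⟩ := ih _ (by omega) b rfl
  exact ⟨l ++ m, fun c hc => (List.mem_append.mp hc).elim (hl c) (hm c), by simp⟩

/-- Isomorphisms between interval monoids preserve the length. -/
theorem IntervalMonoid.length_mulEquiv {W' : Type*} [Group W'] {S' : Set W'} {w' : W'}
    (hb : IsBalanced S w) (hS : Submonoid.closure S = ⊤) (hb' : IsBalanced S' w')
    (hS' : Submonoid.closure S' = ⊤) (e : IntervalMonoid S w ≃* IntervalMonoid S' w')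
    (x : IntervalMonoid S w) :
    IntervalMonoid.length S' w' (e x) = IntervalMonoid.length S w x := by
  obtain ⟨l, hl, rfl⟩ := exists_irreducible_list hS x
  induction l with
  | nil => simp
  | cons a l ih =>
    have ha := hl a (by simp)
    rw [List.prod_cons, map_mul, map_mul, map_mul, ih fun b hb => hl b (by simp [hb])]
    congr 1
    exact Multiplicative.toAdd.injective ((length_eq_of_irreducible hb' hS'
      ((MulEquiv.irreducible_iff e).mpr ha)).trans (length_eq_of_irreducible hb hS ha).symm)

end Irreducible

/-! ### Comparison with dual monoids -/

namespace GInf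

variable {n : ℕ} [hn : Fact (2 ≤ n)] {k : ℤ}

theorem length_lam (hk : k = 1 ∨ k = -1) : wordLength (genX n) (lam n ^ k) + n = n * n := by
  -- Every off-diagonal weight is 2; the correction on the diagonal makes the double sum equal to `2
  -- n²`.
  have h1 : ∀ i j, weight (lam n ^ k) i j + (if i = j then 2 else 0) = 2 := fun i j => by
    have key : ∀ i j, i < j → weight (lam n ^ k) i j = 2 := fun i j hij => by
      rw [weight_of_lt _ hij, perm_lam_zpow hk, exp_lam_zpow hk hij, Equiv.Perm.one_apply,
        Equiv.Perm.one_apply, if_pos hij, if_neg (by omega)]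
    rcases lt_trichotomy i j with h | rfl | h
    · simp [key i j h, h.ne]
    · simp [weight_self]
    · simp [weight_comm _ i j, key j i h, h.ne']
  have h2 : height (lam n ^ k) + ∑ i : Fin n, ∑ j : Fin n, (if i = j then 2 else 0) =
      ∑ i : Fin n, ∑ j : Fin n, 2 := by
    simp only [height, ← Finset.sum_add_distrib, h1]
  simp only [Finset.sum_ite_eq, Finset.mem_univ, if_true, Finset.sum_const, Finset.card_univ,
    Fintype.card_fin, smul_eq_mul, ← two_mul_length] at h2
  rw [← mul_assoc] at h2
  omega

/-- Having all generators as descents forces the permutation to increase and the exponents outside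
row 0 to be nonzero, hence equal to `k` inside the interval. -/
theorem lam_precedes_of_forall_isDescent (hk : k = 1 ∨ k = -1) {v : GInf n}
    (hv : v ∈ interval (genX n) (lam n ^ k)) (h : ∀ y, IsDescent y v) :
    Precedes (genX n) (lam n ^ k) v := by
  have h2 := hn.out
  have key : ∀ k, (hk : k + 1 < n) →
      perm v ⟨k, by omega⟩ < perm v ⟨k + 1, hk⟩ ∧ exp v ⟨k + 1, hk⟩ ≠ 0 := by
    intro k
    induction k with
    | zero =>
      intro hk
      -- The index is chosen to miss the exponent in row 0, so this descent can only come from rows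
      -- in order.
      have h0 := h (.t (1 - exp v ⟨0, by omega⟩))
      simp only [IsDescent, lo, hi, row, shift] at h0
      exact h0.resolve_right fun h1 => by omega
    | succ k ih =>
      intro hk
      have h0 := h (.s ⟨k + 3, by omega, by omega⟩)
      have h4 := (ih (by omega)).2
      simp only [IsDescent, lo, hi, row, shift, neg_zero, Nat.reduceSubDiff] at h0
      exact h0.resolve_right fun h1 => h4 h1.2
  obtain ⟨m, rfl⟩ : ∃ m, n = m + 1 := ⟨n - 1, by omega⟩
  have hmono : StrictMono (perm v) := Fin.strictMono_iff_lt_succ.mpr fun i =>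
    (key i.val (by omega)).1
  rw [precedes_iff_pairLE]
  intro i j hij
  have hj : exp v j ≠ 0 := by
    obtain ⟨j, rfl⟩ := Fin.exists_succ_eq.mpr ((Fin.zero_le i).trans_lt hij).ne'
    exact (key j.val (by omega)).2
  simp only [PairLE, perm_lam_zpow hk, exp_lam_zpow hk hij, Equiv.Perm.one_apply]
  exact ⟨fun _ => Or.inr ⟨hmono hij, (((mem_interval_lam hk).mp hv i j hij
    (hmono hij)).resolve_left hj).symm⟩, fun h => absurd h hij.not_gt⟩

theorem interval_lam_ne :
    interval (genX n) (lam n ^ (1 : ℤ)) ≠ interval (genX n) (lam n ^ (-1 : ℤ)) := by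
  intro h
  have h1 := self_mem_interval (genX n) (lam n ^ (1 : ℤ))
  have hlt := lo_lt_hi (.t 0 : Gen ℤ n)
  rw [h, mem_interval_lam (Or.inr rfl)] at h1
  have h2 := h1 _ _ hlt (by rw [perm_lam_zpow (Or.inl rfl)]; exact hlt)
  rw [exp_lam_zpow (Or.inl rfl) hlt] at h2
  omega

/-- The interval monoid of a balanced element of length at most `n` is not isomorphic to the
interval monoid of `[1, λ^k]` if `n ≥ 3`. -/
theorem isEmpty_mulEquiv_of_length_le (h3 : 3 ≤ n) (hk : k = 1 ∨ k = -1) {W : Type*} [Group W]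
    {S : Set W} {c : W} (hb : IsBalanced S c) (hS : Submonoid.closure S = ⊤)
    (hc : wordLength S c ≤ n) :
    IsEmpty (IntervalMonoid (genX n) (lam n ^ k) ≃* IntervalMonoid S c) := by
  refine ⟨fun e => ?_⟩
  have H := isLeftGarsideInterval_lam (n := n) hk
  -- Let `x` correspond to `c`. Every atom on the dual side is a prefix of `c`, so every generator
  -- divides `x` and hence precedes `lead x`; thus `λ^k` does too, which is impossible as `x` has
  -- length at most `n`.
  set x := e.symm (toIntervalMonoid S c ⟨c, self_mem_interval S c⟩) with hx
  have hlen := IntervalMonoid.length_mulEquiv hb hS H.balanced H.generates e.symm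
    (toIntervalMonoid S c ⟨c, self_mem_interval S c⟩)
  have hlead : wordLength (genX n) (H.lead x : GInf n) ≤ wordLength S c := by
    rw [← hx, ← H.lead_mul_rest x, map_mul, IntervalMonoid.length_of, IntervalMonoid.length_of]
      at hlen
    exact Nat.le.intro (congrArg Multiplicative.toAdd hlen)
  have hdesc : ∀ y, IsDescent y (H.lead x : GInf n) := fun y => by
    rw [← gen_precedes_iff]
    refine (H.of_dvd_iff (a := ⟨gen y, gen_mem_interval hk y⟩)).mp ?_
    have hirr : Irreducible (simpleGen hk y) :=
      IntervalMonoid.irreducible_of_length_eq H.generates (length_gen y)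
    obtain ⟨v, hv, -⟩ := IntervalMonoid.exists_of_irreducible hb hS
      ((MulEquiv.irreducible_iff e).mpr hirr)
    obtain ⟨hu, hq, h⟩ := hb.toIntervalMonoid_mul_quotient hS ⟨c, self_mem_interval S c⟩
      (mem_interval_iff.mp v.2)
    refine ⟨e.symm (toIntervalMonoid S c ⟨_, hq⟩), ?_⟩
    rw [hx, h, map_mul]
    congr 1
    rw [MulEquiv.symm_apply_eq]
    exact hv.symm
  have hle := (lam_precedes_of_forall_isDescent hk (H.lead x).2 hdesc).wordLength_le
  have hl := length_lam (n := n) hk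
  have : 3 * n ≤ n * n := Nat.mul_le_mul_right n h3
  omega

end GInf

theorem closure_affineReflections (n : ℕ) : Submonoid.closure (affineReflections n) = ⊤ := by
  rw [eq_top_iff, ← (affineA n).toCoxeterSystem.submonoid_closure_range_simple]
  refine Submonoid.closure_mono ?_
  rintro _ ⟨i, rfl⟩
  exact (affineA n).toCoxeterSystem.isReflection_simple i

theorem isBalanced_affineReflections (n : ℕ) (c : (affineA n).Group) :
    IsBalanced (affineReflections n) c :=
  isBalanced_of_conj_mem (closure_affineReflections n) fun g _ hx => hx.conj g

theorem IsCoxeterElement.wordLength_le {n : ℕ} {c : (affineA n).Group}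
    (hc : IsCoxeterElement n c) : wordLength (affineReflections n) c ≤ n := by
  obtain ⟨σ, rfl⟩ := hc
  refine (wordLength_prod_le fun x hx => ?_).trans (by simp)
  obtain ⟨i, rfl⟩ := (List.mem_ofFn' _ _).mp hx
  exact (affineA n).toCoxeterSystem.isReflection_simple (σ i)

theorem mainTheorem2 (n : ℕ) (hn : 2 ≤ n) :
    -- for `k = ± 1`, the group of fractions of `B^{⊕k}(∞,∞,n)` exists and is `B(∞,∞,n)`
    (∀ k : ℤ, k = 1 ∨ k = -1 →
      IsFractionEmbedding (FractionGroup.of (BPlus n k)) ∧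
      Nonempty (BFrac n k ≃* BInf n)) ∧
    -- `B(∞,∞,n)` is the affine Artin group of type `Ã_{n-1}`
    Nonempty (BInf n ≃* ArtinGroup (affineA n)) ∧
    -- the interval `[1, λ^k]` gives an interval Garside structure for this Artin group
    (∀ k : ℤ, k = 1 ∨ k = -1 →
      IsIntervalGarside (genX n) (lam n ^ k) ∧
      Nonempty (BPlus n k ≃* IntervalMonoid (genX n) (lam n ^ k)) ∧
      IsFractionEmbedding (FractionGroup.of (IntervalMonoid (genX n) (lam n ^ k))) ∧
      Nonempty (FractionGroup (IntervalMonoid (genX n) (lam n ^ k)) ≃*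
        ArtinGroup (affineA n))) ∧
    -- the two intervals are different
    interval (genX n) (lam n ^ (1 : ℤ)) ≠ interval (genX n) (lam n ^ (-1 : ℤ)) ∧
    -- neither structure comes from a dual presentation
    (3 ≤ n → ∀ k : ℤ, k = 1 ∨ k = -1 → ∀ c : (affineA n).Group, IsCoxeterElement n c →
      IsEmpty (IntervalMonoid (genX n) (lam n ^ k) ≃*
        IntervalMonoid (affineReflections n) c)) := by
  have : Fact (2 ≤ n) := ⟨hn⟩
  obtain ⟨N, rfl⟩ := Nat.exists_eq_add_of_le' hn
  have hG : ∀ k : ℤ, k = 1 ∨ k = -1 → IsIntervalGarside (genX (N + 2)) (lam (N + 2) ^ k) :=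
    -- The right-hand properties for `λ^k` are the left-hand ones for `λ^{-k}`.
    fun k hk => (GInf.isLeftGarsideInterval_lam hk).isIntervalGarside GInf.inv_mem_genX
      (by rw [← zpow_neg]; exact GInf.isLeftGarsideInterval_lam (by omega))
  obtain ⟨a⟩ := nonempty_BInf_mulEquiv N
  refine ⟨fun k hk => ?_, ⟨a⟩, fun k hk => ?_, GInf.interval_lam_ne, fun h3 k hk c hc => ?_⟩
  · obtain ⟨e⟩ := GInf.nonempty_BPlus_mulEquiv (n := N + 2) hk
    exact ⟨(hG k hk).garside.isFractionEmbedding_of_mulEquiv e, nonempty_BFrac_mulEquiv N hk⟩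
  · obtain ⟨e⟩ := GInf.nonempty_BPlus_mulEquiv (n := N + 2) hk
    obtain ⟨b⟩ := nonempty_BFrac_mulEquiv N hk
    exact ⟨hG k hk, ⟨e⟩, (hG k hk).garside.isFractionEmbedding_of_mulEquiv (MulEquiv.refl _),
      ⟨((FractionGroup.congr e).symm.trans b).trans a⟩⟩
  · exact GInf.isEmpty_mulEquiv_of_length_le h3 hk (isBalanced_affineReflections _ c)
      (closure_affineReflections _) hc.wordLength_le
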